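/- **Setting.** Let $\mathcal Y=[\underline y,\overline y]$ with $\underline y<\overline y$, let $\mathcal M$ be a set of probability measures on $\mathcal Y$ (the admissible measures), let $\mathcal J$ be a real-valued index of probability measures on $\mathcal Y$, and put $F(\mu;\pi,q)=\mathcal J((1-\pi)\mu+\pi q)$ for $\pi\in[0,1]$ and a probability measure $q$ on $\mathcal Y$. For each $n$ there are finitely many constraint rows, equalities $\int f_{i,n}(y;\theta)\,d\mu=c_i$ and inequalities $\int f_{i,n}(y;\theta)\,d\mu\le c_i$ (group-share restrictions are such rows, with $f$ equal to $\pm$ the indicator of a group); $\mathcal C_n(c,\theta)$ is the set of $\mu\in\mathcal M$ satisfying them. Write $u=(c,\theta)$ and $u_n^*=(c_0,\theta_0)$. For a number $k$ of support points, let $X_k$ be the set of $x=(p,z)$ with $p$ in the $k$-dimensional simplex and $z\in\mathcal Y^k$, $z_1\le\dots\le z_k$; put $\mu_x=\sum_j p_j\delta_{z_j}$ and $\Phi(x;\pi,q)=F(\mu_x;\pi,q)$. The value $V^{(k)}_{n,\bullet}(c,\theta;\pi,q)$ is the minimum ($\bullet=\min$) or maximum ($\bullet=\max$), in general the infimum or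 supremum, of $\Phi(x;\pi,q)$ over the feasible $x\in X_k$, i.e. those with $\mu_x\in\mathcal C_n(c,\theta)$. Assume that for some $r_0>0$ and $L$ one has $|F(\mu;\pi,q)-F(\nu;\pi,q)|\le L\,W_1(\mu,\nu)$ for all $\mu,\nu\in\mathcal M$ and all $(\pi,q)$ in the neighbourhood $\mathcal N=\{|\pi-\pi_0|<r_0,\ \|q-q_0\|_{BL^*}<r_0\}$, where $\|\cdot\|_{BL^*}$ is the supremum over $1$-Lipschitz functions bounded by $1$. A map is Hadamard directionally differentiable at $w_0$ with derivative $D$ if $(\varphi(w_m)-\varphi(w_0))/t_m\to D[h]$ whenever $t_m\downarrow0$, the $w_m$ lie in the domain and $(w_m-w_0)/t_m\to h$. Then the following hold. **(i)** There are $K<\infty$ and $r>0$, independent of $n$, $k$ and $(\pi,q)$, such that, for every optimizer $x^*$ of a minimization or maximization problem as above (at any $(c,\theta)$ and any parameters in $\mathcal N$), every $(\pi,q)\in\mathcal N$, and all $x=(p,z)$, $x'=(p',z')$ in $X_k$ within $r$ of $x^*$ with $\mu_x,\mu_{x'}\in\mathcal M$, $$|\Phi(x;\pi,q)-\Phi(x';\pi,q)|\le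 K\,(\|p-p'\|_1+\|z-z'\|_\infty).$$ **(ii)** Assume that, for $\theta$ in a fixed neighbourhood of $\theta_0$, the integrands $f_{i,n}(\cdot;\theta)$ are piecewise Lipschitz with finitely many knots $\mathcal T_n(\theta)$, depending continuously on $\theta$, and a common Lipschitz constant; that for every $\delta>0$, at outcomes at distance at least $\delta$ from $\mathcal T_n(\theta)$, they are $C^1$ in the parameter on the $\delta$-ball around $\theta$, with derivative at $\theta$ and quadratic Taylor remainder bounded by a constant $L_\theta(\delta)$; and that they are uniformly bounded (all constants independent of $n,i,\theta$). Fix $\bullet\in\{\min,\max\}$, $k$ and $(\pi,q)\in\mathcal N$. Suppose that for every $n$ there are $x_n^*=(p_n^*,z_n^*)$ and multipliers $\lambda_n^*$ satisfying the following regularity conditions, with constants $r,\varepsilon,\sigma,\kappa>0$ and $B$ independent of $n$. * (Smooth program) There are nondegenerate intervals (cells) $[l_j,h_j]\subset\mathcal Y$ such that for $(u,x)$ near $(u_n^*,x_n^*)$ every feasible $x$ has $z_j\in[l_j,h_j]$ for all $j$ (for instance $[l_j,h_j]=\mathcal Y$). The constraints of the program are the rows $c_i(x,u)=c_i-\sum_jp_jf_{i,n}(z_j;\theta)$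 ($=0$ or $\ge0$), $\sum_jp_j=1$, $p_j\ge0$, $l_j\le z_j\le h_j$ and $z_j\le z_{j+1}$. Within the cells and near $x_n^*$: $\mu_x\in\mathcal M$ and $\Phi(\cdot;\pi,q)$ is $C^2$; for rows active at $x_n^*$, $f_{i,n}$ is $C^2$ in the outcome at $\theta_0$ and jointly $C^1$ in (outcome, $\theta$) near each $(z^*_{n,j},\theta_0)$; for inactive rows it is jointly continuous there. * (Optimizer and KKT pair) $x_n^*$ is the unique optimizer at $u_n^*$, and $(x_n^*,\lambda_n^*)$ is a locally unique KKT pair at $u_n^*$ for the Lagrangian $\Phi+\sum_i\lambda_ic_i$, with inequality multipliers $\ge0$ for $\max$ and $\le0$ for $\min$. * (Slater) For every $u$ with $\|u-u_n^*\|\le r$ some feasible point satisfies all inequality rows with slack at least $\varepsilon$. * (LICQ) The Jacobian at $x_n^*$ of the active constraints has minimal singular value at least $\sigma$. * (SOSC) For all $v$ in the critical cone at $(x_n^*,\lambda_n^*)$, $v^\top\nabla^2_{xx}\mathcal L\,v\le-\kappa\|v\|^2$ for $\max$, and $\ge\kappa\|v\|^2$ for $\min$, where $\mathcal L$ is the Lagrangian.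 * (Compactness) For $\|u-u_n^*\|\le r$ the feasible set is nonempty, and the set of pairs $(u,x)$ with $\|u-u_n^*\|\le r$ and $x$ feasible at $u$ is compact. * (Differentiability of active rows) For every row with $\lambda_{n,i}^*\neq0$, $u\mapsto c_i(x_n^*,u)$ is Hadamard directionally differentiable at $u_n^*$ with a linear derivative of norm at most $B$. Then there is $C<\infty$ independent of $n$ such that, for every $n$, the map $(c,\theta)\mapsto V^{(k)}_{n,\bullet}(c,\theta;\pi,q)$ is Hadamard directionally differentiable at $u_n^*$, with a linear derivative of norm at most $C$ (sup norm on $c$, Euclidean norm on $\theta$), given by $$DV^{(k)}_{n,\bullet}(u_n^*)[h]=\sum_{i:\ \lambda^*_{n,i}\ne0}\lambda^*_{n,i}\Big(\langle e_i,h_c\rangle-\sum_j D_\theta f_{i,n}(z^*_{n,j};\theta_0)[h_\theta]\;p^*_{n,j}\Big),\qquad h=(h_c,h_\theta),$$ the sum running over the rows. **(iii)** Let $\bullet\in\{\min,\max\}$, let $n,k$ be arbitrary, let $\rho>0$, and fix $(c,\theta)$ with $\|(c,\theta)-u_n^*\|<\rho$. Call $\mu$ nearly feasible if $\mu\in\mathcal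 C_n(u)$ for some $u$ with $\|u-u_n^*\|<\rho$. Below, all derivatives are required to be continuous in the direction, $\pi$ ranges over $[0,1]$, $q$ over the probability measures on $\mathcal Y$, and directions of $q$ are taken with respect to $\|\cdot\|_{BL^*}$. * If $\pi\mapsto F(\mu;\pi,q_0)$ is Hadamard directionally differentiable at $\pi_0$ uniformly over nearly feasible $\mu$, then $\pi\mapsto V^{(k)}_{n,\bullet}(c,\theta;\pi,q_0)$ is Hadamard directionally differentiable at $\pi_0$. * If $q\mapsto F(\mu;\pi_0,q)$ is Hadamard directionally differentiable at $q_0$ uniformly over nearly feasible $\mu$, then $q\mapsto V^{(k)}_{n,\bullet}(c,\theta;\pi_0,q)$ is Hadamard directionally differentiable at $q_0$. * If $(\pi,q)\mapsto F(\mu;\pi,q)$ is Hadamard directionally differentiable at $(\pi_0,q_0)$ uniformly over nearly feasible $\mu$, then $(\pi,q)\mapsto V^{(k)}_{n,\bullet}(c,\theta;\pi,q)$ is Hadamard directionally differentiable at $(\pi_0,q_0)$. -/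

import Mathlib

open MeasureTheory Set Filter Topology
open scoped ENNReal

noncomputable section

namespace SharpBounds

/-! ### Directional differentiability -/

/-- `φ : W → ℝ` has Hadamard directional derivative `D` at `w₀`, where `W` is regarded as a subset
of the normed space `E` through `e`: whenever `t_m ↓ 0` and the points `w_m` of `W` satisfy
`(e w_m - e w₀) / t_m → h` in `E`, one has `(φ w_m - φ w₀) / t_m → D h`. -/
def HasHadamardDirDeriv {W E : Type*} [NormedAddCommGroup E] [NormedSpace ℝ E]
    (e : W → E) (φ : W → ℝ) (w₀ : W) (D : E → ℝ) : Prop :=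
  ∀ (t : ℕ → ℝ) (w : ℕ → W) (h : E), (∀ m, 0 < t m) → Tendsto t atTop (𝓝 0) →
    Tendsto (fun m => (t m)⁻¹ • (e (w m) - e w₀)) atTop (𝓝 h) →
    Tendsto (fun m => (t m)⁻¹ * (φ (w m) - φ w₀)) atTop (𝓝 (D h))

/-- The directions in which `w₀` can be approached inside `W` (the contingent cone). -/
def dirCone {W E : Type*} [NormedAddCommGroup E] [NormedSpace ℝ E] (e : W → E) (w₀ : W) : Set E :=
  {h | ∃ (t : ℕ → ℝ) (w : ℕ → W), (∀ m, 0 < t m) ∧ Tendsto t atTop (𝓝 0) ∧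
    Tendsto (fun m => (t m)⁻¹ • (e (w m) - e w₀)) atTop (𝓝 h)}

/-- `φ` is Hadamard directionally differentiable at `w₀`, with a derivative that is continuous in
the direction. -/
def HadamardDirDifferentiableAt {W E : Type*} [NormedAddCommGroup E] [NormedSpace ℝ E]
    (e : W → E) (φ : W → ℝ) (w₀ : W) : Prop :=
  ∃ D : E → ℝ, ContinuousOn D (dirCone e w₀) ∧ HasHadamardDirDeriv e φ w₀ D

/-- The functions `φ a`, `a ∈ A`, are Hadamard directionally differentiable at `w₀`, uniformly in
`a ∈ A`, with derivatives that are continuous in the direction. -/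
def UniformHadamardDirDifferentiableAt {α W E : Type*} [NormedAddCommGroup E] [NormedSpace ℝ E]
    (e : W → E) (φ : α → W → ℝ) (A : Set α) (w₀ : W) : Prop :=
  ∃ D : α → E → ℝ, (∀ a ∈ A, ContinuousOn (D a) (dirCone e w₀)) ∧
    ∀ (t : ℕ → ℝ) (w : ℕ → W) (h : E), (∀ m, 0 < t m) → Tendsto t atTop (𝓝 0) →
      Tendsto (fun m => (t m)⁻¹ • (e (w m) - e w₀)) atTop (𝓝 h) →
      TendstoUniformlyOn (fun m a => (t m)⁻¹ * (φ a (w m) - φ a w₀)) (fun a => D a h) atTop A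

/-! ### Wasserstein distance and bounded-Lipschitz embedding -/

/-- The `1`-Wasserstein distance, through couplings. -/
def W1 {Y : Type*} [PseudoMetricSpace Y] [MeasurableSpace Y] (μ ν : ProbabilityMeasure Y) : ℝ :=
  sInf {r | ∃ γ : ProbabilityMeasure (Y × Y),
    (γ : Measure (Y × Y)).map Prod.fst = μ ∧ (γ : Measure (Y × Y)).map Prod.snd = ν ∧
      r = ∫ y, dist y.1 y.2 ∂(γ : Measure (Y × Y))}

/-- The unit ball of bounded Lipschitz functions. -/
abbrev BLBall (Y : Type*) [PseudoMetricSpace Y] : Type _ :=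
  {g : Y → ℝ // LipschitzWith 1 g ∧ ∀ y, |g y| ≤ 1}

/-- The space `ℓ^∞` of bounded functions on the bounded-Lipschitz unit ball. -/
abbrev BLStar (Y : Type*) [PseudoMetricSpace Y] : Type _ := lp (fun _ : BLBall Y => ℝ) ∞

lemma memlp_integral {Y : Type*} [PseudoMetricSpace Y] [MeasurableSpace Y]
    (μ : ProbabilityMeasure Y) :
    Memℓp (fun g : BLBall Y => ∫ y, g.1 y ∂(μ : Measure Y)) ∞ := by
  refine memℓp_infty ⟨1, ?_⟩
  rintro _ ⟨g, rfl⟩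
  have h := norm_integral_le_of_norm_le_const (μ := (μ : Measure Y)) (f := g.1) (C := 1)
    (Eventually.of_forall fun y => by simpa [Real.norm_eq_abs] using g.2.2 y)
  simpa using h

/-- A probability measure as an element of `ℓ^∞(BL₁)`, `g ↦ ∫ g dμ`; the norm distance
`‖blEmb μ - blEmb ν‖` is the bounded-Lipschitz distance. -/
def blEmb {Y : Type*} [PseudoMetricSpace Y] [MeasurableSpace Y]
    (μ : ProbabilityMeasure Y) : BLStar Y :=
  ⟨fun g => ∫ y, g.1 y ∂(μ : Measure Y), memlp_integral μ⟩

/-! ### Mixtures and finitely supported measures -/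

/-- The mixture `(1 - π) μ + π q`. -/
def mix {Y : Type*} [MeasurableSpace Y] (π : unitInterval) (q μ : ProbabilityMeasure Y) :
    ProbabilityMeasure Y :=
  ⟨ENNReal.ofReal (1 - (π : ℝ)) • (μ : Measure Y) + ENNReal.ofReal (π : ℝ) • (q : Measure Y), by
    refine ⟨?_⟩
    have h0 : (0 : ℝ) ≤ 1 - π := by linarith [π.2.2]
    simp only [Measure.add_apply, Measure.smul_apply, measure_univ, smul_eq_mul, mul_one]
    rw [← ENNReal.ofReal_add h0 π.2.1]
    simp⟩

/-- Decision vectors `x = (p, z)` with `k` weights and `k` support points. -/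
abbrev Dec (k : ℕ) : Type := (Fin k → ℝ) × (Fin k → ℝ)

/-- The set `Δ^k × {z ∈ [a,b]^k : z_1 ≤ ⋯ ≤ z_k}`. -/
def simplexOrd (a b : ℝ) (k : ℕ) : Set (Dec k) :=
  {x | (∀ j, 0 ≤ x.1 j) ∧ ∑ j, x.1 j = 1 ∧ (∀ j, x.2 j ∈ Icc a b) ∧ Monotone x.2}

/-- The measure `∑_j p_j δ_{z_j}`. -/
def atomic {a b : ℝ} {k : ℕ} (x : Dec k) (hx : x ∈ simplexOrd a b k) :
    ProbabilityMeasure (Icc a b) :=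
  ⟨∑ j, ENNReal.ofReal (x.1 j) • Measure.dirac (⟨x.2 j, hx.2.2.1 j⟩ : Icc a b), by
    refine ⟨?_⟩
    simp only [Measure.finsetSum_apply, Measure.smul_apply, measure_univ, smul_eq_mul, mul_one]
    rw [← ENNReal.ofReal_sum_of_nonneg fun j _ => hx.1 j, hx.2.1]
    simp⟩

/-! ### The partially identified inequality problem -/

/-- The data of the problem. Outcomes lie in `[yLo, yHi]`; `adm` is the class of admissible
measures; `idx` is the inequality index (only its values on `adm` have a meaning in the
applications). For each `n` there are `nEq n` equality rows and `nIneq n` inequality rows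
`∫ f_i(y; θ) dμ(y) = c_i` and `∫ f_i(y; θ) dμ(y) ≤ c_i`. Group-share restrictions are such rows,
with `f` equal to plus or minus the indicator of a group. Only the values of `f` at outcomes in
`[yLo, yHi]` matter. -/
structure Setup where
  yLo : ℝ
  yHi : ℝ
  yLo_lt_yHi : yLo < yHi
  adm : Set (ProbabilityMeasure (Icc yLo yHi))
  idx : ProbabilityMeasure (Icc yLo yHi) → ℝ
  nEq : ℕ → ℕ
  nIneq : ℕ → ℕ
  dimθ : ℕ → ℕ
  f : (n : ℕ) → Fin (nEq n) ⊕ Fin (nIneq n) → ℝ → EuclideanSpace ℝ (Fin (dimθ n)) → ℝ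
  c₀ : (n : ℕ) → Fin (nEq n) ⊕ Fin (nIneq n) → ℝ
  θ₀ : (n : ℕ) → EuclideanSpace ℝ (Fin (dimθ n))
  π₀ : unitInterval
  q₀ : ProbabilityMeasure (Icc yLo yHi)

/-- Minimization or maximization. -/
inductive Goal
  | min
  | max

/-- `+1` for maximization and `-1` for minimization. -/
def Goal.sign : Goal → ℝ
  | .min => -1
  | .max => 1

namespace Setup

variable (P : Setup)

/-- The space of outcomes. -/
abbrev Y : Type := Icc P.yLo P.yHi

/-- Probability measures on the space of outcomes. -/
abbrev PM : Type := ProbabilityMeasure (Icc P.yLo P.yHi)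

/-- Indices of the constraint rows: equalities, then inequalities. -/
abbrev Row (n : ℕ) : Type := Fin (P.nEq n) ⊕ Fin (P.nIneq n)

/-- The space of the constraint parameter `θ`. -/
abbrev Θ (n : ℕ) : Type := EuclideanSpace ℝ (Fin (P.dimθ n))

/-- Nuisance inputs `u = (c, θ)`. -/
abbrev U (n : ℕ) : Type := (P.Row n → ℝ) × P.Θ n

/-- The population input `u* = (c₀, θ₀)`. -/
def u₀ (n : ℕ) : P.U n := (P.c₀ n, P.θ₀ n)

/-- The objective `F(μ; π, q)`. -/
def F (μ : P.PM) (π : unitInterval) (q : P.PM) : ℝ := P.idx (mix π q μ)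

/-- The set `C_n(c, θ)` of admissible measures that satisfy the constraint rows. -/
def feasMeasures (n : ℕ) (u : P.U n) : Set P.PM :=
  {μ | μ ∈ P.adm ∧
    (∀ i : Fin (P.nEq n), ∫ y, P.f n (.inl i) (y : ℝ) u.2 ∂(μ : Measure P.Y) = u.1 (.inl i)) ∧
    (∀ i : Fin (P.nIneq n), ∫ y, P.f n (.inr i) (y : ℝ) u.2 ∂(μ : Measure P.Y) ≤ u.1 (.inr i))}

/-- Decision vectors of the problem with `k` support points. -/
abbrev X (k : ℕ) : Set (Dec k) := simplexOrd P.yLo P.yHi k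

open Classical in
/-- The finite-support objective `Φ(p, z; π, q) = F(∑_j p_j δ_{z_j}; π, q)`, for `(p, z) ∈ X k`
(zero elsewhere). -/
def Φ (k : ℕ) (π : unitInterval) (q : P.PM) (x : Dec k) : ℝ :=
  if hx : x ∈ P.X k then P.F (atomic x hx) π q else 0

/-- Decision vectors whose measure is admissible. -/
def admDec (k : ℕ) : Set (Dec k) := {x | ∃ hx : x ∈ P.X k, atomic x hx ∈ P.adm}

/-- The feasible set of the problem with `k` support points. -/
def feas (n k : ℕ) (u : P.U n) : Set (Dec k) :=
  {x | ∃ hx : x ∈ P.X k, atomic x hx ∈ P.feasMeasures n u}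

/-- The value `V_n^{(k)}(c, θ; π, q)` of the maximization or minimization problem. -/
def V (s : Goal) (n k : ℕ) (u : P.U n) (π : unitInterval) (q : P.PM) : ℝ :=
  match s with
  | .min => sInf (P.Φ k π q '' P.feas n k u)
  | .max => sSup (P.Φ k π q '' P.feas n k u)

/-- `x` is a (global) optimizer. -/
def IsOptimizer (s : Goal) (n k : ℕ) (u : P.U n) (π : unitInterval) (q : P.PM) (x : Dec k) : Prop :=
  x ∈ P.feas n k u ∧ ∀ y ∈ P.feas n k u, s.sign * P.Φ k π q y ≤ s.sign * P.Φ k π q x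

/-- `(π, q)` is within `r` of `(π₀, q₀)`. -/
def near (r : ℝ) (π : unitInterval) (q : P.PM) : Prop :=
  |(π : ℝ) - P.π₀| < r ∧ ‖blEmb q - blEmb P.q₀‖ < r

/-- The objective is `W₁`-Lipschitz on admissible measures with constant `L`, uniformly over
`(π, q)` within `r` of `(π₀, q₀)`. -/
def LipschitzObjective (r L : ℝ) : Prop :=
  ∀ π q, P.near r π q → ∀ μ ∈ P.adm, ∀ ν ∈ P.adm, |P.F μ π q - P.F ν π q| ≤ L * W1 μ ν

/-- Measures that are feasible for some input `u` within `ρ` of `u*`. -/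
def nearFeasible (n : ℕ) (ρ : ℝ) : Set P.PM :=
  {μ | ∃ u ∈ Metric.ball (P.u₀ n) ρ, μ ∈ P.feasMeasures n u}

/-- Regularity of the integrands `f_i(y; θ)` for `θ` in a fixed neighbourhood of `θ₀`:
piecewise Lipschitz in the outcome with finitely many knots (which may move continuously with `θ`),
smooth in `θ` away from the knots with uniform moduli, and uniformly bounded. -/
def RegularIntegrands : Prop :=
  ∃ r > (0 : ℝ), ∃ (s : ℕ → ℕ) (τ : (n : ℕ) → Fin (s n) → P.Θ n → ℝ),
    (∀ n l, ContinuousOn (τ n l) (Metric.ball (P.θ₀ n) r)) ∧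
    (∃ K : ℝ, ∀ n i, ∀ θ ∈ Metric.ball (P.θ₀ n) r, ∀ y ∈ Icc P.yLo P.yHi, ∀ y' ∈ Icc P.yLo P.yHi,
      (∀ l, τ n l θ ∉ uIcc y y') → |P.f n i y θ - P.f n i y' θ| ≤ K * |y - y'|) ∧
    (∀ δ > (0 : ℝ), ∃ L : ℝ, ∀ n i, ∀ θ ∈ Metric.ball (P.θ₀ n) r, ∀ y ∈ Icc P.yLo P.yHi,
      (∀ l, δ ≤ |y - τ n l θ|) →
        ContDiffOn ℝ 1 (P.f n i y) (Metric.ball θ δ ∩ Metric.ball (P.θ₀ n) r) ∧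
        ‖fderiv ℝ (P.f n i y) θ‖ ≤ L ∧
        ∀ θ' ∈ Metric.ball θ δ ∩ Metric.ball (P.θ₀ n) r,
          |P.f n i y θ' - P.f n i y θ - fderiv ℝ (P.f n i y) θ (θ' - θ)| ≤ L * ‖θ' - θ‖ ^ 2) ∧
    (∃ B : ℝ, ∀ n i, ∀ θ ∈ Metric.ball (P.θ₀ n) r, ∀ y ∈ Icc P.yLo P.yHi, |P.f n i y θ| ≤ B)

/-! ### The nonlinear program in `(p, z)` and its regularity conditions

Near the optimizer, the support point `z_j` ranges over a fixed interval `[lo_j, hi_j]` (its cell).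
One can take the whole outcome range; smaller cells allow an optimizer with a support point at a
known group endpoint, where a group-share row jumps but no feasible point lies across the jump. -/

/-- Consecutive positions. -/
abbrev Consec (k : ℕ) : Type := {a : Fin k × Fin k // a.1.val + 1 = a.2.val}

/-- Scalar constraints of the program: rows, `p_j ≥ 0`, `z_j ≥ lo_j`, `z_j ≤ hi_j`,
`z_j ≤ z_{j+1}`. The remaining constraint `∑ p_j = 1` is treated separately. -/
inductive Con (n k : ℕ)
  | row (i : P.Row n)
  | weight (j : Fin k)
  | lower (j : Fin k)
  | upper (j : Fin k)
  | order (a : Consec k)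

/-- `Con` as a sum type. -/
def conEquiv (n k : ℕ) :
    P.Con n k ≃ (P.Row n ⊕ Fin k) ⊕ ((Fin k ⊕ Fin k) ⊕ Consec k) where
  toFun
    | .row i => .inl (.inl i)
    | .weight j => .inl (.inr j)
    | .lower j => .inr (.inl (.inl j))
    | .upper j => .inr (.inl (.inr j))
    | .order a => .inr (.inr a)
  invFun
    | .inl (.inl i) => .row i
    | .inl (.inr j) => .weight j
    | .inr (.inl (.inl j)) => .lower j
    | .inr (.inl (.inr j)) => .upper j
    | .inr (.inr a) => .order a
  left_inv := by rintro (_ | _ | _ | _ | _) <;> rfl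
  right_inv := by rintro ((_ | _) | ((_ | _) | _)) <;> rfl

instance (n k : ℕ) : Fintype (P.Con n k) := Fintype.ofEquiv _ (P.conEquiv n k).symm

/-- Equality constraints. -/
def Con.IsEq {P : Setup} {n k : ℕ} : P.Con n k → Prop
  | .row (.inl _) => True
  | _ => False

/-- The constraint functions, in the form `con = 0` (equalities) and `con ≥ 0` (inequalities); a
row reads `c_i - ∑_j p_j f_i(z_j; θ)`. -/
def con {n k : ℕ} (lo hi : Fin k → ℝ) (x : Dec k) (u : P.U n) : P.Con n k → ℝ
  | .row i => u.1 i - ∑ j, x.1 j * P.f n i (x.2 j) u.2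
  | .weight j => x.1 j
  | .lower j => x.2 j - lo j
  | .upper j => hi j - x.2 j
  | .order a => x.2 a.1.2 - x.2 a.1.1

/-- The gradients in `x = (p, z)` of the constraint functions. -/
def grad {n k : ℕ} (lo hi : Fin k → ℝ) (x : Dec k) (u : P.U n) : P.Con n k → Dec k
  | .row i => (fun j => -P.f n i (x.2 j) u.2,
      fun j => -(x.1 j * derivWithin (fun y => P.f n i y u.2) (Icc (lo j) (hi j)) (x.2 j)))
  | .weight j => (Pi.single j 1, 0)
  | .lower j => (0, Pi.single j 1)
  | .upper j => (0, -Pi.single j 1)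
  | .order a => (0, Pi.single a.1.2 1 - Pi.single a.1.1 1)

/-- Euclidean inner product on `ℝ^k × ℝ^k`. -/
def dot {k : ℕ} (v w : Dec k) : ℝ := ∑ j, v.1 j * w.1 j + ∑ j, v.2 j * w.2 j

/-- Decision vectors with every support point in its cell. -/
def cellDec {k : ℕ} (lo hi : Fin k → ℝ) : Set (Dec k) :=
  {x | x ∈ P.X k ∧ ∀ j, x.2 j ∈ Icc (lo j) (hi j)}

/-- `(x, l)` is a Karush-Kuhn-Tucker pair for the input `u`, with Lagrangian `Φ + ∑ l_i con_i`; the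
multipliers of inequalities are nonnegative for `max` and nonpositive for `min`. Stationarity is
tested on the directions that preserve `∑ p_j = 1`, so this constraint needs no multiplier. -/
def IsKKT (s : Goal) {n k : ℕ} (u : P.U n) (π : unitInterval) (q : P.PM) (lo hi : Fin k → ℝ)
    (x : Dec k) (l : P.Con n k → ℝ) : Prop :=
  x ∈ P.feas n k u ∧ x ∈ P.cellDec lo hi ∧
  (∀ i, ¬ i.IsEq → 0 ≤ s.sign * l i) ∧ (∀ i, l i * P.con lo hi x u i = 0) ∧
  ∃ Φ' : Dec k →L[ℝ] ℝ, HasFDerivWithinAt (P.Φ k π q) Φ' (P.cellDec lo hi) x ∧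
    ∀ v : Dec k, ∑ j, v.1 j = 0 → Φ' v + ∑ i, l i * dot (P.grad lo hi x u i) v = 0

/-- Linear independence constraint qualification at `x`: the Jacobian of the active constraints
(including `∑ p_j = 1`) has minimal singular value at least `σ`. -/
def LICQ {n k : ℕ} (σ : ℝ) (u : P.U n) (lo hi : Fin k → ℝ) (x : Dec k) : Prop :=
  ∀ (w₀ : ℝ) (w : P.Con n k → ℝ), (∀ i, w i ≠ 0 → P.con lo hi x u i = 0) →
    σ ^ 2 * (w₀ ^ 2 + ∑ i, w i ^ 2) ≤
      dot (w₀ • ((fun _ => 1, 0) : Dec k) + ∑ i, w i • P.grad lo hi x u i)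
        (w₀ • ((fun _ => 1, 0) : Dec k) + ∑ i, w i • P.grad lo hi x u i)

/-- The critical cone at a Karush-Kuhn-Tucker pair. -/
def criticalCone {n k : ℕ} (u : P.U n) (lo hi : Fin k → ℝ) (x : Dec k) (l : P.Con n k → ℝ) :
    Set (Dec k) :=
  {v | ∑ j, v.1 j = 0 ∧ ∀ i, P.con lo hi x u i = 0 →
    0 ≤ dot (P.grad lo hi x u i) v ∧ (i.IsEq ∨ l i ≠ 0 → dot (P.grad lo hi x u i) v = 0)}

/-- The Lagrangian. -/
def lagrangian {n k : ℕ} (u : P.U n) (π : unitInterval) (q : P.PM) (lo hi : Fin k → ℝ)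
    (l : P.Con n k → ℝ) (x : Dec k) : ℝ :=
  P.Φ k π q x + ∑ i, l i * P.con lo hi x u i

/-- Second-order sufficient condition: the second derivative of the Lagrangian along any direction
`v` of the critical cone, `vᵀ ∇²L v`, is at most `-κ ‖v‖²` for `max` and at least `κ ‖v‖²` for
`min`. -/
def SOSC (s : Goal) {n k : ℕ} (κ : ℝ) (u : P.U n) (π : unitInterval) (q : P.PM)
    (lo hi : Fin k → ℝ) (x : Dec k) (l : P.Con n k → ℝ) : Prop :=
  ∀ v ∈ P.criticalCone u lo hi x l,
    s.sign * iteratedDerivWithin 2 (fun t : ℝ => P.lagrangian u π q lo hi l (x + t • v)) (Ici 0) 0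
      ≤ -κ * dot v v

/-- The regularity conditions at `u* = (c₀, θ₀)`, with constants `r, ε, σ, κ, B`, for the program
with `k` support points, its unique optimizer `x` and the multipliers `l`. -/
structure RegularAt (s : Goal) (n k : ℕ) (π : unitInterval) (q : P.PM) (r ε σ κ B : ℝ)
    (lo hi : Fin k → ℝ) (x : Dec k) (l : P.Con n k → ℝ) : Prop where
  /-- cells are nondegenerate intervals of outcomes -/
  cells : ∀ j, P.yLo ≤ lo j ∧ lo j < hi j ∧ hi j ≤ P.yHi
  /-- for inputs near `u*`, feasible points near `x` respect the cells -/
  cells_local : ∀ᶠ a : P.U n × Dec k in 𝓝 (P.u₀ n, x),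
    a.2 ∈ P.feas n k a.1 → ∀ j, a.2.2 j ∈ Icc (lo j) (hi j)
  /-- near `x`, the objective is defined and twice continuously differentiable -/
  adm_near : ∀ᶠ y in 𝓝[P.cellDec lo hi] x, y ∈ P.admDec k
  smooth_objective : ContDiffWithinAt ℝ 2 (P.Φ k π q) (P.cellDec lo hi) x
  /-- active rows are twice continuously differentiable in `x` and jointly `C¹` in `(x, u)` -/
  smooth_active : ∀ i : P.Row n, P.con lo hi x (P.u₀ n) (.row i) = 0 → ∀ j,
    ContDiffWithinAt ℝ 2 (fun y => P.f n i y (P.θ₀ n)) (Icc (lo j) (hi j)) (x.2 j) ∧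
    ContDiffWithinAt ℝ 1 (fun a : ℝ × P.Θ n => P.f n i a.1 a.2) (Icc (lo j) (hi j) ×ˢ univ)
      (x.2 j, P.θ₀ n)
  /-- inactive rows are continuous in `(x, u)` -/
  continuous_inactive : ∀ i : P.Row n, P.con lo hi x (P.u₀ n) (.row i) ≠ 0 → ∀ j,
    ContinuousWithinAt (fun a : ℝ × P.Θ n => P.f n i a.1 a.2) (Icc (lo j) (hi j) ×ˢ univ)
      (x.2 j, P.θ₀ n)
  /-- `x` is the only optimizer -/
  optimizer : P.IsOptimizer s n k (P.u₀ n) π q x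
  unique_optimizer : ∀ y, P.IsOptimizer s n k (P.u₀ n) π q y → y = x
  /-- `(x, l)` is a Karush-Kuhn-Tucker pair, and locally the only one -/
  kkt : P.IsKKT s (P.u₀ n) π q lo hi x l
  locally_unique_kkt : ∀ᶠ a : Dec k × (P.Con n k → ℝ) in 𝓝 (x, l),
    P.IsKKT s (P.u₀ n) π q lo hi a.1 a.2 → a = (x, l)
  /-- Slater points with margin `ε` exist for all inputs within `r` of `u*` -/
  slater : ∀ u ∈ Metric.closedBall (P.u₀ n) r, ∃ y ∈ P.feas n k u,
    ∀ i : Fin (P.nIneq n), ε ≤ P.con lo hi y u (.row (.inr i))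
  licq : P.LICQ σ (P.u₀ n) lo hi x
  sosc : P.SOSC s κ (P.u₀ n) π q lo hi x l
  /-- the feasible set is nonempty and compact, uniformly for inputs within `r` of `u*` -/
  nonempty : ∀ u ∈ Metric.closedBall (P.u₀ n) r, (P.feas n k u).Nonempty
  compact : IsCompact {a : P.U n × Dec k | a.1 ∈ Metric.closedBall (P.u₀ n) r ∧
    a.2 ∈ P.feas n k a.1}
  /-- rows with a nonzero multiplier are Hadamard directionally differentiable in `u`, with a
  linear derivative of norm at most `B` -/
  rows_differentiable : ∀ i : P.Row n, l (.row i) ≠ 0 → ∃ A : P.U n →L[ℝ] ℝ, ‖A‖ ≤ B ∧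
    HasHadamardDirDeriv (fun u : P.U n => u) (fun u => P.con lo hi x u (.row i)) (P.u₀ n) A

open Classical in
/-- The envelope formula
`∑_{i : l_i ≠ 0} l_i (⟨e_i, h_c⟩ - ⟨D_θ a_i(x, θ₀)[h_θ], p⟩)`, where `a_i(x, θ)` is the vector of
the values `f_i(z_j; θ)`. -/
def envelope {n k : ℕ} (x : Dec k) (l : P.Con n k → ℝ) (h : P.U n) : ℝ :=
  ∑ i : P.Row n with l (.row i) ≠ 0,
    l (.row i) * (h.1 i - ∑ j, fderiv ℝ (fun θ => P.f n i (x.2 j) θ) (P.θ₀ n) h.2 * x.1 j)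

end Setup

end SharpBounds

end

open SharpBounds

/-! (i) Two measures with `k` atoms are coupled explicitly: the common weight `min (p_j, p'_j)`
stays at index `j` and the leftover mass is transported arbitrarily. The first part costs at most
the distance of the support points, the second at most the diameter times the `ℓ¹` distance of the
weights. With the `W₁`-Lipschitz property of the objective this bounds the difference of objectives
globally (`LipschitzObjective.abs_Φ_sub_le`), so the radius plays no role.

(iii) The feasible set does not depend on `(π, q)`, so the value is a supremum over a fixed family.
By uniform differentiability each member may be replaced, up to `o(t)` uniformly, by `F(μ) + t
D_μ(h)`. A supremum of functions affine in `t` is convex, hence has a one-sided slope at `0`,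
whether or not the supremum is attained. The infimum follows by negation, and continuity in the
direction is automatic.

(ii) After multiplication by the sign only maximization remains. Let `u_m = u* + t_m h + o(t_m)`,
and let `Λ` be the Lagrangian with the input frozen at `u*`. Lower bound: LICQ and the implicit
function theorem give feasible points `y_m` at distance `O(t_m)` from `x*` on which every active
constraint stays active (`RegularAt.exists_path`). Stationarity makes the change of `Λ` at `y_m` of
order `t_m²`, so the objective there moves at the rate `∑ λ_i D_u c_i [h]`. Upper bound: optimizers
`x_m` at `u_m` exist and converge to `x*`, by compactness and uniqueness. Since `λ_i c_i(x_m, u_m) ≥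
0`, the gain `Φ(x_m) - Φ(x*)` is at most `Λ(x_m) - Λ(x*)` plus `∑ λ_i (c_i(x_m, u_m) - c_i(x_m,
u*))`. Strict differentiability gives the sum the right rate, with no information on how fast `x_m`
converges (`tendsto_partial_quotient`). It remains to see that `Λ(x_m) - Λ(x*) ≤ o(t_m)`, which is
where SOSC enters (`lagrangian_increase_le`). If `Λ` rose by `η t_m`, its quadratic expansion would
force `t_m = O(‖x_m - x*‖²)`; then the input is negligible next to `x_m - x*`, the normalized
displacements accumulate at a critical direction, and the quadratic form is nonnegative there, a
contradiction. No rate for the optimizers and no stability of the multipliers is needed.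

The derivative is bounded uniformly in `n` because LICQ leaves at most `2k` active constraints, each
multiplier is at most a Lipschitz constant divided by `σ`, and each relevant row has derivative at
most `B`. -/

noncomputable section
namespace SharpBounds

/-! ### Hadamard directional derivatives of value functions -/

section Hadamard

variable {α W E : Type*} [NormedAddCommGroup E] [NormedSpace ℝ E]

/-- If the difference quotients converge then the points converge. -/
lemma tendsto_of_quotient {e : W → E} {w₀ : W} {t : ℕ → ℝ} {w : ℕ → W} {h : E}
    (ht : ∀ m, 0 < t m) (ht0 : Tendsto t atTop (𝓝 0))
    (hw : Tendsto (fun m => (t m)⁻¹ • (e (w m) - e w₀)) atTop (𝓝 h)) :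
    Tendsto (fun m => e (w m) - e w₀) atTop (𝓝 0) := by
  have h1 := ht0.smul hw
  rw [zero_smul] at h1
  refine h1.congr fun m => ?_
  rw [smul_smul, mul_inv_cancel₀ (ht m).ne', one_smul]

/-- A Hadamard directional derivative is continuous on the cone of directions. -/
lemma HasHadamardDirDeriv.continuousOn {e : W → E} {φ : W → ℝ} {w₀ : W} {D : E → ℝ}
    (hD : HasHadamardDirDeriv e φ w₀ D) : ContinuousOn D (dirCone e w₀) := by
  intro h _
  refine tendsto_of_seq_tendsto fun x hx => ?_
  obtain ⟨hx, hxm⟩ := tendsto_nhdsWithin_iff.1 hx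
  have hpos : ∀ k : ℕ, (0 : ℝ) < 1 / (k + 1) := fun k => Nat.one_div_pos_of_nat
  -- Diagonal choice: for each direction `x k` pick one difference quotient that is within `1/(k+1)`
  -- of it and whose `φ`-quotient is within `1/(k+1)` of `D (x k)`. The chosen points then approach
  -- `w₀` in the limit direction `h`.
  have hex : ∀ k : ℕ, ∃ (τ : ℝ) (ω : W), 0 < τ ∧ τ ≤ 1 / (k + 1) ∧ (x k ∈ dirCone e w₀ →
      ‖τ⁻¹ • (e ω - e w₀) - x k‖ < 1 / (k + 1) ∧ |τ⁻¹ * (φ ω - φ w₀) - D (x k)| < 1 / (k + 1)) := by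
    intro k
    by_cases hk : x k ∈ dirCone e w₀
    · obtain ⟨t, w, ht, ht0, hw⟩ := hk
      have e1 := ht0.eventually (gt_mem_nhds (hpos k))
      have e2 := hw.eventually (Metric.ball_mem_nhds _ (hpos k))
      have e3 := (hD t w _ ht ht0 hw).eventually (Metric.ball_mem_nhds _ (hpos k))
      obtain ⟨m, h1, h2, h3⟩ := (e1.and (e2.and e3)).exists
      exact ⟨t m, w m, ht m, h1.le, fun _ => ⟨by simpa [dist_eq_norm] using h2,
        by simpa [dist_eq_norm] using h3⟩⟩
    · exact ⟨_, w₀, hpos k, le_rfl, fun h => absurd h hk⟩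
  choose τ ω hτ hτ1 hω using hex
  have h0 : Tendsto (fun k : ℕ => (1 : ℝ) / (k + 1)) atTop (𝓝 0) :=
    tendsto_one_div_add_atTop_nhds_zero_nat
  have hτ0 : Tendsto τ atTop (𝓝 0) := squeeze_zero (fun k => (hτ k).le) hτ1 h0
  have hq : Tendsto (fun k => (τ k)⁻¹ • (e (ω k) - e w₀)) atTop (𝓝 h) := by
    have : Tendsto (fun k => (τ k)⁻¹ • (e (ω k) - e w₀) - x k) atTop (𝓝 0) :=
      squeeze_zero_norm' (hxm.mono fun k hk => (hω k hk).1.le) h0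
    simpa using this.add hx
  have hlim := hD τ ω h hτ hτ0 hq
  have h2 : Tendsto (fun k => (τ k)⁻¹ * (φ (ω k) - φ w₀) - D (x k)) atTop (𝓝 0) :=
    squeeze_zero_norm' (hxm.mono fun k hk => (hω k hk).2.le) h0
  simpa [Function.comp_def] using hlim.sub h2

lemma HadamardDirDifferentiableAt.of_hasDeriv {e : W → E} {φ : W → ℝ} {w₀ : W} {D : E → ℝ}
    (hD : HasHadamardDirDeriv e φ w₀ D) : HadamardDirDifferentiableAt e φ w₀ :=
  ⟨D, hD.continuousOn, hD⟩

lemma HadamardDirDifferentiableAt.neg {e : W → E} {φ : W → ℝ} {w₀ : W}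
    (h : HadamardDirDifferentiableAt e φ w₀) :
    HadamardDirDifferentiableAt e (fun w => -φ w) w₀ := by
  obtain ⟨D, -, hD⟩ := h
  refine .of_hasDeriv (D := fun h => -D h) fun t w h ht ht0 hw => ?_
  refine (hD t w h ht ht0 hw).neg.congr fun m => ?_
  ring

lemma UniformHadamardDirDifferentiableAt.neg {e : W → E} {φ : α → W → ℝ} {A : Set α} {w₀ : W}
    (h : UniformHadamardDirDifferentiableAt e φ A w₀) :
    UniformHadamardDirDifferentiableAt e (fun a w => -φ a w) A w₀ := by
  obtain ⟨D, hc, hD⟩ := h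
  refine ⟨fun a h => -D a h, fun a ha => (hc a ha).neg, fun t w h ht ht0 hw => ?_⟩
  have := hD t w h ht ht0 hw
  rw [Metric.tendstoUniformlyOn_iff] at this ⊢
  intro ε hε
  filter_upwards [this ε hε] with m hm a ha
  have h1 := hm a ha
  rw [Real.dist_eq, abs_sub_comm] at h1 ⊢
  convert h1 using 1
  rw [← abs_neg]
  congr 1
  ring

lemma UniformHadamardDirDifferentiableAt.mono {e : W → E} {φ : α → W → ℝ} {A A' : Set α} {w₀ : W}
    (h : UniformHadamardDirDifferentiableAt e φ A w₀) (hA : A' ⊆ A) :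
    UniformHadamardDirDifferentiableAt e φ A' w₀ := by
  obtain ⟨D, hc, hD⟩ := h
  exact ⟨D, fun a ha => hc a (hA ha), fun t w h ht ht0 hw => (hD t w h ht ht0 hw).mono hA⟩

/-- Suprema of uniformly close functions are close. -/
lemma abs_sSup_image_sub_le {f g : α → ℝ} {A : Set α} (hA : A.Nonempty) {c : ℝ}
    (hf : BddAbove (f '' A)) (hg : BddAbove (g '' A)) (h : ∀ a ∈ A, |f a - g a| ≤ c) :
    |sSup (f '' A) - sSup (g '' A)| ≤ c := by
  rw [abs_sub_le_iff]
  constructor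
  · rw [sub_le_iff_le_add]
    refine csSup_le (hA.image _) ?_
    rintro _ ⟨a, ha, rfl⟩
    have := le_csSup hg (mem_image_of_mem g ha)
    linarith [(abs_sub_le_iff.1 (h a ha)).1]
  · rw [sub_le_iff_le_add]
    refine csSup_le (hA.image _) ?_
    rintro _ ⟨a, ha, rfl⟩
    have := le_csSup hf (mem_image_of_mem f ha)
    linarith [(abs_sub_le_iff.1 (h a ha)).2]

/-- The slope at `0` of `t ↦ sup_a (f a + t d a)`. -/
def supSlope (A : Set α) (f d : α → ℝ) (t : ℝ) : ℝ :=
  t⁻¹ * (sSup ((fun a => f a + t * d a) '' A) - sSup (f '' A))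

/-- A supremum of functions affine in `t` is convex, so its slope from `0` is monotone in `t`. The
slope is bounded below by `-Md`, hence it decreases to its infimum as `t ↓ 0`. -/
lemma supSlope_tendsto {A : Set α} (hA : A.Nonempty) {f d : α → ℝ} {Mf Md : ℝ}
    (hf : ∀ a ∈ A, |f a| ≤ Mf) (hd : ∀ a ∈ A, |d a| ≤ Md) :
    Tendsto (supSlope A f d) (𝓝[>] 0) (𝓝 (sInf (supSlope A f d '' Ioi 0))) := by
  have hbf : BddAbove (f '' A) := ⟨Mf, by
    rintro _ ⟨a, ha, rfl⟩; exact (abs_le.1 (hf a ha)).2⟩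
  have hbt : ∀ t : ℝ, 0 < t → BddAbove ((fun a => f a + t * d a) '' A) := fun t ht =>
    ⟨Mf + t * Md, by
      rintro _ ⟨a, ha, rfl⟩
      have h1 := (abs_le.1 (hf a ha)).2
      have h2 := mul_le_mul_of_nonneg_left (abs_le.1 (hd a ha)).2 ht.le
      simp only
      linarith⟩
  refine MonotoneOn.tendsto_nhdsGT ?_ ?_
  · intro s hs t ht hst
    have hs0 : (0 : ℝ) < s := hs
    have ht0 : (0 : ℝ) < t := ht
    simp only [supSlope]
    have key : sSup ((fun a => f a + s * d a) '' A) ≤ (1 - s / t) * sSup (f '' A) +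
        s / t * sSup ((fun a => f a + t * d a) '' A) := by
      refine csSup_le (hA.image _) ?_
      rintro _ ⟨a, ha, rfl⟩
      have h1 := le_csSup hbf (mem_image_of_mem f ha)
      have h2 := le_csSup (hbt t ht0) (mem_image_of_mem (fun a => f a + t * d a) ha)
      have h3 : 0 ≤ 1 - s / t := by
        rw [sub_nonneg, div_le_one ht0]; exact hst
      have h4 : 0 ≤ s / t := by positivity
      have h5 := mul_le_mul_of_nonneg_left h1 h3
      have h6 := mul_le_mul_of_nonneg_left h2 h4
      have h7 : f a + s * d a = (1 - s / t) * f a + s / t * (f a + t * d a) := by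
        field_simp
        ring
      simp only at h6 ⊢
      linarith
    rw [inv_mul_le_iff₀ hs0]
    calc _ ≤ s / t * (sSup ((fun a => f a + t * d a) '' A) - sSup (f '' A)) := by linarith
      _ = _ := by ring
  · refine ⟨-Md, ?_⟩
    rintro _ ⟨t, ht, rfl⟩
    have ht0 : (0 : ℝ) < t := ht
    have h := abs_sSup_image_sub_le hA (hbt t ht0) hbf (c := t * Md) (fun a ha => by
      rw [add_sub_cancel_left, abs_mul, abs_of_pos ht0]
      exact mul_le_mul_of_nonneg_left (hd a ha) ht0.le)
    have h1 := (abs_le.1 h).1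
    simp only [supSlope]
    rw [le_inv_mul_iff₀ ht0]
    linarith

/-- Directional differentiability of a supremum of functions that are uniformly directionally
differentiable. -/
lemma hadamardDirDifferentiableAt_sSup {e : W → E} {φ : α → W → ℝ} {A : Set α} {w₀ : W}
    (hu : UniformHadamardDirDifferentiableAt e φ A w₀) {δ : ℝ} (hδ : 0 < δ)
    (hb : ∀ w, ‖e w - e w₀‖ < δ → ∃ M, ∀ a ∈ A, |φ a w| ≤ M) :
    HadamardDirDifferentiableAt e (fun w => sSup ((fun a => φ a w) '' A)) w₀ := by
  rcases A.eq_empty_or_nonempty with rfl | hA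
  -- Over an empty family the value is the default `sSup ∅ = 0` for every parameter, hence constant.
  · exact .of_hasDeriv (D := 0) fun t w h ht ht0 hw => by simp
  obtain ⟨D, -, hD⟩ := hu
  refine .of_hasDeriv (D := fun h => sInf (supSlope A (fun a => φ a w₀) (fun a => D a h) '' Ioi 0))
    fun t w h ht ht0 hw => ?_
  have hun := Metric.tendstoUniformlyOn_iff.1 (hD t w h ht ht0 hw)
  have hnear : ∀ᶠ m in atTop, ‖e (w m) - e w₀‖ < δ := by
    have := (tendsto_of_quotient ht ht0 hw).eventually (Metric.ball_mem_nhds _ hδ)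
    simpa using this
  obtain ⟨M₀, hM₀⟩ := hb w₀ (by simpa using hδ)
  obtain ⟨m, hm1, hm2⟩ := ((hun 1 one_pos).and hnear).exists
  obtain ⟨M₁, hM₁⟩ := hb _ hm2
  -- The derivatives are bounded in `a` because they lie within `1` of a single difference quotient,
  -- whose two function values are bounded in `a`.
  obtain ⟨Md, hDb⟩ : ∃ Md, ∀ a ∈ A, |D a h| ≤ Md := by
    refine ⟨(t m)⁻¹ * (M₁ + M₀) + 1, fun a ha => ?_⟩
    have h1 := hm1 a ha
    rw [Real.dist_eq] at h1
    have h2 : |(t m)⁻¹ * (φ a (w m) - φ a w₀)| ≤ (t m)⁻¹ * (M₁ + M₀) := by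
      rw [abs_mul, abs_of_pos (inv_pos.2 (ht m))]
      refine mul_le_mul_of_nonneg_left ?_ (inv_pos.2 (ht m)).le
      exact (abs_sub _ _).trans (add_le_add (hM₁ a ha) (hM₀ a ha))
    have h3 := abs_sub_abs_le_abs_sub (D a h) ((t m)⁻¹ * (φ a (w m) - φ a w₀))
    linarith
  have hlim := (supSlope_tendsto hA hM₀ hDb).comp
    (tendsto_nhdsWithin_iff.2 ⟨ht0, Eventually.of_forall ht⟩)
  -- Replacing each function by its first-order model changes the supremum by at most `t m * (ε /
  -- 2)`, which is negligible after division by `t m`.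
  have hdiff : Tendsto (fun m => (t m)⁻¹ * (sSup ((fun a => φ a (w m)) '' A) -
      sSup ((fun a => φ a w₀) '' A)) - supSlope A (fun a => φ a w₀) (fun a => D a h) (t m))
      atTop (𝓝 0) := by
    rw [Metric.tendsto_nhds]
    intro ε hε
    filter_upwards [hun (ε / 2) (half_pos hε), hnear] with m hm hmn
    obtain ⟨M₂, hM₂⟩ := hb _ hmn
    have htm := ht m
    have h1 : |sSup ((fun a => φ a (w m)) '' A) -
        sSup ((fun a => φ a w₀ + t m * D a h) '' A)| ≤ t m * (ε / 2) := by
      refine abs_sSup_image_sub_le hA ⟨M₂, ?_⟩ ⟨M₀ + t m * Md, ?_⟩ fun a ha => ?_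
      · rintro _ ⟨a, ha, rfl⟩
        exact (abs_le.1 (hM₂ a ha)).2
      · rintro _ ⟨a, ha, rfl⟩
        exact add_le_add (abs_le.1 (hM₀ a ha)).2
          (mul_le_mul_of_nonneg_left (abs_le.1 (hDb a ha)).2 htm.le)
      · have h2 := (hm a ha).le
        rw [Real.dist_eq, abs_sub_comm] at h2
        have h3 : φ a (w m) - (φ a w₀ + t m * D a h)
            = t m * ((t m)⁻¹ * (φ a (w m) - φ a w₀) - D a h) := by
          field_simp
          ring
        rw [h3, abs_mul, abs_of_pos htm]
        exact mul_le_mul_of_nonneg_left h2 htm.le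
    rw [dist_zero_right, Real.norm_eq_abs]
    have h4 : (t m)⁻¹ * (sSup ((fun a => φ a (w m)) '' A) - sSup ((fun a => φ a w₀) '' A)) -
        supSlope A (fun a => φ a w₀) (fun a => D a h) (t m) = (t m)⁻¹ *
        (sSup ((fun a => φ a (w m)) '' A) - sSup ((fun a => φ a w₀ + t m * D a h) '' A)) := by
      simp only [supSlope]
      ring
    rw [h4, abs_mul, abs_of_pos (inv_pos.2 htm)]
    have h5 := mul_le_mul_of_nonneg_left h1 (inv_pos.2 htm).le
    rw [← mul_assoc, inv_mul_cancel₀ htm.ne', one_mul] at h5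
    linarith
  simpa using hdiff.add hlim

/-- Directional differentiability of an infimum of functions that are uniformly directionally
differentiable. -/
lemma hadamardDirDifferentiableAt_sInf {e : W → E} {φ : α → W → ℝ} {A : Set α} {w₀ : W}
    (hu : UniformHadamardDirDifferentiableAt e φ A w₀) {δ : ℝ} (hδ : 0 < δ)
    (hb : ∀ w, ‖e w - e w₀‖ < δ → ∃ M, ∀ a ∈ A, |φ a w| ≤ M) :
    HadamardDirDifferentiableAt e (fun w => sInf ((fun a => φ a w) '' A)) w₀ := by
  have := (hadamardDirDifferentiableAt_sSup hu.neg hδ (by simpa using hb)).neg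
  convert this using 2 with w
  rw [Real.sInf_def, ← image_neg_eq_neg, image_image]

end Hadamard

/-! ### The Wasserstein distance of finitely supported measures -/

section Wasserstein

/-- Integration against a finitely supported measure. -/
lemma integral_sum_ofReal_dirac {ι X : Type*} [Fintype ι] [MeasurableSpace X]
    [MeasurableSingletonClass X] {w : ι → ℝ} (hw : ∀ i, 0 ≤ w i) (a : ι → X) (g : X → ℝ) :
    ∫ y, g y ∂(∑ i, ENNReal.ofReal (w i) • Measure.dirac (a i)) = ∑ i, w i * g (a i) := by
  rw [integral_finsetSum_measure fun i _ =>
    (integrable_dirac (by simp)).smul_measure ENNReal.ofReal_ne_top]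
  refine Finset.sum_congr rfl fun i _ => ?_
  rw [integral_smul_measure, integral_dirac, ENNReal.toReal_ofReal (hw i), smul_eq_mul]

lemma map_sum_ofReal_dirac {ι X Z : Type*} [Fintype ι] [MeasurableSpace X] [MeasurableSpace Z]
    (w : ι → ℝ) (a : ι → X) {g : X → Z} (hg : Measurable g) :
    (∑ i, ENNReal.ofReal (w i) • Measure.dirac (a i)).map g
      = ∑ i, ENNReal.ofReal (w i) • Measure.dirac (g (a i)) := by
  ext s hs
  simp [Measure.map_apply hg hs, Measure.finsetSum_apply, Measure.dirac_apply' _ (hg hs),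
    Measure.dirac_apply' _ hs, Set.indicator,
    mem_preimage]
  rfl

variable {Y : Type*} [PseudoMetricSpace Y] [MeasurableSpace Y]

lemma W1_nonneg (μ ν : ProbabilityMeasure Y) : 0 ≤ W1 μ ν := by
  refine Real.sInf_nonneg ?_
  rintro _ ⟨γ, -, -, rfl⟩
  exact integral_nonneg fun _ => dist_nonneg

lemma W1_le_of_coupling {μ ν : ProbabilityMeasure Y} (γ : ProbabilityMeasure (Y × Y))
    (h1 : (γ : Measure (Y × Y)).map Prod.fst = μ) (h2 : (γ : Measure (Y × Y)).map Prod.snd = ν) :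
    W1 μ ν ≤ ∫ y, dist y.1 y.2 ∂(γ : Measure (Y × Y)) := by
  refine csInf_le ⟨0, ?_⟩ ⟨γ, h1, h2, rfl⟩
  rintro _ ⟨γ, -, -, rfl⟩
  exact integral_nonneg fun _ => dist_nonneg

/-- The product measure is a coupling of any two marginals. -/
lemma W1_le_of_dist_le {d : ℝ} (hd : ∀ y z : Y, dist y z ≤ d) (μ ν : ProbabilityMeasure Y) :
    W1 μ ν ≤ d := by
  refine (W1_le_of_coupling (μ.prod ν) (by simp) (by simp)).trans ?_
  have h := norm_integral_le_of_norm_le_const (μ := ((μ.prod ν : ProbabilityMeasure (Y × Y)) :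
    Measure (Y × Y))) (f := fun y => dist y.1 y.2) (C := d)
    (Eventually.of_forall fun y => by
      rw [Real.norm_eq_abs, abs_of_nonneg dist_nonneg]; exact hd _ _)
  exact (le_abs_self _).trans (by simpa using h)

/-- Two finitely supported measures are close if their weights and support points are. -/
lemma W1_atomic_le {a b : ℝ} {k : ℕ} {x y : Dec k} (hx : x ∈ simplexOrd a b k)
    (hy : y ∈ simplexOrd a b k) :
    W1 (atomic x hx) (atomic y hy) ≤ (b - a) * ∑ j, |x.1 j - y.1 j| + ‖x.2 - y.2‖ := by
  set m : Fin k → ℝ := fun j => min (x.1 j) (y.1 j) with hm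
  set R : ℝ := 1 - ∑ j, m j with hR
  have hRx : ∑ j, (x.1 j - m j) = R := by rw [Finset.sum_sub_distrib, hx.2.1]
  have hRy : ∑ j, (y.1 j - m j) = R := by rw [Finset.sum_sub_distrib, hy.2.1]
  have hmx : ∀ j, 0 ≤ x.1 j - m j := fun j => sub_nonneg.2 (min_le_left _ _)
  have hmy : ∀ j, 0 ≤ y.1 j - m j := fun j => sub_nonneg.2 (min_le_right _ _)
  have hm0 : ∀ j, 0 ≤ m j := fun j => le_min (hx.1 j) (hy.1 j)
  have hR0 : 0 ≤ R := hRx ▸ Finset.sum_nonneg fun j _ => hmx j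
  -- Coupling weights: the common mass `m` on the diagonal, and the two leftovers, both of total
  -- mass `R`, coupled as a normalized product. If `R = 0` the leftovers vanish and so does the
  -- quotient, by the convention for division by zero.
  set W : Fin k × Fin k → ℝ := fun i =>
    (if i.1 = i.2 then m i.1 else 0) + (x.1 i.1 - m i.1) * (y.1 i.2 - m i.2) / R with hW
  have hW0 : ∀ i, 0 ≤ W i := fun i => by
    have := hm0 i.1
    have := mul_nonneg (hmx i.1) (hmy i.2)
    simp only [hW]
    split_ifs <;> positivity
  have hWx : ∀ j, ∑ l, W (j, l) = x.1 j := fun j => by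
    simp only [hW, Finset.sum_add_distrib, Finset.sum_ite_eq, Finset.mem_univ, if_true,
      ← Finset.sum_div, ← Finset.mul_sum, hRy]
    rcases hR0.eq_or_lt with h | h
    · have := (Finset.sum_eq_zero_iff_of_nonneg fun j _ => hmx j).1 (hRx.trans h.symm) j
        (Finset.mem_univ j)
      rw [this, ← h]; linarith
    · field_simp; ring
  have hWy : ∀ l, ∑ j, W (j, l) = y.1 l := fun l => by
    simp only [hW, Finset.sum_add_distrib, Finset.sum_ite_eq', Finset.mem_univ, if_true,
      ← Finset.sum_div, ← Finset.sum_mul, hRx]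
    rcases hR0.eq_or_lt with h | h
    · have := (Finset.sum_eq_zero_iff_of_nonneg fun j _ => hmy j).1 (hRy.trans h.symm) l
        (Finset.mem_univ l)
      rw [this, ← h]; linarith
    · field_simp; ring
  set zx : Fin k → Icc a b := fun j => ⟨x.2 j, hx.2.2.1 j⟩ with hzx
  set zy : Fin k → Icc a b := fun j => ⟨y.2 j, hy.2.2.1 j⟩ with hzy
  set γ : Measure (Icc a b × Icc a b) :=
    ∑ i : Fin k × Fin k, ENNReal.ofReal (W i) • Measure.dirac (zx i.1, zy i.2) with hγ
  have hsum : ∑ i, W i = 1 := by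
    rw [Fintype.sum_prod_type]
    simp only [hWx, hx.2.1]
  have hprob : IsProbabilityMeasure γ := by
    refine ⟨?_⟩
    simp only [hγ, Measure.finsetSum_apply, Measure.smul_apply, measure_univ, smul_eq_mul, mul_one]
    rw [← ENNReal.ofReal_sum_of_nonneg fun i _ => hW0 i, hsum, ENNReal.ofReal_one]
  have h1 : γ.map Prod.fst = atomic x hx := by
    rw [hγ, map_sum_ofReal_dirac _ _ measurable_fst, Fintype.sum_prod_type]
    refine Finset.sum_congr rfl fun j _ => ?_
    simp only [← Finset.sum_smul]
    rw [← ENNReal.ofReal_sum_of_nonneg fun i _ => hW0 (j, i), hWx]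
  have h2 : γ.map Prod.snd = atomic y hy := by
    rw [hγ, map_sum_ofReal_dirac _ _ measurable_snd, Fintype.sum_prod_type_right]
    refine Finset.sum_congr rfl fun l _ => ?_
    simp only [← Finset.sum_smul]
    rw [← ENNReal.ofReal_sum_of_nonneg fun i _ => hW0 (i, l), hWy]
  refine (W1_le_of_coupling ⟨γ, hprob⟩ h1 h2).trans ?_
  change ∫ y, dist y.1 y.2 ∂γ ≤ _
  rw [hγ, integral_sum_ofReal_dirac hW0]
  have hdist : ∀ i : Fin k × Fin k, dist (zx i.1) (zy i.2) ≤ b - a := fun i =>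
    Real.dist_le_of_mem_Icc (zx i.1).2 (zy i.2).2
  have hbound : ∀ i : Fin k × Fin k, W i * dist (zx i.1) (zy i.2) ≤
      (if i.1 = i.2 then m i.1 * ‖x.2 - y.2‖ else 0) +
        (x.1 i.1 - m i.1) * (y.1 i.2 - m i.2) / R * (b - a) := fun i => by
    have h3 : 0 ≤ (x.1 i.1 - m i.1) * (y.1 i.2 - m i.2) / R :=
      div_nonneg (mul_nonneg (hmx _) (hmy _)) hR0
    simp only [hW, add_mul]
    refine add_le_add ?_ (mul_le_mul_of_nonneg_left (hdist i) h3)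
    split_ifs with h
    · refine mul_le_mul_of_nonneg_left ?_ (hm0 _)
      rw [← h]
      exact norm_le_pi_norm (x.2 - y.2) i.1
    · simp
  refine (Finset.sum_le_sum fun i _ => hbound i).trans ?_
  rw [Finset.sum_add_distrib, Fintype.sum_prod_type, Fintype.sum_prod_type]
  simp only [Finset.sum_ite_eq, Finset.mem_univ, if_true, ← Finset.sum_mul, ← Finset.sum_div,
    ← Finset.mul_sum, hRx, hRy]
  have hm1 : ∑ j, m j ≤ 1 := by linarith
  -- The leftover mass is the sum of the positive parts of `x.1 j - y.1 j`.
  have hRle : R ≤ ∑ j, |x.1 j - y.1 j| := by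
    rw [← hRx]
    refine Finset.sum_le_sum fun j _ => ?_
    simp only [hm]
    rcases le_total (x.1 j) (y.1 j) with h | h
    · simp [min_eq_left h]
    · rw [min_eq_right h]; exact le_abs_self _
  have hk : 0 ≤ (b - a) := by
    rcases Nat.eq_zero_or_pos k with rfl | hk
    · have := hx.2.1; simp at this
    · exact dist_nonneg.trans (hdist (⟨0, hk⟩, ⟨0, hk⟩))
  have h5 : R * R / R ≤ R := by
    rcases hR0.eq_or_lt with h | h
    · simp [← h]
    · rw [mul_div_assoc, div_self h.ne', mul_one]
  calc _ ≤ 1 * ‖x.2 - y.2‖ + (∑ j, |x.1 j - y.1 j|) * (b - a) := by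
        gcongr
        exact h5.trans hRle
    _ = _ := by ring

end Wasserstein

/-! ### Consequences of the Lipschitz property of the objective -/

namespace Setup

variable {P : Setup} {r₀ L : ℝ}

lemma Φ_eq {k : ℕ} {x : Dec k} (hx : x ∈ P.X k) (π : unitInterval) (q : P.PM) :
    P.Φ k π q x = P.F (atomic x hx) π q := dif_pos hx

/-- The factor `yHi - yLo + 1` dominates both coefficients in `W1_atomic_le`, the diameter and `1`;
the absolute value covers a negative `L`. -/
lemma LipschitzObjective.abs_Φ_sub_le (hL : P.LipschitzObjective r₀ L) {k : ℕ} {π : unitInterval}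
    {q : P.PM} (hπ : P.near r₀ π q) {x y : Dec k} (hx : x ∈ P.admDec k) (hy : y ∈ P.admDec k) :
    |P.Φ k π q x - P.Φ k π q y| ≤
      |L| * (P.yHi - P.yLo + 1) * (∑ j, |x.1 j - y.1 j| + ‖x.2 - y.2‖) := by
  obtain ⟨hx, hxa⟩ := hx
  obtain ⟨hy, hya⟩ := hy
  rw [Φ_eq hx, Φ_eq hy]
  refine (hL π q hπ _ hxa _ hya).trans ?_
  have hW := W1_atomic_le hx hy
  have hW0 := W1_nonneg (atomic x hx) (atomic y hy)
  have hd := sub_pos.2 P.yLo_lt_yHi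
  have hs : 0 ≤ ∑ j, |x.1 j - y.1 j| := Finset.sum_nonneg fun _ _ => abs_nonneg _
  have hn := norm_nonneg (x.2 - y.2)
  calc L * W1 (atomic x hx) (atomic y hy) ≤ |L| * W1 (atomic x hx) (atomic y hy) :=
        mul_le_mul_of_nonneg_right (le_abs_self L) hW0
    _ ≤ |L| * ((P.yHi - P.yLo + 1) * (∑ j, |x.1 j - y.1 j| + ‖x.2 - y.2‖)) :=
        mul_le_mul_of_nonneg_left (by nlinarith) (abs_nonneg L)
    _ = _ := by ring

/-- `W₁` is at most the diameter of the outcome range, so a `W₁`-Lipschitz objective is bounded.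
This makes the suprema and infima over feasible measures genuine rather than default values. -/
lemma LipschitzObjective.exists_bound (hL : P.LipschitzObjective r₀ L) {π : unitInterval}
    {q : P.PM} (hπ : P.near r₀ π q) : ∃ M, ∀ μ ∈ P.adm, |P.F μ π q| ≤ M := by
  rcases P.adm.eq_empty_or_nonempty with h | ⟨ν, hν⟩
  · simp [h]
  refine ⟨|P.F ν π q| + |L| * (P.yHi - P.yLo), fun μ hμ => ?_⟩
  have h1 := hL π q hπ μ hμ ν hν
  have h2 := W1_le_of_dist_le (Y := P.Y) (d := P.yHi - P.yLo)
    (fun y z => Real.dist_le_of_mem_Icc y.2 z.2) μ ν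
  have h3 := abs_sub_abs_le_abs_sub (P.F μ π q) (P.F ν π q)
  have h4 : L * W1 μ ν ≤ |L| * (P.yHi - P.yLo) :=
    (mul_le_mul_of_nonneg_right (le_abs_self L) (W1_nonneg μ ν)).trans
      (mul_le_mul_of_nonneg_left h2 (abs_nonneg L))
  linarith

/-- The finitely supported measures of the feasible points. -/
def feasAtomic (P : Setup) (n k : ℕ) (u : P.U n) : Set P.PM :=
  {μ | ∃ x, ∃ hx : x ∈ P.X k, atomic x hx = μ ∧ μ ∈ P.feasMeasures n u}

/-- Indexing the value by measures instead of decision vectors matches the uniformity hypothesis,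
which ranges over nearly feasible measures. -/
lemma Φ_image_feas (n k : ℕ) (u : P.U n) (π : unitInterval) (q : P.PM) :
    P.Φ k π q '' P.feas n k u = (fun μ => P.F μ π q) '' P.feasAtomic n k u := by
  ext r
  constructor
  · rintro ⟨x, ⟨hx, hxf⟩, rfl⟩
    exact ⟨_, ⟨x, hx, rfl, hxf⟩, (Φ_eq hx π q).symm⟩
  · rintro ⟨_, ⟨x, hx, rfl, hxf⟩, rfl⟩
    exact ⟨x, ⟨hx, hxf⟩, Φ_eq hx π q⟩

/-- Directional differentiability of the value in parameters of the objective. -/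
lemma LipschitzObjective.hadamard_value (hL : P.LipschitzObjective r₀ L) {W E : Type*}
    [NormedAddCommGroup E] [NormedSpace ℝ E] {e : W → E} (p : W → unitInterval × P.PM) {w₀ : W}
    {δ : ℝ} (hδ : 0 < δ) (hp : ∀ w, ‖e w - e w₀‖ < δ → P.near r₀ (p w).1 (p w).2) (s : Goal)
    {n k : ℕ} {ρ : ℝ} {u : P.U n} (hu : u ∈ Metric.ball (P.u₀ n) ρ)
    (h : UniformHadamardDirDifferentiableAt e (fun μ w => P.F μ (p w).1 (p w).2)
      (P.nearFeasible n ρ) w₀) :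
    HadamardDirDifferentiableAt e (fun w => P.V s n k u (p w).1 (p w).2) w₀ := by
  have hsub : P.feasAtomic n k u ⊆ P.nearFeasible n ρ := by
    rintro _ ⟨x, hx, rfl, hxf⟩
    exact ⟨u, hu, hxf⟩
  have hb : ∀ w, ‖e w - e w₀‖ < δ → ∃ M, ∀ μ ∈ P.feasAtomic n k u,
      |P.F μ (p w).1 (p w).2| ≤ M := by
    intro w hw
    obtain ⟨M, hM⟩ := hL.exists_bound (hp w hw)
    refine ⟨M, ?_⟩
    rintro _ ⟨x, hx, rfl, hxf⟩
    exact hM _ hxf.1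
  cases s with
  | min =>
    simp only [V, Φ_image_feas]
    exact hadamardDirDifferentiableAt_sInf (h.mono hsub) hδ hb
  | max =>
    simp only [V, Φ_image_feas]
    exact hadamardDirDifferentiableAt_sSup (h.mono hsub) hδ hb

/-- In each of the three cases the ball of radius `r₀` around the base point lies in `near r₀`; for
the joint parameter this uses that the product norm is the maximum. -/
lemma LipschitzObjective.hadamard_parameters (hL : P.LipschitzObjective r₀ L) (hr₀ : 0 < r₀)
    (s : Goal) (n k : ℕ) (ρ : ℝ) (u : P.U n) (hu : u ∈ Metric.ball (P.u₀ n) ρ) :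
    (UniformHadamardDirDifferentiableAt (fun π : unitInterval => (π : ℝ))
        (fun μ π => P.F μ π P.q₀) (P.nearFeasible n ρ) P.π₀ →
      HadamardDirDifferentiableAt (fun π : unitInterval => (π : ℝ))
        (fun π => P.V s n k u π P.q₀) P.π₀) ∧
    (UniformHadamardDirDifferentiableAt (blEmb : P.PM → BLStar P.Y)
        (fun μ q => P.F μ P.π₀ q) (P.nearFeasible n ρ) P.q₀ →
      HadamardDirDifferentiableAt (blEmb : P.PM → BLStar P.Y)
        (fun q => P.V s n k u P.π₀ q) P.q₀) ∧
    (UniformHadamardDirDifferentiableAt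
        (fun w : unitInterval × P.PM => ((w.1 : ℝ), (blEmb w.2 : BLStar P.Y)))
        (fun μ w => P.F μ w.1 w.2) (P.nearFeasible n ρ) (P.π₀, P.q₀) →
      HadamardDirDifferentiableAt
        (fun w : unitInterval × P.PM => ((w.1 : ℝ), (blEmb w.2 : BLStar P.Y)))
        (fun w => P.V s n k u w.1 w.2) (P.π₀, P.q₀)) := by
  refine ⟨fun h => ?_, fun h => ?_, fun h => ?_⟩
  · exact hL.hadamard_value (fun π => (π, P.q₀)) hr₀
      (fun w hw => ⟨by simpa using hw, by simpa using hr₀⟩) s hu h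
  · exact hL.hadamard_value (fun q => (P.π₀, q)) hr₀
      (fun w hw => ⟨by simpa using hr₀, hw⟩) s hu h
  · refine hL.hadamard_value (fun w => w) hr₀ (fun w hw => ?_) s hu h
    rw [Prod.mk_sub_mk, Prod.norm_mk, max_lt_iff] at hw
    exact hw

end Setup

/-! ### Calculus within convex sets -/

section Calculus

variable {E F : Type*} [NormedAddCommGroup E] [NormedSpace ℝ E] [NormedAddCommGroup F]
  [NormedSpace ℝ F]

/-- Two derivatives within a convex set agree on the directions that point into the set. -/
lemma hasFDerivWithinAt_eq_of_mem_convex {f : E → F} {f' f'' : E →L[ℝ] F} {s : Set E} {x y : E}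
    (hs : Convex ℝ s) (hx : x ∈ s) (hy : y ∈ s) (h' : HasFDerivWithinAt f f' s x)
    (h'' : HasFDerivWithinAt f f'' s x) : f' (y - x) = f'' (y - x) :=
  h'.unique_on h'' (mem_tangentConeAt_of_segment_subset (hs.segment_subset hx hy))

/-- A function that is `C¹` within a convex set is strictly differentiable within this set. -/
lemma strict_within_of_contDiffWithinAt {f : E → F} {f' : E →L[ℝ] F} {s : Set E} {x : E}
    (hs : Convex ℝ s) (hx : x ∈ s) (hf : ContDiffWithinAt ℝ 1 f s x)
    (h' : HasFDerivWithinAt f f' s x) {ε : ℝ} (hε : 0 < ε) :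
    ∃ δ > 0, ∀ y ∈ s ∩ Metric.ball x δ, ∀ z ∈ s ∩ Metric.ball x δ,
      ‖f y - f z - f' (y - z)‖ ≤ ε * ‖y - z‖ := by
  have hf1 : ContDiffWithinAt ℝ (0 + 1) f s x := by simpa using hf
  obtain ⟨u, hu, -, -, g, hg, hgc⟩ :=
    (contDiffWithinAt_succ_iff_hasFDerivWithinAt' (by simp)).1 hf1
  rw [insert_eq_of_mem hx] at hu
  have hcont : Tendsto g (𝓝[s] x) (𝓝 (g x)) := hgc.continuousWithinAt
  have hev : ∀ᶠ y in 𝓝[s] x, y ∈ u ∧ ‖g y - g x‖ ≤ ε := by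
    refine (eventually_mem_set.2 hu).and ?_
    have := hcont.eventually (Metric.closedBall_mem_nhds _ hε)
    filter_upwards [this] with y hy
    simpa [dist_eq_norm] using hy
  rw [eventually_nhdsWithin_iff, Metric.eventually_nhds_iff_ball] at hev
  obtain ⟨δ, hδ, hball⟩ := hev
  have hxu : x ∈ u := (hball x (Metric.mem_ball_self hδ) hx).1
  refine ⟨δ, hδ, fun y hy z hz => ?_⟩
  have key := (hs.inter (convex_ball x δ)).norm_image_sub_le_of_norm_hasFDerivWithin_le'
    (f := f) (f' := g) (φ := g x) (C := ε)
    (fun w hw => (hg w (hball w hw.2 hw.1).1).mono inter_subset_left)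
    (fun w hw => (hball w hw.2 hw.1).2) hz hy
  -- The set may have empty interior, so `f'` and `g x` need not coincide. They agree on `y - x` and
  -- `z - x`, hence on `y - z`.
  have h1 := hasFDerivWithinAt_eq_of_mem_convex hs hx hy.1 h' (hg x hxu)
  have h2 := hasFDerivWithinAt_eq_of_mem_convex hs hx hz.1 h' (hg x hxu)
  have h3 : f' (y - z) = g x (y - z) := by
    have : y - z = (y - x) - (z - x) := by abel
    rw [this, map_sub f', map_sub (g x), h1, h2]
  rwa [h3]

/-- Second-order Taylor expansion within a convex set. -/
lemma taylor_two_within {f : E → ℝ} {f' : E →L[ℝ] ℝ} {s : Set E} {x : E}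
    (hs : Convex ℝ s) (hx : x ∈ s) (hf : ContDiffWithinAt ℝ 2 f s x)
    (h' : HasFDerivWithinAt f f' s x) :
    ∃ Q : E →L[ℝ] E →L[ℝ] ℝ, ∀ ε > (0 : ℝ), ∀ᶠ y in 𝓝[s] x,
      |f y - f x - f' (y - x) - Q (y - x) (y - x) / 2| ≤ ε * ‖y - x‖ ^ 2 := by
  have hf1 : ContDiffWithinAt ℝ (1 + 1) f s x := by
    rw [one_add_one_eq_two]; exact hf
  obtain ⟨u, hu, -, -, g, hg, hgc⟩ :=
    (contDiffWithinAt_succ_iff_hasFDerivWithinAt' (by simp)).1 hf1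
  rw [insert_eq_of_mem hx] at hu
  have hgd := (hgc.differentiableWithinAt one_ne_zero).hasFDerivWithinAt
  set Q := fderivWithin ℝ g s x
  refine ⟨Q, fun ε hε => ?_⟩
  have hev : ∀ᶠ y in 𝓝[s] x, y ∈ u ∧ ‖g y - g x - Q (y - x)‖ ≤ ε * ‖y - x‖ :=
    (eventually_mem_set.2 hu).and (hgd.isLittleO.def hε)
  rw [eventually_nhdsWithin_iff, Metric.eventually_nhds_iff_ball] at hev
  obtain ⟨δ, hδ, hball⟩ := hev
  have hxu : x ∈ u := (hball x (Metric.mem_ball_self hδ) hx).1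
  rw [eventually_nhdsWithin_iff, Metric.eventually_nhds_iff_ball]
  refine ⟨δ, hδ, fun y hy hys => ?_⟩
  set v := y - x with hv
  have hvδ : ‖v‖ < δ := by simpa [hv, dist_eq_norm] using hy
  have hline : ∀ t ∈ Icc (0 : ℝ) 1, x + t • v ∈ s ∧ x + t • v ∈ Metric.ball x δ := by
    intro t ht
    refine ⟨?_, ?_⟩
    · have := hs.add_smul_sub_mem hx hys ht
      simpa [hv] using this
    · have : ‖t • v‖ ≤ ‖v‖ := by
        rw [norm_smul, Real.norm_eq_abs, abs_of_nonneg ht.1]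
        nlinarith [norm_nonneg v, ht.2]
      simpa [dist_eq_norm] using lt_of_le_of_lt this hvδ
  -- The remainder of the expansion along the segment from `x` to `y`: its derivative is at most `ε
  -- ‖v‖²` because `Q` is the derivative of `g` at `x`, and the mean value inequality on `[0, 1]`
  -- concludes.
  have hder : ∀ t ∈ Icc (0 : ℝ) 1, HasDerivWithinAt
      (fun t : ℝ => f (x + t • v) - t * g x v - t ^ 2 * (Q v v / 2))
      (g (x + t • v) v - g x v - t * Q v v) (Icc 0 1) t := by
    intro t ht
    have hl : HasDerivWithinAt (fun t : ℝ => x + t • v) v (Icc 0 1) t := by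
      have := ((hasDerivAt_id t).smul_const v).const_add x
      simpa using this.hasDerivWithinAt
    have h1 : HasDerivWithinAt (fun t : ℝ => f (x + t • v)) (g (x + t • v) v) (Icc 0 1) t :=
      (hg _ (hball _ (hline t ht).2 (hline t ht).1).1).comp_hasDerivWithinAt t hl
        (fun r hr => (hline r hr).1)
    have h2 : HasDerivWithinAt (fun t : ℝ => t * g x v) (g x v) (Icc 0 1) t := by
      simpa using ((hasDerivAt_id t).mul_const (g x v)).hasDerivWithinAt
    have h3 : HasDerivWithinAt (fun t : ℝ => t ^ 2 * (Q v v / 2)) (t * Q v v) (Icc 0 1) t := by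
      have := ((hasDerivAt_pow 2 t).mul_const (Q v v / 2)).hasDerivWithinAt (s := Icc 0 1)
      refine this.congr_deriv ?_
      norm_num
      ring
    exact (h1.sub h2).sub h3
  have hbd : ∀ t ∈ Icc (0 : ℝ) 1, ‖g (x + t • v) v - g x v - t * Q v v‖ ≤ ε * ‖v‖ ^ 2 := by
    intro t ht
    have h1 := (hball _ (hline t ht).2 (hline t ht).1).2
    have h2 : g (x + t • v) v - g x v - t * Q v v
        = (g (x + t • v) - g x - Q (x + t • v - x)) v := by
      simp only [add_sub_cancel_left, map_smul, _root_.sub_apply, _root_.smul_apply, smul_eq_mul]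
    rw [h2]
    refine (ContinuousLinearMap.le_opNorm _ _).trans ?_
    have h3 : ‖x + t • v - x‖ ≤ ‖v‖ := by
      rw [add_sub_cancel_left, norm_smul, Real.norm_eq_abs, abs_of_nonneg ht.1]
      nlinarith [norm_nonneg v, ht.2]
    calc _ ≤ (ε * ‖x + t • v - x‖) * ‖v‖ := by gcongr
      _ ≤ (ε * ‖v‖) * ‖v‖ := by gcongr
      _ = _ := by ring
  have key := (convex_Icc (0 : ℝ) 1).norm_image_sub_le_of_norm_hasDerivWithin_le hder hbd
    (left_mem_Icc.2 zero_le_one) (right_mem_Icc.2 zero_le_one)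
  have h1 := hasFDerivWithinAt_eq_of_mem_convex hs hx hys h' (hg x hxu)
  have e1 : x + v = y := by simp [hv]
  simp only [one_smul, zero_smul, add_zero, e1, one_mul, zero_mul, one_pow, sub_zero, norm_one,
    mul_one, Real.norm_eq_abs] at key
  rw [h1, ← hv]
  convert key using 2
  ring

/-- A quadratic polynomial that is `o(t²)` at `0+` vanishes. -/
lemma quadratic_eq_zero_of_isLittleO {a b : ℝ}
    (h : (fun t : ℝ => t * a + t ^ 2 * b) =o[𝓝[>] 0] fun t => t ^ 2) : b = 0 := by
  have hpos : ∀ᶠ t : ℝ in 𝓝[>] 0, 0 < t := self_mem_nhdsWithin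
  have hid : Tendsto (fun t : ℝ => t) (𝓝[>] 0) (𝓝 0) := nhdsWithin_le_nhds
  have h2 := h.tendsto_div_nhds_zero
  have ha : a = 0 := by
    have h3 : Tendsto (fun t : ℝ => (t * a + t ^ 2 * b) / t ^ 2 * t - t * b) (𝓝[>] 0)
        (𝓝 (0 * 0 - 0 * b)) := (h2.mul hid).sub (hid.mul_const b)
    have h4 : Tendsto (fun _ : ℝ => a) (𝓝[>] 0) (𝓝 (0 * 0 - 0 * b)) := by
      refine h3.congr' ?_
      filter_upwards [hpos] with t ht
      field_simp
      ring
    simpa using tendsto_nhds_unique tendsto_const_nhds h4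
  subst ha
  have h4 : Tendsto (fun _ : ℝ => b) (𝓝[>] 0) (𝓝 0) := by
    refine h2.congr' ?_
    filter_upwards [hpos] with t ht
    field_simp
    ring
  exact tendsto_nhds_unique tendsto_const_nhds h4

/-- The second derivative along a ray is the value of the quadratic form of the second-order
expansion. -/
lemma iteratedDerivWithin_two_ray {f : E → ℝ} {f' : E →L[ℝ] ℝ} {Q : E →L[ℝ] E →L[ℝ] ℝ}
    {s : Set E} {x d : E} (hf : ContDiffWithinAt ℝ 2 f s x)
    (hQ : ∀ ε > (0 : ℝ), ∀ᶠ y in 𝓝[s] x,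
      |f y - f x - f' (y - x) - Q (y - x) (y - x) / 2| ≤ ε * ‖y - x‖ ^ 2)
    (hd : ∀ᶠ t : ℝ in 𝓝[≥] 0, x + t • d ∈ s) :
    iteratedDerivWithin 2 (fun t : ℝ => f (x + t • d)) (Ici 0) 0 = Q d d := by
  set g : ℝ → ℝ := fun t => f (x + t • d) with hg
  have hline : Continuous fun t : ℝ => x + t • d := by fun_prop
  have htend : Tendsto (fun t : ℝ => x + t • d) (𝓝[≥] 0) (𝓝[s] x) := by
    refine tendsto_nhdsWithin_iff.2 ⟨?_, hd⟩
    have := (hline.tendsto 0).mono_left (nhdsWithin_le_nhds (s := Ici (0 : ℝ)))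
    simpa using this
  have hgc : ContDiffWithinAt ℝ 2 g (Ici 0) 0 := by
    have hf0 : ContDiffWithinAt ℝ 2 f s (x + (0 : ℝ) • d) := by simpa using hf
    have h1 : ContDiffWithinAt ℝ 2 (f ∘ fun t : ℝ => x + t • d)
        (Ici 0 ∩ (fun t : ℝ => x + t • d) ⁻¹' s) 0 :=
      hf0.comp 0 (by fun_prop) (fun t ht => ht.2)
    refine h1.mono_of_mem_nhdsWithin ?_
    exact inter_mem self_mem_nhdsWithin hd
  obtain ⟨w, hw, -, hwc⟩ := hgc.contDiffOn (m := 2) le_rfl (by simp)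
  rw [insert_eq_of_mem self_mem_Ici] at hw
  obtain ⟨b, hb, hbw⟩ := mem_nhdsGE_iff_exists_Icc_subset.1 hw
  have hb0 : (0 : ℝ) < b := hb
  have hgI : ContDiffOn ℝ 2 g (Icc 0 b) := hwc.mono hbw
  -- The one-variable Taylor formula and the assumed expansion `hQ` along the ray are two quadratic
  -- expansions of `g` at `0+`; their second-order coefficients must agree, whatever the first-order
  -- ones.
  have hT := taylor_isLittleO (n := 2) (convex_Icc 0 b) (left_mem_Icc.2 hb0.le) hgI
  have hset : iteratedDerivWithin 2 g (Icc 0 b) 0 = iteratedDerivWithin 2 g (Ici 0) 0 := by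
    simp only [iteratedDerivWithin]
    rw [iteratedFDerivWithin_congr_set]
    exact (nhdsWithin_eq_iff_eventuallyEq.1 (nhdsWithin_Icc_eq_nhdsGE hb0))
  have hle : 𝓝[>] (0 : ℝ) ≤ 𝓝[Icc 0 b] 0 := by
    rw [nhdsWithin_Icc_eq_nhdsGE hb0]
    exact nhdsWithin_mono _ Ioi_subset_Ici_self
  have hT' := hT.mono hle
  simp only [sub_zero] at hT'
  have hQ' : (fun t : ℝ => g t - g 0 - t * f' d - t ^ 2 * (Q d d / 2)) =o[𝓝[>] 0]
      fun t => t ^ 2 := by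
    refine Asymptotics.isLittleO_iff.2 fun c hc => ?_
    have hd2 : 0 < ‖d‖ ^ 2 + 1 := by positivity
    have := (htend.mono_left (nhdsWithin_mono _ Ioi_subset_Ici_self)).eventually
      (hQ (c / (‖d‖ ^ 2 + 1)) (by positivity))
    filter_upwards [this] with t ht
    simp only [add_sub_cancel_left, map_smul, norm_smul, _root_.smul_apply,
      smul_eq_mul, Real.norm_eq_abs, mul_pow, sq_abs] at ht
    have e : g t - g 0 - t * f' d - t ^ 2 * (Q d d / 2)
        = f (x + t • d) - f x - t * f' d - t * (t * Q d d) / 2 := by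
      simp only [hg, zero_smul, add_zero]; ring
    rw [e, Real.norm_eq_abs, Real.norm_eq_abs, abs_of_nonneg (sq_nonneg t)]
    refine ht.trans ?_
    rw [div_mul_eq_mul_div, div_le_iff₀ hd2]
    nlinarith [sq_nonneg t, mul_nonneg hc.le (sq_nonneg t)]
  have hsub := hQ'.sub hT'
  have hpoly := quadratic_eq_zero_of_isLittleO (a := derivWithin g (Icc 0 b) 0 - f' d)
    (b := iteratedDerivWithin 2 g (Ici 0) 0 / 2 - Q d d / 2) (by
      refine hsub.congr_left fun t => ?_
      rw [← hset]
      simp only [taylorWithinEval_succ, taylor_within_zero_eval, Nat.factorial, smul_eq_mul,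
        sub_zero]
      norm_num
      ring)
  linarith

end Calculus

/-! ### Sensitivity of the value of a nonlinear program -/

section Sensitivity

variable {E U : Type*} [NormedAddCommGroup E] [NormedSpace ℝ E] [NormedAddCommGroup U]
  [NormedSpace ℝ U]

/-- Difference quotients in the parameter of a function that is strictly differentiable within
`S × U`, along moving points of `S`. -/
lemma tendsto_partial_quotient {S : Set E} (hS : Convex ℝ S) {x : E} (hx : x ∈ S) {u₀ : U}
    {c : E × U → ℝ} {c' : E × U →L[ℝ] ℝ} (hc : ContDiffWithinAt ℝ 1 c (S ×ˢ univ) (x, u₀))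
    (hc' : HasFDerivWithinAt c c' (S ×ˢ univ) (x, u₀)) {t : ℕ → ℝ} {us : ℕ → U} {h : U}
    (ht : ∀ m, 0 < t m) (ht0 : Tendsto t atTop (𝓝 0))
    (hu : Tendsto (fun m => (t m)⁻¹ • (us m - u₀)) atTop (𝓝 h)) {zs : ℕ → E}
    (hz : Tendsto zs atTop (𝓝 x)) (hzS : ∀ᶠ m in atTop, zs m ∈ S) :
    Tendsto (fun m => (t m)⁻¹ * (c (zs m, us m) - c (zs m, u₀))) atTop (𝓝 (c' (0, h))) := by
  have husub := tendsto_of_quotient (e := fun u : U => u) ht ht0 hu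
  have hus : Tendsto us atTop (𝓝 u₀) := by simpa using husub.add_const u₀
  have h1 : Tendsto (fun m => c' (0, (t m)⁻¹ • (us m - u₀))) atTop (𝓝 (c' (0, h))) :=
    (c'.continuous.tendsto _).comp (tendsto_const_nhds.prodMk_nhds hu)
  suffices h2 : Tendsto (fun m => (t m)⁻¹ * (c (zs m, us m) - c (zs m, u₀)) -
      c' (0, (t m)⁻¹ • (us m - u₀))) atTop (𝓝 0) by simpa using h2.add h1
  rw [Metric.tendsto_nhds]
  intro ε hε
  have hpos : 0 < ‖h‖ + 1 := by positivity
  -- Strict differentiability compares `(zs m, us m)` with `(zs m, u₀)` directly, with error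
  -- relative to `‖us m - u₀‖` only; this is why the speed of `zs` does not matter.
  obtain ⟨δ, hδ, hst⟩ := strict_within_of_contDiffWithinAt (hS.prod convex_univ)
    (mk_mem_prod hx (mem_univ u₀)) hc hc' (ε := ε / (2 * (‖h‖ + 1))) (by positivity)
  have hb : ∀ᶠ m in atTop, ‖(t m)⁻¹ • (us m - u₀)‖ < ‖h‖ + 1 :=
    hu.norm.eventually (gt_mem_nhds (by linarith))
  have e1 := (hz.prodMk_nhds hus).eventually (Metric.ball_mem_nhds _ hδ)
  have e2 := (hz.prodMk_nhds (tendsto_const_nhds (x := u₀))).eventually (Metric.ball_mem_nhds _ hδ)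
  filter_upwards [hb, e1, e2, hzS] with m hm h1 h2 h3
  have key := hst _ ⟨mk_mem_prod h3 (mem_univ _), h1⟩ _ ⟨mk_mem_prod h3 (mem_univ _), h2⟩
  have htm := ht m
  simp only [Prod.mk_sub_mk, sub_self, Prod.norm_mk, norm_zero] at key
  rw [max_eq_right (norm_nonneg _)] at key
  have e3 : (0, (t m)⁻¹ • (us m - u₀)) = (t m)⁻¹ • ((0, us m - u₀) : E × U) := by
    simp
  rw [dist_zero_right, e3, map_smul, smul_eq_mul, ← mul_sub, norm_mul, norm_inv,
    Real.norm_of_nonneg htm.le]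
  rw [norm_smul, norm_inv, Real.norm_of_nonneg htm.le] at hm
  calc _ ≤ (t m)⁻¹ * (ε / (2 * (‖h‖ + 1)) * ‖us m - u₀‖) := by gcongr
    _ = ε / (2 * (‖h‖ + 1)) * ((t m)⁻¹ * ‖us m - u₀‖) := by ring
    _ ≤ ε / (2 * (‖h‖ + 1)) * (‖h‖ + 1) := by gcongr
    _ = ε / 2 := by field_simp
    _ < ε := half_lt_self hε

variable {ι : Type*} [Fintype ι]

/-- The second-order sufficient condition bounds the increase of the Lagrangian along feasible
points for perturbed parameters whose objective does not fall too much. -/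
lemma lagrangian_increase_le [FiniteDimensional ℝ E] {S : Set E} {x : E} (T : Submodule ℝ E)
    (hT : ∀ y ∈ S, y - x ∈ T) {u₀ : U} {φ Λ : E → ℝ} {φ' : E →L[ℝ] ℝ}
    (hφ : HasFDerivWithinAt φ φ' S x) {Q : E →L[ℝ] E →L[ℝ] ℝ}
    (hQ : ∀ ε > (0 : ℝ), ∀ᶠ y in 𝓝[S] x, |Λ y - Λ x - Q (y - x) (y - x) / 2| ≤ ε * ‖y - x‖ ^ 2)
    {c : ι → E × U → ℝ} {c' : ι → E × U →L[ℝ] ℝ} (hc0 : ∀ i, c i (x, u₀) = 0)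
    (hc : ∀ i, HasFDerivWithinAt (c i) (c' i) (S ×ˢ univ) (x, u₀)) {l : ι → ℝ} {eq : ι → Prop}
    (hl : ∀ i, ¬ eq i → 0 ≤ l i) (hstat : ∀ v ∈ T, φ' v + ∑ i, l i * c' i (v, 0) = 0)
    (hsosc : ∀ d ∈ T, d ≠ 0 → (∀ i, 0 ≤ c' i (d, 0) ∧ (eq i ∨ l i ≠ 0 → c' i (d, 0) = 0)) →
      Q d d < 0)
    {t : ℕ → ℝ} {us : ℕ → U} {h : U} (ht : ∀ m, 0 < t m) (ht0 : Tendsto t atTop (𝓝 0))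
    (hu : Tendsto (fun m => (t m)⁻¹ • (us m - u₀)) atTop (𝓝 h)) {xs : ℕ → E}
    (hx : Tendsto xs atTop (𝓝 x)) (hxS : ∀ᶠ m in atTop, xs m ∈ S)
    (hfeas : ∀ᶠ m in atTop, ∀ i, 0 ≤ c i (xs m, us m) ∧ (eq i → c i (xs m, us m) = 0))
    {C : ℝ} (hlow : ∀ᶠ m in atTop, -C * t m ≤ φ (xs m) - φ x) {η : ℝ} (hη : 0 < η) :
    ∀ᶠ m in atTop, Λ (xs m) - Λ x ≤ η * t m := by
  -- If the bound fails along an ultrafilter, its negation holds there eventually; the ultrafilter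
  -- replaces the extraction of subsequences.
  refine mem_iff_ultrafilter.2 fun G hG => ?_
  by_contra hcon
  have hGbad : ∀ᶠ m in (G : Filter ℕ), η * t m < Λ (xs m) - Λ x := by
    filter_upwards [Ultrafilter.compl_mem_iff_notMem.2 hcon] with m hm
    exact not_le.1 hm
  set v : ℕ → E := fun m => xs m - x with hv
  have hv0 : Tendsto v G (𝓝 0) := by simpa using (hx.mono_left hG).sub_const x
  have hxw : Tendsto xs G (𝓝[S] x) :=
    tendsto_nhdsWithin_iff.2 ⟨hx.mono_left hG, hG hxS⟩
  have hvne : ∀ᶠ m in (G : Filter ℕ), 0 < ‖v m‖ := by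
    filter_upwards [hGbad] with m hm
    rw [norm_pos_iff]
    intro h0
    have : xs m = x := sub_eq_zero.1 h0
    rw [this, sub_self] at hm
    exact absurd hm (not_lt.2 (mul_pos hη (ht m)).le)
  -- the normalized direction converges along the ultrafilter
  set d : ℕ → E := fun m => ‖v m‖⁻¹ • v m with hd
  have hdnorm : ∀ᶠ m in (G : Filter ℕ), ‖d m‖ = 1 := by
    filter_upwards [hvne] with m hm
    simp only [hd, norm_smul, norm_inv, norm_norm]
    exact inv_mul_cancel₀ hm.ne'
  obtain ⟨D, hD1, hDlim⟩ : ∃ D ∈ Metric.sphere (0 : E) 1, Tendsto d G (𝓝 D) := by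
    have := (isCompact_sphere (0 : E) 1).ultrafilter_le_nhds (G.map d)
      (le_principal_iff.2 (by
        change ∀ᶠ m in (G : Filter ℕ), d m ∈ Metric.sphere (0 : E) 1
        filter_upwards [hdnorm] with m hm
        simpa using hm))
    exact this
  have hDne : D ≠ 0 := by
    rintro rfl
    simp at hD1
  have hDT : D ∈ T := by
    refine T.closed_of_finiteDimensional.mem_of_tendsto hDlim ?_
    filter_upwards [hG hxS] with m hm
    exact T.smul_mem _ (hT _ hm)
  -- the parameter moves slower than the point
  have hτ : Tendsto (fun m => ‖v m‖⁻¹ * t m) G (𝓝 0) := by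
    have hC : 0 < ‖Q‖ / 2 + 1 := by positivity
    -- The expansion with error constant `1` gives `η t_m < Λ (xs m) - Λ x ≤ (‖Q‖ / 2 + 1) ‖v m‖²`,
    -- hence this bound on `t_m / ‖v m‖`.
    have hlim : Tendsto (fun m => (‖Q‖ / 2 + 1) / η * ‖v m‖) G (𝓝 0) := by
      simpa using hv0.norm.const_mul ((‖Q‖ / 2 + 1) / η)
    refine squeeze_zero' (Eventually.of_forall fun m => by have := (ht m).le; positivity) ?_ hlim
    filter_upwards [hxw.eventually (hQ 1 one_pos), hGbad, hvne] with m h1 h2 h3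
    have h4 : Q (v m) (v m) ≤ ‖Q‖ * ‖v m‖ * ‖v m‖ :=
      (le_abs_self _).trans (Q.le_opNorm₂ (v m) (v m))
    have h5 := (abs_le.1 h1).2
    rw [inv_mul_le_iff₀ h3, div_mul_eq_mul_div, mul_div_assoc', le_div_iff₀ hη]
    nlinarith
  have huv : Tendsto (fun m => ‖v m‖⁻¹ • (us m - u₀)) G (𝓝 0) := by
    have := hτ.smul (hu.mono_left hG)
    rw [zero_smul] at this
    refine this.congr fun m => ?_
    rw [smul_smul, mul_assoc, mul_inv_cancel₀ (ht m).ne', mul_one]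
  have husub : Tendsto (fun m => us m - u₀) G (𝓝 0) :=
    (tendsto_of_quotient (e := fun u : U => u) ht ht0 hu).mono_left hG
  -- The input moves by `o(‖v‖)`, so in these quotients only the direction `(D, 0)` survives.
  have hcd : ∀ i, Tendsto (fun m => ‖v m‖⁻¹ * c i (xs m, us m)) G (𝓝 (c' i (D, 0))) := by
    intro i
    have := (hc i).lim (l := (G : Filter ℕ)) (c := fun m => ‖v m‖⁻¹)
      (d := fun m => (v m, us m - u₀)) (v := (D, 0)) (hv0.prodMk_nhds husub)
      (by
        filter_upwards [hG hxS] with m hm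
        simpa [hv] using hm) (hDlim.prodMk_nhds huv)
    simpa [hv, hc0] using this
  have hφd : Tendsto (fun m => ‖v m‖⁻¹ * (φ (xs m) - φ x)) G (𝓝 (φ' D)) := by
    have := hφ.lim (l := (G : Filter ℕ)) (c := fun m => ‖v m‖⁻¹) (d := v) (v := D) hv0
      (by
        filter_upwards [hG hxS] with m hm
        simpa [hv] using hm) hDlim
    simpa [hv] using this
  have hnn : ∀ i, 0 ≤ c' i (D, 0) := fun i =>
    ge_of_tendsto (hcd i) (by
      filter_upwards [hG hfeas] with m hm
      exact mul_nonneg (inv_nonneg.2 (norm_nonneg _)) (hm i).1)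
  have heq : ∀ i, eq i → c' i (D, 0) = 0 := fun i hi =>
    tendsto_nhds_unique (hcd i) (tendsto_const_nhds.congr' (by
      filter_upwards [hG hfeas] with m hm
      rw [(hm i).2 hi, mul_zero]))
  -- By `hlow` the objective falls by at most `C t_m`, which is `o(‖v m‖)`.
  have hφ0 : 0 ≤ φ' D := by
    have hz : Tendsto (fun m => -C * (‖v m‖⁻¹ * t m)) G (𝓝 0) := by
      simpa using hτ.const_mul (-C)
    refine le_of_tendsto_of_tendsto hz hφd ?_
    filter_upwards [hG hlow] with m hm
    have := mul_le_mul_of_nonneg_left hm (inv_nonneg.2 (norm_nonneg (v m)))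
    linarith
  have hterm : ∀ i, 0 ≤ l i * c' i (D, 0) := fun i => by
    by_cases hi : eq i
    · rw [heq i hi, mul_zero]
    · exact mul_nonneg (hl i hi) (hnn i)
  -- Stationarity writes zero as `φ' D` plus a sum of nonnegative terms, with `φ' D ≥ 0`. All terms
  -- vanish, so `D` is a critical direction.
  have hsum : ∑ i, l i * c' i (D, 0) = 0 :=
    le_antisymm (by linarith [hstat D hDT]) (Finset.sum_nonneg fun i _ => hterm i)
  have hzero := (Finset.sum_eq_zero_iff_of_nonneg fun i _ => hterm i).1 hsum
  have hneg := hsosc D hDT hDne fun i => ⟨hnn i, fun hi => by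
    rcases hi with hi | hi
    · exact heq i hi
    · exact (mul_eq_zero.1 (hzero i (Finset.mem_univ i))).resolve_left hi⟩
  have hQd : Tendsto (fun m => Q (d m) (d m)) G (𝓝 (Q D D)) :=
    ((by fun_prop : Continuous fun w : E => Q w w).tendsto D).comp hDlim
  -- The increase of `Λ` is positive along the ultrafilter; dividing its expansion by `‖v‖²` shows
  -- that the form is nonnegative at `D`, against `hsosc`.
  have hge : ∀ ε > (0 : ℝ), 0 ≤ Q D D / 2 + ε := by
    intro ε hε
    refine ge_of_tendsto ((hQd.div_const 2).add_const ε) ?_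
    filter_upwards [hxw.eventually (hQ ε hε), hGbad, hvne] with m h1 h2 h3
    have h5 := (abs_le.1 h1).2
    have h6 := mul_pos hη (ht m)
    have h7 : Q (d m) (d m) = Q (v m) (v m) / ‖v m‖ ^ 2 := by
      simp only [hd, map_smul, _root_.smul_apply, smul_eq_mul]
      field_simp
    rw [h7]
    have h8 : 0 ≤ Q (v m) (v m) / 2 + ε * ‖v m‖ ^ 2 := by
      simp only [hv]
      linarith
    have h9 : Q (v m) (v m) / ‖v m‖ ^ 2 / 2 + ε
        = (Q (v m) (v m) / 2 + ε * ‖v m‖ ^ 2) / ‖v m‖ ^ 2 := by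
      field_simp
    rw [h9]
    positivity
  have := hge (-Q D D / 4) (by linarith)
  linarith

/-- The value of a nonlinear program along a perturbation: if `ys` is a path of feasible points
that keeps the rows with nonzero multiplier active, at distance `O(t)` from the optimizer `x`, and
`xs` is a path of feasible points that do at least as well as `ys` and converge to `x`, then the
difference quotients of the objective along `xs` converge to the derivative of the Lagrangian in
the parameter. -/
lemma tendsto_value_quotient [FiniteDimensional ℝ E] {S : Set E} (hSc : Convex ℝ S) {x : E}
    (hxmem : x ∈ S) (T : Submodule ℝ E) (hT : ∀ y ∈ S, y - x ∈ T) {u₀ : U} {φ : E → ℝ}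
    {φ' : E →L[ℝ] ℝ} (hφ : HasFDerivWithinAt φ φ' S x) {c : ι → E × U → ℝ}
    {c' : ι → E × U →L[ℝ] ℝ} (hc0 : ∀ i, c i (x, u₀) = 0)
    (hc1 : ∀ i, ContDiffWithinAt ℝ 1 (c i) (S ×ˢ univ) (x, u₀))
    (hc : ∀ i, HasFDerivWithinAt (c i) (c' i) (S ×ˢ univ) (x, u₀)) {l : ι → ℝ} {eq : ι → Prop}
    {Q : E →L[ℝ] E →L[ℝ] ℝ}
    (hQ : ∀ ε > (0 : ℝ), ∀ᶠ y in 𝓝[S] x, |(φ y + ∑ i, l i * c i (y, u₀)) -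
      (φ x + ∑ i, l i * c i (x, u₀)) - Q (y - x) (y - x) / 2| ≤ ε * ‖y - x‖ ^ 2)
    (hl : ∀ i, ¬ eq i → 0 ≤ l i) (hstat : ∀ v ∈ T, φ' v + ∑ i, l i * c' i (v, 0) = 0)
    (hsosc : ∀ d ∈ T, d ≠ 0 → (∀ i, 0 ≤ c' i (d, 0) ∧ (eq i ∨ l i ≠ 0 → c' i (d, 0) = 0)) →
      Q d d < 0)
    {t : ℕ → ℝ} {us : ℕ → U} {h : U} (ht : ∀ m, 0 < t m) (ht0 : Tendsto t atTop (𝓝 0))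
    (hu : Tendsto (fun m => (t m)⁻¹ • (us m - u₀)) atTop (𝓝 h)) {xs ys : ℕ → E}
    (hx : Tendsto xs atTop (𝓝 x)) (hxS : ∀ᶠ m in atTop, xs m ∈ S)
    (hfeas : ∀ᶠ m in atTop, ∀ i, 0 ≤ c i (xs m, us m) ∧ (eq i → c i (xs m, us m) = 0))
    {K : ℝ} (hy : ∀ᶠ m in atTop, ‖ys m - x‖ ≤ K * t m) (hyS : ∀ᶠ m in atTop, ys m ∈ S)
    (hyact : ∀ᶠ m in atTop, ∀ i, c i (ys m, us m) = 0)
    (hxy : ∀ᶠ m in atTop, φ (ys m) ≤ φ (xs m)) :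
    Tendsto (fun m => (t m)⁻¹ * (φ (xs m) - φ x)) atTop (𝓝 (∑ i, l i * c' i (0, h))) := by
  have hytend : Tendsto ys atTop (𝓝 x) := by
    rw [tendsto_iff_norm_sub_tendsto_zero]
    have : Tendsto (fun m => K * t m) atTop (𝓝 0) := by simpa using ht0.const_mul K
    exact squeeze_zero' (Eventually.of_forall fun m => norm_nonneg _) hy this
  set Λ : E → ℝ := fun y => φ y + ∑ i, l i * c i (y, u₀) with hΛ
  have hΛx : Λ x = φ x := by simp [hΛ, hc0]
  have hsumq : ∀ zs : ℕ → E, Tendsto zs atTop (𝓝 x) → (∀ᶠ m in atTop, zs m ∈ S) →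
      Tendsto (fun m => (t m)⁻¹ * ∑ i, l i * (c i (zs m, us m) - c i (zs m, u₀))) atTop
        (𝓝 (∑ i, l i * c' i (0, h))) := by
    intro zs hz hzS
    have := tendsto_finsetSum Finset.univ fun i _ =>
      (tendsto_partial_quotient hSc hxmem (hc1 i) (hc i) ht ht0 hu hz hzS).const_mul (l i)
    refine this.congr fun m => ?_
    rw [Finset.mul_sum]
    exact Finset.sum_congr rfl fun i _ => by ring
  have hqx := hsumq xs hx hxS
  have hqy := hsumq ys hytend hyS
  -- lower bound
  have hΛy : Tendsto (fun m => (t m)⁻¹ * (Λ (ys m) - Λ x)) atTop (𝓝 0) := by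
    have hlim : Tendsto (fun m => (‖Q‖ / 2 + 1) * K ^ 2 * t m) atTop (𝓝 0) := by
      simpa using ht0.const_mul ((‖Q‖ / 2 + 1) * K ^ 2)
    refine squeeze_zero_norm' ?_ hlim
    have hyw : Tendsto ys atTop (𝓝[S] x) := tendsto_nhdsWithin_iff.2 ⟨hytend, hyS⟩
    filter_upwards [hyw.eventually (hQ 1 one_pos), hy] with m h1 h2
    have htm := ht m
    have h3 : |Q (ys m - x) (ys m - x)| ≤ ‖Q‖ * ‖ys m - x‖ * ‖ys m - x‖ :=
      Q.le_opNorm₂ _ _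
    have h4 : |Λ (ys m) - Λ x| ≤ (‖Q‖ / 2 + 1) * ‖ys m - x‖ ^ 2 := by
      have h5 := abs_le.1 h1
      have h6 := abs_le.1 h3
      rw [abs_le]
      constructor <;> simp only [hΛ] <;> nlinarith [h5.1, h5.2, h6.1, h6.2]
    rw [norm_mul, norm_inv, Real.norm_of_nonneg htm.le, Real.norm_eq_abs, inv_mul_le_iff₀ htm]
    have h7 : ‖ys m - x‖ ^ 2 ≤ (K * t m) ^ 2 := by gcongr
    have h8 : 0 ≤ ‖Q‖ / 2 + 1 := by positivity
    nlinarith [mul_le_mul_of_nonneg_left h7 h8]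
  -- As the constraints vanish at `(ys m, us m)`, the objective change at `ys m` is the change of
  -- `Λ`, which is `O(t²)`, plus the weighted change of the constraints in the input.
  have hlowq : Tendsto (fun m => (t m)⁻¹ * (φ (ys m) - φ x)) atTop
      (𝓝 (∑ i, l i * c' i (0, h))) := by
    have := hΛy.add hqy
    rw [zero_add] at this
    refine this.congr' ?_
    filter_upwards [hyact] with m hm
    rw [← mul_add]
    congr 1
    rw [hΛx]
    simp only [hΛ, hm, zero_sub, mul_neg, Finset.sum_neg_distrib]
    ring
  set s := ∑ i, l i * c' i (0, h) with hs
  have hlow : ∀ᶠ m in atTop, -(|s| + 1) * t m ≤ φ (xs m) - φ x := by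
    have h1 : -(|s| + 1) < s := by linarith [neg_abs_le s]
    filter_upwards [hlowq.eventually (lt_mem_nhds h1), hxy] with m hm hm2
    have htm := ht m
    rw [lt_inv_mul_iff₀ htm] at hm
    linarith
  -- The points `xs` do at least as well as `ys`, whose objective moves at rate `s`; this supplies
  -- the lower bound `hlow` required here.
  have hup := fun (η : ℝ) (hη : 0 < η) => lagrangian_increase_le T hT hφ (Λ := Λ) hQ hc0 hc hl
    hstat hsosc ht ht0 hu hx hxS hfeas hlow hη
  rw [Metric.tendsto_nhds]
  intro ε hε
  have e1 := hlowq.eventually (Metric.ball_mem_nhds s hε)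
  have e2 := hqx.eventually (Metric.ball_mem_nhds s (half_pos hε))
  filter_upwards [e1, e2, hup (ε / 2) (half_pos hε), hxy, hfeas] with m h1 h2 h3 h4 h5
  have htm := ht m
  rw [Real.dist_eq, abs_lt] at h1 h2 ⊢
  constructor
  · have := mul_le_mul_of_nonneg_left (sub_le_sub_right h4 (φ x)) (inv_pos.2 htm).le
    linarith [h1.1]
  -- Weak duality: by feasibility at `us m` and the multiplier signs, the Lagrangian at the
  -- perturbed input dominates the objective.
  · have hnn : 0 ≤ ∑ i, l i * c i (xs m, us m) := Finset.sum_nonneg fun i _ => by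
      by_cases hi : eq i
      · rw [(h5 i).2 hi, mul_zero]
      · exact mul_nonneg (hl i hi) (h5 i).1
    have h6 : φ (xs m) - φ x ≤ ε / 2 * t m +
        ∑ i, l i * (c i (xs m, us m) - c i (xs m, u₀)) := by
      rw [hΛx] at h3
      simp only [hΛ] at h3
      simp only [mul_sub, Finset.sum_sub_distrib]
      linarith
    have h7 := mul_le_mul_of_nonneg_left h6 (inv_pos.2 htm).le
    have h8 : (t m)⁻¹ * (ε / 2 * t m) = ε / 2 := by field_simp
    rw [mul_add, h8] at h7
    linarith [h2.2]

end Sensitivity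

namespace Setup

/-! ### The Euclidean inner product on decision vectors -/

section Dot

variable {k : ℕ}

/-- `dot` as a bilinear map. -/
def dotB (k : ℕ) : Dec k →ₗ[ℝ] Dec k →ₗ[ℝ] ℝ :=
  LinearMap.mk₂ ℝ dot
    (fun v w z => by
      simp only [dot, Prod.fst_add, Prod.snd_add, Pi.add_apply, add_mul, Finset.sum_add_distrib]
      ring)
    (fun a v w => by
      simp only [dot, Prod.smul_fst, Prod.smul_snd, Pi.smul_apply, smul_eq_mul, mul_assoc,
        ← Finset.mul_sum, mul_add])
    (fun v w z => by
      simp only [dot, Prod.fst_add, Prod.snd_add, Pi.add_apply, mul_add, Finset.sum_add_distrib]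
      ring)
    (fun a v w => by
      simp only [dot, Prod.smul_fst, Prod.smul_snd, Pi.smul_apply, smul_eq_mul, mul_left_comm,
        ← Finset.mul_sum, mul_add])

lemma dotB_apply (v w : Dec k) : dotB k v w = dot v w := rfl

/-- `dot v` as a continuous linear map. -/
def dotL (v : Dec k) : Dec k →L[ℝ] ℝ := (dotB k v).toContinuousLinearMap

@[simp] lemma dotL_apply (v w : Dec k) : dotL v w = dot v w := rfl

lemma dot_comm (v w : Dec k) : dot v w = dot w v := by simp only [dot, mul_comm]

lemma dot_self_nonneg (v : Dec k) : 0 ≤ dot v v :=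
  add_nonneg (Finset.sum_nonneg fun _ _ => mul_self_nonneg _)
    (Finset.sum_nonneg fun _ _ => mul_self_nonneg _)

/-- The ambient norm of `Dec k` is a supremum norm, while LICQ and SOSC are Euclidean; this passes
from one to the other. -/
lemma norm_sq_le_dot_self (v : Dec k) : ‖v‖ ^ 2 ≤ dot v v := by
  have h1 : ∀ w : Fin k → ℝ, ‖w‖ ≤ Real.sqrt (∑ j, w j * w j) := fun w => by
    refine (pi_norm_le_iff_of_nonneg (Real.sqrt_nonneg _)).2 fun j => ?_
    rw [Real.norm_eq_abs, ← Real.sqrt_sq_eq_abs, sq]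
    exact Real.sqrt_le_sqrt
      (Finset.single_le_sum (f := fun j => w j * w j) (fun i _ => mul_self_nonneg _)
        (Finset.mem_univ j))
  have h2 : ‖v‖ ≤ Real.sqrt (dot v v) := by
    refine max_le ((h1 v.1).trans (Real.sqrt_le_sqrt ?_)) ((h1 v.2).trans (Real.sqrt_le_sqrt ?_))
    · exact le_add_of_nonneg_right (Finset.sum_nonneg fun _ _ => mul_self_nonneg _)
    · exact le_add_of_nonneg_left (Finset.sum_nonneg fun _ _ => mul_self_nonneg _)
  calc ‖v‖ ^ 2 ≤ Real.sqrt (dot v v) ^ 2 := by gcongr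
    _ = dot v v := Real.sq_sqrt (dot_self_nonneg v)

lemma eq_zero_of_dot_self {v : Dec k} (h : dot v v = 0) : v = 0 := by
  have := norm_sq_le_dot_self v
  rw [h] at this
  exact norm_eq_zero.1 (pow_eq_zero_iff two_ne_zero |>.1 (le_antisymm this (sq_nonneg _)))

lemma dot_sum_smul_left {ι : Type*} (s : Finset ι) (w : ι → ℝ) (g : ι → Dec k) (v : Dec k) :
    dot (∑ i ∈ s, w i • g i) v = ∑ i ∈ s, w i * dot (g i) v := by
  rw [← dotB_apply, map_sum, LinearMap.sum_apply]
  exact Finset.sum_congr rfl fun i _ => by rw [map_smul, LinearMap.smul_apply, dotB_apply, smul_eq_mul]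

lemma dot_sum_smul_right {ι : Type*} (s : Finset ι) (w : ι → ℝ) (g : ι → Dec k) (v : Dec k) :
    dot v (∑ i ∈ s, w i • g i) = ∑ i ∈ s, w i * dot v (g i) := by
  rw [dot_comm, dot_sum_smul_left]
  simp only [dot_comm v]

lemma dot_add_left (u v w : Dec k) : dot (u + v) w = dot u w + dot v w := by
  simp only [← dotB_apply, map_add, LinearMap.add_apply]

lemma dot_add_right (u v w : Dec k) : dot u (v + w) = dot u v + dot u w := by
  simp only [← dotB_apply, map_add]

lemma dot_smul_left (a : ℝ) (v w : Dec k) : dot (a • v) w = a * dot v w := by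
  simp only [← dotB_apply, map_smul, LinearMap.smul_apply, smul_eq_mul]

lemma dot_smul_right (a : ℝ) (v w : Dec k) : dot v (a • w) = a * dot v w := by
  simp only [← dotB_apply, map_smul, smul_eq_mul]

lemma dot_one (v : Dec k) : dot ((fun _ => 1, 0) : Dec k) v = ∑ j, v.1 j := by
  simp [dot]

/-- Linearly independent vectors have a dual family. -/
lemma exists_dual_family {o : Type*} [Fintype o] [DecidableEq o] {g : o → Dec k}
    (hg : LinearIndependent ℝ g) :
    ∃ b : o → Dec k, ∀ i a, dot (g i) (b a) = if i = a then 1 else 0 := by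
  set A : Dec k →ₗ[ℝ] (o → ℝ) := LinearMap.pi fun i => dotB k (g i) with hA
  -- A functional `f` killing the range of `A` yields the combination `G` of the `g i` with
  -- coefficients `f (Pi.single i 1)`. Then `dot G G = f (A G) = 0`, so `G = 0`, and independence
  -- forces `f = 0`.
  have hsurj : LinearMap.range A = ⊤ := by
    by_contra hne
    obtain ⟨f, hf, hle⟩ := Submodule.exists_le_ker_of_lt_top _ (lt_top_iff_ne_top.2 hne)
    apply hf
    have hfb : ∀ b : o → ℝ, f b = ∑ i, b i * f (Pi.single i 1) := fun b => by
      rw [LinearMap.pi_apply_eq_sum_univ f b]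
      refine Finset.sum_congr rfl fun i _ => ?_
      rw [smul_eq_mul]
      congr 2
      ext j
      simp [Pi.single_apply, eq_comm]
    set G : Dec k := ∑ i, f (Pi.single i 1) • g i with hG
    have h0 : f (A G) = 0 := hle (LinearMap.mem_range_self A G)
    have h1 : dot G G = 0 := by
      conv_lhs => rw [hG, dot_sum_smul_left]
      rw [← h0, hfb]
      exact Finset.sum_congr rfl fun i _ => mul_comm _ _
    have h2 := Fintype.linearIndependent_iff.1 hg (fun i => f (Pi.single i 1))
      (eq_zero_of_dot_self h1)
    ext b
    simpa using h2 b
  refine ⟨fun a => (LinearMap.range_eq_top.1 hsurj (Pi.single a 1)).choose, fun i a => ?_⟩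
  have := (LinearMap.range_eq_top.1 hsurj (Pi.single a 1)).choose_spec
  have := congrFun this i
  rw [Pi.single_apply] at this
  exact this

end Dot

/-! ### Constraints of the program -/

variable {P : Setup} {n k : ℕ} {lo hi : Fin k → ℝ} {x : Dec k}

/-- Directions that preserve the total weight. -/
def balanced (k : ℕ) : Submodule ℝ (Dec k) := LinearMap.ker (dotB k (fun _ => 1, 0))

lemma mem_balanced {v : Dec k} : v ∈ balanced k ↔ ∑ j, v.1 j = 0 := by
  rw [balanced, LinearMap.mem_ker, dotB_apply, dot_one]

/-- Constraints other than the rows. -/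
def Con.NotRow (i : P.Con n k) : Prop := ∀ r, i ≠ .row r

/-- Apart from the rows, the constraints are affine, so their first-order expansions are exact. -/
lemma con_add {i : P.Con n k} (hi' : i.NotRow) (u : P.U n) (v : Dec k) :
    P.con lo hi (x + v) u i = P.con lo hi x u i + dot (P.grad lo hi x u i) v := by
  cases i with
  | row r => exact absurd rfl (hi' r)
  | weight j => simp [con, grad, dot, Pi.single_apply]
  | lower j => simp [con, grad, dot, Pi.single_apply]; ring
  | upper j => simp [con, grad, dot, Pi.single_apply]; ring
  | order a =>
    simp only [con, grad, dot, Prod.snd_add, Pi.add_apply, Pi.zero_apply, zero_mul,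
      Finset.sum_const_zero, Pi.sub_apply, sub_mul, Finset.sum_sub_distrib, Pi.single_apply,
      ite_mul, one_mul, Finset.sum_ite_eq', Finset.mem_univ, if_true]
    simp
    ring

lemma con_eq_of_notRow {i : P.Con n k} (hi' : i.NotRow) (u u' : P.U n) :
    P.con lo hi x u i = P.con lo hi x u' i := by
  cases i with
  | row r => exact absurd rfl (hi' r)
  | _ => rfl

lemma monotone_of_consec {z : Fin k → ℝ} (h : ∀ a : Consec k, z a.1.1 ≤ z a.1.2) : Monotone z := by
  cases k with
  | zero => exact fun i => i.elim0
  | succ m =>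
    refine Fin.monotone_iff_le_succ.2 fun i => ?_
    exact h ⟨(i.castSucc, i.succ), by simp⟩

lemma mem_cellDec_iff (hcell : ∀ j, P.yLo ≤ lo j ∧ lo j < hi j ∧ hi j ≤ P.yHi) (u : P.U n)
    {y : Dec k} : y ∈ P.cellDec lo hi ↔
      ∑ j, y.1 j = 1 ∧ ∀ i : P.Con n k, i.NotRow → 0 ≤ P.con lo hi y u i := by
  constructor
  · rintro ⟨⟨h1, h2, -, h4⟩, h5⟩
    refine ⟨h2, fun i hi' => ?_⟩
    cases i with
    | row r => exact absurd rfl (hi' r)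
    | weight j => exact h1 j
    | lower j => exact sub_nonneg.2 (h5 j).1
    | upper j => exact sub_nonneg.2 (h5 j).2
    | order a => exact sub_nonneg.2 (h4 (Fin.le_def.2 (by have := a.2; omega)))
  · rintro ⟨h1, h2⟩
    have hc : ∀ j, y.2 j ∈ Icc (lo j) (hi j) := fun j =>
      ⟨sub_nonneg.1 (h2 (.lower j) (fun r h => by cases h)),
        sub_nonneg.1 (h2 (.upper j) (fun r h => by cases h))⟩
    refine ⟨⟨fun j => h2 (.weight j) (fun r h => by cases h), h1,
      fun j => ⟨(hcell j).1.trans (hc j).1, (hc j).2.trans (hcell j).2.2⟩, ?_⟩, hc⟩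
    exact monotone_of_consec fun a => sub_nonneg.1 (h2 (.order a) (fun r h => by cases h))

lemma convex_cellDec (lo hi : Fin k → ℝ) : Convex ℝ (P.cellDec lo hi) := by
  rintro y ⟨⟨h1, h2, h3, h4⟩, h5⟩ z ⟨⟨g1, g2, g3, g4⟩, g5⟩ a b ha hb hab
  refine ⟨⟨fun j => ?_, ?_, fun j => ?_, ?_⟩, fun j => ?_⟩
  · exact add_nonneg (mul_nonneg ha (h1 j)) (mul_nonneg hb (g1 j))
  · simp only [Prod.fst_add, Prod.smul_fst, Pi.add_apply, Pi.smul_apply, smul_eq_mul,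
      Finset.sum_add_distrib, ← Finset.mul_sum, h2, g2, mul_one, hab]
  · exact convex_Icc _ _ (h3 j) (g3 j) ha hb hab
  · exact (h4.const_mul ha).add (g4.const_mul hb)
  · exact convex_Icc _ _ (h5 j) (g5 j) ha hb hab

lemma sub_mem_balanced {y : Dec k} (hx : x ∈ P.cellDec lo hi) (hy : y ∈ P.cellDec lo hi) :
    y - x ∈ balanced k := by
  rw [mem_balanced]
  simp [Finset.sum_sub_distrib, hy.1.2.1, hx.1.2.1]

/-- Small balanced moves that respect the active constraints stay in the cell. -/
lemma eventually_add_mem_cellDec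
    (hcell : ∀ j, P.yLo ≤ lo j ∧ lo j < hi j ∧ hi j ≤ P.yHi) (u : P.U n)
    (hx : x ∈ P.cellDec lo hi) {α : Type*} {F : Filter α} {ψ : α → Dec k}
    (hψ : Tendsto ψ F (𝓝 0)) (h0 : ∀ᶠ a in F, ψ a ∈ balanced k)
    (hact : ∀ᶠ a in F, ∀ i : P.Con n k, i.NotRow → P.con lo hi x u i = 0 →
      0 ≤ dot (P.grad lo hi x u i) (ψ a)) :
    ∀ᶠ a in F, x + ψ a ∈ P.cellDec lo hi := by
  have hxc := (mem_cellDec_iff hcell u).1 hx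
  -- Inactive constraints have positive slack, which survives small moves; there are finitely many
  -- of them.
  have hinact : ∀ᶠ a in F, ∀ i : P.Con n k, i.NotRow → P.con lo hi x u i ≠ 0 →
      0 ≤ P.con lo hi x u i + dot (P.grad lo hi x u i) (ψ a) := by
    refine eventually_all.2 fun i => ?_
    by_cases hi' : i.NotRow ∧ P.con lo hi x u i ≠ 0
    · have hpos : 0 < P.con lo hi x u i := lt_of_le_of_ne (hxc.2 i hi'.1) (Ne.symm hi'.2)
      have ht : Tendsto (fun a => P.con lo hi x u i + dotL (P.grad lo hi x u i) (ψ a)) F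
          (𝓝 (P.con lo hi x u i + dotL (P.grad lo hi x u i) 0)) :=
        (((dotL (P.grad lo hi x u i)).continuous.tendsto 0).comp hψ).const_add _
      rw [map_zero, add_zero] at ht
      filter_upwards [ht.eventually (lt_mem_nhds hpos)] with a ha _ _
      exact ha.le
    · exact Eventually.of_forall fun a h1 h2 => absurd ⟨h1, h2⟩ hi'
  filter_upwards [h0, hact, hinact] with a h1 h2 h3
  refine (mem_cellDec_iff hcell u).2 ⟨?_, fun i hi' => ?_⟩
  · simp only [Prod.fst_add, Pi.add_apply, Finset.sum_add_distrib, hxc.1, mem_balanced.1 h1,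
      add_zero]
  · rw [con_add hi']
    by_cases hz : P.con lo hi x u i = 0
    · rw [hz, zero_add]
      exact h2 i hi' hz
    · exact h3 i hi' hz

lemma integral_atomic {a b : ℝ} (hx : x ∈ simplexOrd a b k) (g : ℝ → ℝ) :
    ∫ y, g (y : ℝ) ∂(atomic x hx : Measure (Icc a b)) = ∑ j, x.1 j * g (x.2 j) :=
  integral_sum_ofReal_dirac hx.1 (fun j => (⟨x.2 j, hx.2.2.1 j⟩ : Icc a b)) fun y => g (y : ℝ)

/-- Integrals against atomic measures are finite sums, so feasibility reads off the row constraints.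
The cells do not enter the rows, hence `lo` and `hi` are free here. -/
lemma mem_feas_iff {u : P.U n} {y : Dec k} : y ∈ P.feas n k u ↔ y ∈ P.admDec k ∧
    (∀ i, P.con lo hi y u (.row (.inl i)) = 0) ∧ ∀ i, 0 ≤ P.con lo hi y u (.row (.inr i)) := by
  constructor
  · rintro ⟨hy, ha, h1, h2⟩
    refine ⟨⟨hy, ha⟩, fun i => ?_, fun i => ?_⟩
    · have := h1 i
      rw [integral_atomic hy (fun y => P.f n (.inl i) y u.2)] at this
      simp [con, this]
    · have := h2 i
      rw [integral_atomic hy (fun y => P.f n (.inr i) y u.2)] at this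
      simpa [con] using this
  · rintro ⟨⟨hy, ha⟩, h1, h2⟩
    refine ⟨hy, ha, fun i => ?_, fun i => ?_⟩
    · rw [integral_atomic hy (fun y => P.f n (.inl i) y u.2)]
      exact (sub_eq_zero.1 (h1 i)).symm
    · rw [integral_atomic hy (fun y => P.f n (.inr i) y u.2)]
      exact sub_nonneg.1 (h2 i)

/-! ### Consequences of the constraint qualification -/

/-- A vanishing combination makes the right side of LICQ zero, which forces all coefficients to
vanish; coefficients are extended by zero to inactive constraints. -/
lemma LICQ.linearIndependent {σ : ℝ} (hσ : 0 < σ) {u : P.U n} (h : P.LICQ σ u lo hi x) :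
    LinearIndependent ℝ (fun o : Option {i : P.Con n k // P.con lo hi x u i = 0} =>
      o.elim ((fun _ => 1, 0) : Dec k) fun i => P.grad lo hi x u i.1) := by
  classical
  rw [Fintype.linearIndependent_iff]
  intro w hw
  set W : P.Con n k → ℝ := fun i => if hi' : P.con lo hi x u i = 0 then w (some ⟨i, hi'⟩) else 0
    with hW
  have hWi : ∀ i (hi' : P.con lo hi x u i = 0), W i = w (some ⟨i, hi'⟩) := fun i hi' => dif_pos hi'
  have hsum : ∑ i, W i • P.grad lo hi x u i =
      ∑ i : {i : P.Con n k // P.con lo hi x u i = 0}, w (some i) • P.grad lo hi x u i.1 := by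
    refine (Fintype.sum_of_injective Subtype.val Subtype.val_injective _ _ (fun i hi' => ?_)
      fun i => ?_).symm
    · have : W i = 0 := dif_neg fun h => hi' ⟨⟨i, h⟩, rfl⟩
      rw [this, zero_smul]
    · rw [hWi i.1 i.2]
  have key := h (w none) W fun i hi' => by
    by_contra hne
    exact hi' (dif_neg hne)
  rw [Fintype.sum_option] at hw
  simp only [Option.elim] at hw
  rw [hsum, hw] at key
  have h0 : dot (0 : Dec k) 0 = 0 := by simp [dot]
  rw [h0] at key
  have hnn : 0 ≤ ∑ i, W i ^ 2 := Finset.sum_nonneg fun i _ => sq_nonneg _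
  have hsq := sq_nonneg (w none)
  have hσ2 : 0 < σ ^ 2 := by positivity
  have hle : w none ^ 2 + ∑ i, W i ^ 2 ≤ 0 := by
    by_contra hcon
    exact absurd key (not_le.2 (mul_pos hσ2 (not_le.1 hcon)))
  rintro (_ | i)
  · exact pow_eq_zero_iff two_ne_zero |>.1 (le_antisymm (by linarith) hsq)
  · have hz : ∑ i, W i ^ 2 = 0 := le_antisymm (by linarith) hnn
    have := (Finset.sum_eq_zero_iff_of_nonneg fun i _ => sq_nonneg (W i)).1 hz i.1
      (Finset.mem_univ _)
    rw [hWi i.1 i.2] at this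
    exact pow_eq_zero_iff two_ne_zero |>.1 this

open Classical in
/-- A family of balanced directions dual to the gradients of the active constraints. -/
lemma LICQ.exists_dual {σ : ℝ} (hσ : 0 < σ) {u : P.U n} (h : P.LICQ σ u lo hi x) :
    ∃ b : P.Con n k → Dec k, ∀ a, P.con lo hi x u a = 0 → b a ∈ balanced k ∧
      ∀ i, P.con lo hi x u i = 0 → dot (P.grad lo hi x u i) (b a) = if i = a then 1 else 0 := by
  obtain ⟨b, hb⟩ := exists_dual_family (h.linearIndependent hσ)
  refine ⟨fun a => if ha : P.con lo hi x u a = 0 then b (some ⟨a, ha⟩) else 0,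
    fun a ha => ⟨?_, fun i hi' => ?_⟩⟩
  · have := hb none (some ⟨a, ha⟩)
    simp only [Option.elim, reduceCtorEq, if_false, dot_one] at this
    rw [mem_balanced]
    simpa only [dif_pos ha] using this
  · have := hb (some ⟨i, hi'⟩) (some ⟨a, ha⟩)
    simp only [Option.elim, Option.some.injEq, Subtype.mk.injEq] at this
    simpa only [dif_pos ha] using this

open Classical in
-- Independent vectors in `ℝ^{2k}` number at most `2k`. The bound does not involve the number of
-- rows, so it is uniform in `n`.
lemma LICQ.card_le {σ : ℝ} (hσ : 0 < σ) {u : P.U n} (h : P.LICQ σ u lo hi x) :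
    Fintype.card {i : P.Con n k // P.con lo hi x u i = 0} ≤ 2 * k := by
  have h1 := (h.linearIndependent hσ).fintype_card_le_finrank
  rw [Fintype.card_option] at h1
  have h2 : Module.finrank ℝ (Dec k) = 2 * k := by
    rw [Module.finrank_prod]
    simp
    ring
  have h3 := h1.trans h2.le
  omega

end Setup

/-- The derivative of a function of `(y, θ)` that is `C¹` within `[a, b] × univ`, in terms of the
partial derivatives. -/
lemma hasFDerivWithinAt_of_partial {Θ : Type*} [NormedAddCommGroup Θ] [NormedSpace ℝ Θ]
    {f : ℝ → Θ → ℝ} {a b z : ℝ} {θ₀ : Θ} (hab : a < b) (hz : z ∈ Icc a b)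
    (h : ContDiffWithinAt ℝ 1 (fun w : ℝ × Θ => f w.1 w.2) (Icc a b ×ˢ univ) (z, θ₀)) :
    HasFDerivWithinAt (fun w : ℝ × Θ => f w.1 w.2)
      (derivWithin (fun y => f y θ₀) (Icc a b) z • ContinuousLinearMap.fst ℝ ℝ Θ +
        (fderiv ℝ (fun θ => f z θ) θ₀).comp (ContinuousLinearMap.snd ℝ ℝ Θ))
      (Icc a b ×ˢ univ) (z, θ₀) := by
  have hd := (h.differentiableWithinAt one_ne_zero).hasFDerivWithinAt
  set F' := fderivWithin ℝ (fun w : ℝ × Θ => f w.1 w.2) (Icc a b ×ˢ univ) (z, θ₀)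
  -- The partial derivatives come from restricting the joint derivative to the two slices: an
  -- interval of positive length in `y`, where the derivative within is unique, and a full
  -- neighbourhood in `θ`.
  have h1 : derivWithin (fun y => f y θ₀) (Icc a b) z = F' (1, 0) := by
    have hl : HasDerivWithinAt (fun y : ℝ => (y, θ₀)) ((1 : ℝ), (0 : Θ)) (Icc a b) z :=
      (hasDerivWithinAt_id z _).prodMk (hasDerivWithinAt_const z _ θ₀)
    exact (hd.comp_hasDerivWithinAt (f := fun y : ℝ => (y, θ₀)) z hl
      (fun y hy => ⟨hy, mem_univ _⟩)).derivWithin (uniqueDiffOn_Icc hab z hz)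
  have h2 : fderiv ℝ (fun θ => f z θ) θ₀ = F'.comp (ContinuousLinearMap.inr ℝ ℝ Θ) := by
    exact (hd.comp_hasFDerivAt (f := fun θ : Θ => (z, θ)) θ₀ (hasFDerivAt_prodMk_right z θ₀)
      (Eventually.of_forall fun θ => ⟨hz, mem_univ _⟩)).fderiv
  refine hd.congr_fderiv (ContinuousLinearMap.ext fun w => ?_)
  have h3 : w = w.1 • ((1 : ℝ), (0 : Θ)) + (0, w.2) := by simp
  conv_lhs => rw [h3, map_add, map_smul]
  rw [h1, h2]
  simp [mul_comm]

/-! ### Derivatives of the constraints and a feasible path through the optimizer -/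

namespace Setup

variable {P : Setup} {n k : ℕ} {lo hi : Fin k → ℝ} {x : Dec k}

lemma Con.exists_of_not_notRow {i : P.Con n k} (h : ¬ i.NotRow) : ∃ m, i = .row m := by
  simp only [Con.NotRow, ne_eq, not_forall, not_not] at h
  exact h

/-- The derivative of a row `c_i - ∑_j p_j f_i(z_j; θ)` in the input `(c, θ)`. -/
def inputDeriv (P : Setup) {n k : ℕ} (x : Dec k) (u : P.U n) (i : P.Row n) : P.U n →L[ℝ] ℝ :=
  (ContinuousLinearMap.proj (R := ℝ) (φ := fun _ : P.Row n => ℝ) i).comp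
      (ContinuousLinearMap.fst ℝ (P.Row n → ℝ) (P.Θ n)) -
    ∑ j, x.1 j • (fderiv ℝ (fun θ => P.f n i (x.2 j) θ) u.2).comp
      (ContinuousLinearMap.snd ℝ (P.Row n → ℝ) (P.Θ n))

lemma inputDeriv_apply (u : P.U n) (i : P.Row n) (h : P.U n) : P.inputDeriv x u i h =
    h.1 i - ∑ j, fderiv ℝ (fun θ => P.f n i (x.2 j) θ) u.2 h.2 * x.1 j := by
  simp [inputDeriv, mul_comm]

/-- The derivative in the input of any constraint. -/
def conInputDeriv (P : Setup) {n k : ℕ} (x : Dec k) (u : P.U n) : P.Con n k → P.U n →L[ℝ] ℝ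
  | .row i => P.inputDeriv x u i
  | _ => 0

/-- The joint derivative of a constraint in the decision vector and the input. -/
def conDeriv (P : Setup) {n k : ℕ} (lo hi : Fin k → ℝ) (x : Dec k) (u : P.U n) (i : P.Con n k) :
    Dec k × P.U n →L[ℝ] ℝ :=
  (dotL (P.grad lo hi x u i)).comp (ContinuousLinearMap.fst ℝ _ _) +
    (P.conInputDeriv x u i).comp (ContinuousLinearMap.snd ℝ _ _)

lemma conDeriv_apply (u : P.U n) (i : P.Con n k) (v : Dec k) (h : P.U n) :
    P.conDeriv lo hi x u i (v, h) = dot (P.grad lo hi x u i) v + P.conInputDeriv x u i h := rfl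

section Regular

variable {s : Goal} {π : unitInterval} {q : P.PM} {r ε σ κ B : ℝ} {l : P.Con n k → ℝ}

lemma RegularAt.mem_cellDec (h : P.RegularAt s n k π q r ε σ κ B lo hi x l) :
    x ∈ P.cellDec lo hi := h.kkt.2.1

lemma RegularAt.mult_eq_zero (h : P.RegularAt s n k π q r ε σ κ B lo hi x l) {i : P.Con n k}
    (hi' : P.con lo hi x (P.u₀ n) i ≠ 0) : l i = 0 :=
  (mul_eq_zero.1 (h.kkt.2.2.2.1 i)).resolve_right hi'

/-- An active box, weight or order constraint has zero constant term, so it equals its derivative at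
the displacement. A row is handled by the chain rule, since its support points remain in the cells
where the integrand is `C¹`. -/
lemma RegularAt.con_differentiable (h : P.RegularAt s n k π q r ε σ κ B lo hi x l)
    {i : P.Con n k} (hi' : P.con lo hi x (P.u₀ n) i = 0) :
    ContDiffWithinAt ℝ 1 (fun a : Dec k × P.U n => P.con lo hi a.1 a.2 i)
      (P.cellDec lo hi ×ˢ univ) (x, P.u₀ n) ∧
    HasFDerivWithinAt (fun a : Dec k × P.U n => P.con lo hi a.1 a.2 i)
      (P.conDeriv lo hi x (P.u₀ n) i) (P.cellDec lo hi ×ˢ univ) (x, P.u₀ n) := by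
  have hx := h.mem_cellDec
  by_cases hrow : i.NotRow
  · have haff : (fun a : Dec k × P.U n => P.con lo hi a.1 a.2 i) =
        fun a => P.conDeriv lo hi x (P.u₀ n) i (a - (x, P.u₀ n)) := by
      funext a
      have h1 : a.1 = x + (a.1 - x) := by abel
      conv_lhs => rw [h1]
      rw [con_add hrow, con_eq_of_notRow hrow a.2 (P.u₀ n), hi', zero_add]
      cases i with
      | row r => exact absurd rfl (hrow r)
      | _ => simp [conDeriv, conInputDeriv, grad]
    rw [haff]
    refine ⟨ContDiff.contDiffWithinAt (by fun_prop), ?_⟩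
    exact ((P.conDeriv lo hi x (P.u₀ n) i).hasFDerivAt.comp (x, P.u₀ n)
      ((hasFDerivAt_id (x, P.u₀ n)).sub_const (x, P.u₀ n))).hasFDerivWithinAt
  · obtain ⟨m, rfl⟩ := Con.exists_of_not_notRow hrow
    have hmaps : ∀ j, MapsTo (fun a : Dec k × P.U n => (a.1.2 j, a.2.2)) (P.cellDec lo hi ×ˢ univ)
        (Icc (lo j) (hi j) ×ˢ univ) := fun j a ha => ⟨ha.1.2 j, mem_univ _⟩
    have hfun : (fun a : Dec k × P.U n => P.con lo hi a.1 a.2 (.row m)) =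
        fun a => a.2.1 m - ∑ j, a.1.1 j * P.f n m (a.1.2 j) a.2.2 := rfl
    rw [hfun]
    constructor
    · have hf : ∀ j, ContDiffWithinAt ℝ 1 (fun a : Dec k × P.U n => P.f n m (a.1.2 j) a.2.2)
          (P.cellDec lo hi ×ˢ univ) (x, P.u₀ n) := fun j =>
        ContDiffWithinAt.comp (t := Icc (lo j) (hi j) ×ˢ univ)
          (g := fun b : ℝ × P.Θ n => P.f n m b.1 b.2)
          (f := fun a : Dec k × P.U n => (a.1.2 j, a.2.2)) (x, P.u₀ n)
          (h.smooth_active m hi' j).2 (ContDiff.contDiffWithinAt (by fun_prop)) (hmaps j)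
      refine ContDiffWithinAt.sub (ContDiff.contDiffWithinAt (by fun_prop)) ?_
      exact ContDiffWithinAt.sum fun j _ =>
        ContDiffWithinAt.mul (ContDiff.contDiffWithinAt (by fun_prop)) (hf j)
    · have hp2 : ∀ j, HasFDerivAt (fun a : Dec k × P.U n => (a.1.2 j, a.2.2))
          (((ContinuousLinearMap.proj (R := ℝ) (φ := fun _ : Fin k => ℝ) j).comp
            ((ContinuousLinearMap.snd ℝ _ _).comp (ContinuousLinearMap.fst ℝ (Dec k) (P.U n)))).prod
            ((ContinuousLinearMap.snd ℝ _ _).comp (ContinuousLinearMap.snd ℝ (Dec k) (P.U n))))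
          (x, P.u₀ n) := fun j => ContinuousLinearMap.hasFDerivAt
            (((ContinuousLinearMap.proj (R := ℝ) (φ := fun _ : Fin k => ℝ) j).comp
            ((ContinuousLinearMap.snd ℝ _ _).comp (ContinuousLinearMap.fst ℝ (Dec k) (P.U n)))).prod
            ((ContinuousLinearMap.snd ℝ _ _).comp (ContinuousLinearMap.snd ℝ (Dec k) (P.U n))))
      have hp1 : ∀ j, HasFDerivAt (fun a : Dec k × P.U n => a.1.1 j)
          ((ContinuousLinearMap.proj (R := ℝ) (φ := fun _ : Fin k => ℝ) j).comp
            ((ContinuousLinearMap.fst ℝ _ _).comp (ContinuousLinearMap.fst ℝ (Dec k) (P.U n))))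
          (x, P.u₀ n) := fun j => ContinuousLinearMap.hasFDerivAt
            ((ContinuousLinearMap.proj (R := ℝ) (φ := fun _ : Fin k => ℝ) j).comp
            ((ContinuousLinearMap.fst ℝ _ _).comp (ContinuousLinearMap.fst ℝ (Dec k) (P.U n))))
      have hc : HasFDerivAt (fun a : Dec k × P.U n => a.2.1 m)
          ((ContinuousLinearMap.proj (R := ℝ) (φ := fun _ : P.Row n => ℝ) m).comp
            ((ContinuousLinearMap.fst ℝ _ _).comp (ContinuousLinearMap.snd ℝ (Dec k) (P.U n))))
          (x, P.u₀ n) := ContinuousLinearMap.hasFDerivAt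
            ((ContinuousLinearMap.proj (R := ℝ) (φ := fun _ : P.Row n => ℝ) m).comp
            ((ContinuousLinearMap.fst ℝ _ _).comp (ContinuousLinearMap.snd ℝ (Dec k) (P.U n))))
      have hf := fun j => HasFDerivWithinAt.comp (f := fun a : Dec k × P.U n => (a.1.2 j, a.2.2))
        (x, P.u₀ n)
        (hasFDerivWithinAt_of_partial (f := P.f n m) (h.cells j).2.1 (hx.2 j)
          (h.smooth_active m hi' j).2) (hp2 j).hasFDerivWithinAt (hmaps j)
      have hall := hc.hasFDerivWithinAt.sub (HasFDerivWithinAt.fun_sum (u := Finset.univ)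
        fun j _ => (hp1 j).hasFDerivWithinAt.mul (hf j))
      refine hall.congr_fderiv ?_
      refine ContinuousLinearMap.ext fun a => ?_
      rw [conDeriv_apply, conInputDeriv, inputDeriv_apply]
      simp only [grad, dot, u₀, _root_.sub_apply, ContinuousLinearMap.coe_comp,
        Function.comp_apply, ContinuousLinearMap.coe_fst', ContinuousLinearMap.coe_snd',
        ContinuousLinearMap.proj_apply, _root_.sum_apply, _root_.add_apply,
        _root_.smul_apply, smul_eq_mul, ContinuousLinearMap.prod_apply, neg_mul,
        Finset.sum_neg_distrib, Finset.sum_add_distrib, mul_add]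
      simp only [mul_comm, mul_left_comm]
      ring

/-- Lagrangian terms are twice continuously differentiable within the cell. -/
lemma RegularAt.contDiff_lagrangian (h : P.RegularAt s n k π q r ε σ κ B lo hi x l) :
    ContDiffWithinAt ℝ 2 (P.lagrangian (P.u₀ n) π q lo hi l) (P.cellDec lo hi) x := by
  refine ContDiffWithinAt.add h.smooth_objective (ContDiffWithinAt.sum fun i _ => ?_)
  by_cases hi' : P.con lo hi x (P.u₀ n) i = 0
  · refine contDiffWithinAt_const.mul ?_
    cases i with
    | row m =>
      have hf : ∀ j, ContDiffWithinAt ℝ 2 (fun y : Dec k => P.f n m (y.2 j) (P.θ₀ n))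
          (P.cellDec lo hi) x := fun j =>
        ContDiffWithinAt.comp (t := Icc (lo j) (hi j))
          (g := fun b : ℝ => P.f n m b (P.θ₀ n))
          (f := fun y : Dec k => y.2 j) x (h.smooth_active m hi' j).1
          (ContDiff.contDiffWithinAt (by fun_prop)) (fun y hy => hy.2 j)
      refine ContDiffWithinAt.sub contDiffWithinAt_const ?_
      exact ContDiffWithinAt.sum fun j _ =>
        ContDiffWithinAt.mul (ContDiff.contDiffWithinAt (by fun_prop)) (hf j)
    | _ =>
      simp only [con]
      exact ContDiff.contDiffWithinAt (by fun_prop)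
  · simp only [h.mult_eq_zero hi', zero_mul]
    exact contDiffWithinAt_const

/-- By complementarity inactive constraints contribute zero, so differentiability is needed only of
the active ones. -/
lemma RegularAt.hasFDeriv_lagrangian (h : P.RegularAt s n k π q r ε σ κ B lo hi x l)
    {Φ' : Dec k →L[ℝ] ℝ} (hΦ : HasFDerivWithinAt (P.Φ k π q) Φ' (P.cellDec lo hi) x) :
    HasFDerivWithinAt (P.lagrangian (P.u₀ n) π q lo hi l)
      (Φ' + ∑ i, l i • dotL (P.grad lo hi x (P.u₀ n) i)) (P.cellDec lo hi) x := by
  refine hΦ.add (HasFDerivWithinAt.fun_sum fun i _ => ?_)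
  by_cases hi' : P.con lo hi x (P.u₀ n) i = 0
  · have h1 := (h.con_differentiable hi').2
    have h2 : HasFDerivWithinAt (fun y : Dec k => (y, P.u₀ n))
        (ContinuousLinearMap.inl ℝ (Dec k) (P.U n)) (P.cellDec lo hi) x :=
      (hasFDerivAt_prodMk_left x (P.u₀ n)).hasFDerivWithinAt
    have h3 := (h1.comp (f := fun y : Dec k => (y, P.u₀ n)) x h2
      (fun y hy => ⟨hy, mem_univ _⟩)).const_mul (l i)
    refine h3.congr_fderiv ?_
    refine ContinuousLinearMap.ext fun v => ?_
    simp [conDeriv_apply]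
  · simp only [h.mult_eq_zero hi', zero_mul, zero_smul]
    exact hasFDerivWithinAt_const _ _ _

/-- A path of feasible points that keeps all active constraints active and moves at most
proportionally to the input. -/
lemma RegularAt.exists_path (h : P.RegularAt s n k π q r ε σ κ B lo hi x l) (hσ : 0 < σ) :
    ∃ (Y : P.U n → Dec k) (K : ℝ), ∀ᶠ u in 𝓝 (P.u₀ n), Y u ∈ P.feas n k u ∧
      Y u ∈ P.cellDec lo hi ∧ (∀ i, P.con lo hi x (P.u₀ n) i = 0 → P.con lo hi (Y u) u i = 0) ∧
      ‖Y u - x‖ ≤ K * ‖u - P.u₀ n‖ := by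
  classical
  have hx := h.mem_cellDec
  obtain ⟨b, hb⟩ := h.licq.exists_dual hσ
  let A : Type := {m : P.Row n // P.con lo hi x (P.u₀ n) (.row m) = 0}
  -- `R w` moves along the directions dual to the active rows: to first order it changes row `m` by
  -- `w m`, and it leaves the other active constraints, as well as the total weight, unchanged.
  let R : (A → ℝ) →L[ℝ] Dec k :=
    ∑ m : A, (ContinuousLinearMap.proj (R := ℝ) (φ := fun _ : A => ℝ) m).smulRight (b (.row m.1))
  have hR : ∀ w, R w = ∑ m : A, w m • b (.row m.1) := fun w => by
    simp [R]
  have hRbal : ∀ w, R w ∈ balanced k := fun w => by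
    rw [hR]
    exact Submodule.sum_mem _ fun m _ => Submodule.smul_mem _ _ (hb _ m.2).1
  have hRrow : ∀ w (m : A), dot (P.grad lo hi x (P.u₀ n) (.row m.1)) (R w) = w m := fun w m => by
    rw [hR, dot_sum_smul_right, Finset.sum_eq_single m]
    · rw [(hb _ m.2).2 _ m.2, if_pos rfl, mul_one]
    · intro m' _ hne
      rw [(hb _ m'.2).2 _ m.2, if_neg, mul_zero]
      intro heq
      exact hne (Subtype.ext (Con.row.inj heq).symm)
    · intro hm
      exact absurd (Finset.mem_univ m) hm
  have hRnot : ∀ w (i : P.Con n k), i.NotRow → P.con lo hi x (P.u₀ n) i = 0 →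
      dot (P.grad lo hi x (P.u₀ n) i) (R w) = 0 := fun w i hi' hz => by
    rw [hR, dot_sum_smul_right]
    refine Finset.sum_eq_zero fun m _ => ?_
    rw [(hb _ m.2).2 _ hz, if_neg (hi' m.1), mul_zero]
  have hcell : ∀ {α : Type} {F : Filter α} {w : α → A → ℝ}, Tendsto w F (𝓝 0) →
      ∀ᶠ a in F, x + R (w a) ∈ P.cellDec lo hi := fun {α F w} hw => by
    refine eventually_add_mem_cellDec h.cells (P.u₀ n) hx ?_
      (Eventually.of_forall fun a => hRbal _)
      (Eventually.of_forall fun a i hi' hz => (hRnot _ i hi' hz).ge)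
    have := (R.continuous.tendsto 0).comp hw
    rwa [map_zero] at this
  -- the active rows as functions of the input and of the coordinates along the dual directions
  let H : P.U n × (A → ℝ) → A → ℝ := fun a m => P.con lo hi (x + R a.2) a.1 (.row m.1)
  let ψ : P.U n × (A → ℝ) → Dec k × P.U n := fun a => (x + R a.2, a.1)
  let ψ' : P.U n × (A → ℝ) →L[ℝ] Dec k × P.U n :=
    (R.comp (ContinuousLinearMap.snd ℝ _ _)).prod (ContinuousLinearMap.fst ℝ _ _)
  have hψ0 : ψ (P.u₀ n, 0) = (x, P.u₀ n) := by simp [ψ]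
  have hψd : HasFDerivAt ψ ψ' (P.u₀ n, 0) :=
    ((R.hasFDerivAt.comp (P.u₀ n, (0 : A → ℝ)) hasFDerivAt_snd).const_add x).prodMk hasFDerivAt_fst
  -- A full neighbourhood is mapped into the cell, so derivatives within the cell pull back to
  -- ordinary strict derivatives and the implicit function theorem applies even when `x` lies on the
  -- boundary of the cell.
  have hψmem : ∀ᶠ a in 𝓝 (P.u₀ n, (0 : A → ℝ)), ψ a ∈ P.cellDec lo hi ×ˢ univ := by
    filter_upwards [hcell (F := 𝓝 (P.u₀ n, (0 : A → ℝ))) (w := fun a => a.2)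
      (continuous_snd.tendsto (P.u₀ n, (0 : A → ℝ)))] with a ha
    exact ⟨ha, mem_univ _⟩
  let H' : P.U n × (A → ℝ) →L[ℝ] A → ℝ :=
    ContinuousLinearMap.pi fun m => (P.conDeriv lo hi x (P.u₀ n) (.row m.1)).comp ψ'
  have hH : HasStrictFDerivAt H H' (P.u₀ n, 0) := by
    refine hasStrictFDerivAt_pi.2 fun m => ?_
    obtain ⟨h1, h2⟩ := h.con_differentiable m.2
    rw [← hψ0] at h1 h2
    have hC : ContDiffAt ℝ 1 ((fun a : Dec k × P.U n => P.con lo hi a.1 a.2 (.row m.1)) ∘ ψ)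
        (P.u₀ n, 0) := by
      have h3 := h1.comp (s := ψ ⁻¹' (P.cellDec lo hi ×ˢ univ)) (P.u₀ n, (0 : A → ℝ))
        (ContDiff.contDiffWithinAt (by fun_prop)) (fun a ha => ha)
      exact h3.contDiffAt hψmem
    exact hC.hasStrictFDerivAt' (h2.comp_hasFDerivAt _ hψd hψmem) one_ne_zero
  -- By duality the partial derivative of the active rows in `w` is the identity.
  have hinv : (H' ∘L .inr ℝ (P.U n) (A → ℝ)).IsInvertible := by
    have : H' ∘L .inr ℝ (P.U n) (A → ℝ) =
        (ContinuousLinearEquiv.refl ℝ (A → ℝ) : (A → ℝ) →L[ℝ] A → ℝ) := by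
      refine ContinuousLinearMap.ext fun w => funext fun m => ?_
      change P.conDeriv lo hi x (P.u₀ n) (.row m.1) (R w, 0) = w m
      rw [conDeriv_apply, map_zero, add_zero, hRrow]
    rw [this]
    exact ContinuousLinearMap.isInvertible_equiv
  have hW1 := hH.eventually_apply_implicitFunctionOfProdDomain hinv
  have hW2 := hH.tendsto_implicitFunctionOfProdDomain hinv
  have hW3 := (hH.hasStrictFDerivAt_implicitFunctionOfProdDomain hinv).hasFDerivAt
  set W := hH.implicitFunctionOfProdDomain hinv
  have hW0 : W (P.u₀ n) = 0 := by
    have := (hH.eventually_apply_eq_iff_implicitFunctionOfProdDomain hinv).self_of_nhds.1 rfl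
    exact this
  obtain ⟨K, hK⟩ := hW3.isBigO_sub.bound
  have hYtend : Tendsto (fun u => x + R (W u)) (𝓝 (P.u₀ n)) (𝓝 x) := by
    have := ((R.continuous.tendsto 0).comp hW2).const_add x
    simpa using this
  have hYcell := hcell hW2
  have hYadm : ∀ᶠ u in 𝓝 (P.u₀ n), x + R (W u) ∈ P.admDec k :=
    (tendsto_nhdsWithin_iff.2 ⟨hYtend, hYcell⟩).eventually h.adm_near
  have hinact : ∀ᶠ u in 𝓝 (P.u₀ n), ∀ m : P.Row n, P.con lo hi x (P.u₀ n) (.row m) ≠ 0 →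
      P.con lo hi (x + R (W u)) u (.row m) ≠ 0 ∧
      (0 < P.con lo hi x (P.u₀ n) (.row m) → 0 < P.con lo hi (x + R (W u)) u (.row m)) := by
    refine eventually_all.2 fun m => ?_
    by_cases hm : P.con lo hi x (P.u₀ n) (.row m) = 0
    · exact Eventually.of_forall fun u hu => absurd hm hu
    have hf : ∀ j, Tendsto (fun u : P.U n => P.f n m ((x + R (W u)).2 j) u.2) (𝓝 (P.u₀ n))
        (𝓝 (P.f n m (x.2 j) (P.θ₀ n))) := fun j => by
      refine (h.continuous_inactive m hm j).tendsto.comp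
        (f := fun u : P.U n => ((x + R (W u)).2 j, u.2)) ?_
      refine tendsto_nhdsWithin_iff.2 ⟨?_, ?_⟩
      · refine Tendsto.prodMk_nhds ?_ (continuous_snd.tendsto (P.u₀ n))
        exact ((continuous_apply j).tendsto x.2).comp ((continuous_snd.tendsto x).comp hYtend)
      · filter_upwards [hYcell] with u hu
        exact ⟨hu.2 j, mem_univ _⟩
    have hc : Tendsto (fun u : P.U n => P.con lo hi (x + R (W u)) u (.row m)) (𝓝 (P.u₀ n))
        (𝓝 (P.con lo hi x (P.u₀ n) (.row m))) := by
      refine Tendsto.sub ?_ (tendsto_finsetSum _ fun j _ => Tendsto.mul ?_ (hf j))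
      · exact ((continuous_apply m).tendsto _).comp (continuous_fst.tendsto (P.u₀ n))
      · exact ((continuous_apply j).tendsto x.1).comp ((continuous_fst.tendsto x).comp hYtend)
    by_cases hpos : 0 < P.con lo hi x (P.u₀ n) (.row m)
    · filter_upwards [hc.eventually (lt_mem_nhds hpos)] with u hu _
      exact ⟨hu.ne', fun _ => hu⟩
    · filter_upwards [hc.eventually_ne hm] with u hu _
      exact ⟨hu, fun h' => absurd h' hpos⟩
  have hx0 := (mem_feas_iff (lo := lo) (hi := hi)).1 h.kkt.1
  refine ⟨fun u => x + R (W u), ‖R‖ * K, ?_⟩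
  filter_upwards [hW1, hK, hYcell, hYadm, hinact] with u h1 h2 h3 h4 h5
  have hrow : ∀ m : P.Row n, P.con lo hi x (P.u₀ n) (.row m) = 0 →
      P.con lo hi (x + R (W u)) u (.row m) = 0 := fun m hm => by
    have e1 := congrFun h1 ⟨m, hm⟩
    have e2 : H (P.u₀ n, 0) ⟨m, hm⟩ = 0 := by
      change P.con lo hi (x + R 0) (P.u₀ n) (.row m) = 0
      rw [map_zero, add_zero, hm]
    exact e1.trans e2
  refine ⟨(mem_feas_iff (lo := lo) (hi := hi)).2 ⟨h4, fun i => hrow _ (hx0.2.1 i), fun i => ?_⟩, h3, fun i hi' => ?_, ?_⟩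
  · by_cases hm : P.con lo hi x (P.u₀ n) (.row (.inr i)) = 0
    · exact (hrow _ hm).ge
    · exact ((h5 _ hm).2 (lt_of_le_of_ne (hx0.2.2 i) (Ne.symm hm))).le
  · by_cases hnr : i.NotRow
    · rw [con_add hnr, (con_eq_of_notRow hnr u (P.u₀ n)).trans hi', zero_add]
      have := hRnot (W u) i hnr hi'
      cases i with
      | row m => exact absurd rfl (hnr m)
      | _ => exact this
    · obtain ⟨m, rfl⟩ : ∃ m, i = .row m := Con.exists_of_not_notRow hnr
      exact hrow m hi'
  · rw [add_sub_cancel_left]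
    rw [hW0, sub_zero] at h2
    calc ‖R (W u)‖ ≤ ‖R‖ * ‖W u‖ := R.le_opNorm _
      _ ≤ ‖R‖ * (K * ‖u - P.u₀ n‖) := by gcongr
      _ = _ := by ring

end Regular

end Setup

lemma Goal.sign_mul_self (s : Goal) : s.sign * s.sign = 1 := by cases s <;> simp [Goal.sign]

lemma Goal.abs_sign (s : Goal) : |s.sign| = 1 := by cases s <;> simp [Goal.sign]

/-! ### Optimizers for perturbed inputs and the derivative of the value -/

namespace Setup

variable {P : Setup} {n k : ℕ} {lo hi : Fin k → ℝ} {x : Dec k} {r₀ L : ℝ}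

lemma IsOptimizer.value_eq {s : Goal} {u : P.U n} {π : unitInterval} {q : P.PM}
    (h : P.IsOptimizer s n k u π q x) : P.V s n k u π q = P.Φ k π q x := by
  cases s with
  | min =>
    refine IsLeast.csInf_eq ⟨mem_image_of_mem _ h.1, ?_⟩
    rintro _ ⟨y, hy, rfl⟩
    have := h.2 y hy
    simp only [Goal.sign] at this
    linarith
  | max =>
    refine IsGreatest.csSup_eq ⟨mem_image_of_mem _ h.1, ?_⟩
    rintro _ ⟨y, hy, rfl⟩
    have := h.2 y hy
    simp only [Goal.sign] at this
    linarith

lemma LipschitzObjective.abs_Φ_sub_le_norm (hL : P.LipschitzObjective r₀ L) {π : unitInterval}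
    {q : P.PM} (hπ : P.near r₀ π q) {x y : Dec k} (hx : x ∈ P.admDec k) (hy : y ∈ P.admDec k) :
    |P.Φ k π q x - P.Φ k π q y| ≤ |L| * (P.yHi - P.yLo + 1) * (k + 1) * ‖x - y‖ := by
  refine (hL.abs_Φ_sub_le hπ hx hy).trans ?_
  have hd := sub_pos.2 P.yLo_lt_yHi
  have h1 : ∑ j, |x.1 j - y.1 j| ≤ k * ‖x - y‖ := by
    have := Finset.sum_le_card_nsmul Finset.univ (fun j => |x.1 j - y.1 j|) ‖x - y‖ fun j _ =>
      (norm_le_pi_norm (x.1 - y.1) j).trans (norm_fst_le (x - y))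
    simpa using this
  have h2 : ‖x.2 - y.2‖ ≤ ‖x - y‖ := norm_snd_le (x - y)
  rw [mul_assoc _ ((k : ℝ) + 1)]
  refine mul_le_mul_of_nonneg_left (by linarith) ?_
  have := abs_nonneg L
  positivity

lemma LipschitzObjective.continuousOn_Φ (hL : P.LipschitzObjective r₀ L) {π : unitInterval}
    {q : P.PM} (hπ : P.near r₀ π q) : ContinuousOn (P.Φ k π q) (P.admDec k) := by
  refine (LipschitzOnWith.of_dist_le_mul
    (K := Real.toNNReal (|L| * (P.yHi - P.yLo + 1) * (k + 1))) fun y hy z hz => ?_).continuousOn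
  rw [Real.dist_eq, dist_eq_norm]
  refine (hL.abs_Φ_sub_le_norm hπ hy hz).trans ?_
  gcongr
  exact Real.le_coe_toNNReal _

/-- Used to pass between all constraints and the active ones, to which the sensitivity argument is
restricted. -/
lemma sum_active {l F : P.Con n k → ℝ} {p : P.Con n k → Prop} [DecidablePred p]
    (hl : ∀ i, ¬ p i → l i = 0) : ∑ i : {i // p i}, l i * F i = ∑ i, l i * F i :=
  Fintype.sum_of_injective Subtype.val Subtype.val_injective _ _
    (fun i hi' => by rw [hl i fun h => hi' ⟨⟨i, h⟩, rfl⟩, zero_mul]) fun _ => rfl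

section Regular

variable {s : Goal} {π : unitInterval} {q : P.PM} {r ε σ κ B : ℝ} {l : P.Con n k → ℝ}

/-- The feasible set at `u` is a slice of a compact set, and the objective is Lipschitz, hence
continuous, on it. -/
lemma RegularAt.exists_optimizer (h : P.RegularAt s n k π q r ε σ κ B lo hi x l)
    (hL : P.LipschitzObjective r₀ L) (hπ : P.near r₀ π q) {u : P.U n}
    (hu : u ∈ Metric.closedBall (P.u₀ n) r) : ∃ y, P.IsOptimizer s n k u π q y := by
  have hcomp : IsCompact (P.feas n k u) := by
    have h1 := (h.compact.inter_right (isClosed_singleton.preimage continuous_fst :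
      IsClosed (Prod.fst ⁻¹' {u} : Set (P.U n × Dec k)))).image continuous_snd
    convert h1 using 1
    ext y
    constructor
    · intro hy
      exact ⟨(u, y), ⟨⟨hu, hy⟩, rfl⟩, rfl⟩
    · rintro ⟨⟨v, y⟩, ⟨⟨-, hy⟩, hv⟩, rfl⟩
      rw [mem_preimage, mem_singleton_iff] at hv
      simp only at hv hy ⊢
      rwa [← hv]
  have hcont : ContinuousOn (fun y => s.sign * P.Φ k π q y) (P.feas n k u) :=
    ContinuousOn.const_mul ((hL.continuousOn_Φ hπ).mono fun y hy => ⟨hy.1, hy.2.1⟩) s.sign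
  obtain ⟨y, hy, hmax⟩ := hcomp.exists_isMaxOn (h.nonempty u hu) hcont
  exact ⟨y, hy, fun z hz => hmax hz⟩

/-- Optimizers for inputs that converge to `u*` converge to `x`. -/
lemma RegularAt.tendsto_optimizer (h : P.RegularAt s n k π q r ε σ κ B lo hi x l)
    (hL : P.LipschitzObjective r₀ L) (hπ : P.near r₀ π q) (hr : 0 < r) {us : ℕ → P.U n}
    (hus : Tendsto us atTop (𝓝 (P.u₀ n))) {xs ys : ℕ → Dec k}
    (hxs : ∀ᶠ m in atTop, P.IsOptimizer s n k (us m) π q (xs m))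
    (hys : ∀ᶠ m in atTop, ys m ∈ P.feas n k (us m)) (hy : Tendsto ys atTop (𝓝 x)) :
    Tendsto xs atTop (𝓝 x) := by
  rw [tendsto_iff_ultrafilter]
  intro G hG
  have hball : ∀ᶠ m in atTop, us m ∈ Metric.closedBall (P.u₀ n) r :=
    hus.eventually (Metric.closedBall_mem_nhds _ hr)
  have hmem : ∀ᶠ m in (G : Filter ℕ), (us m, xs m) ∈ {a : P.U n × Dec k |
      a.1 ∈ Metric.closedBall (P.u₀ n) r ∧ a.2 ∈ P.feas n k a.1} := by
    filter_upwards [hG hball, hG hxs] with m h1 h2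
    exact ⟨h1, h2.1⟩
  obtain ⟨⟨v, y⟩, ⟨-, hyf⟩, hlim⟩ := h.compact.ultrafilter_le_nhds
    (G.map fun m => (us m, xs m)) (le_principal_iff.2 hmem)
  have hlim' : Tendsto (fun m => (us m, xs m)) G (𝓝 (v, y)) := hlim
  have hv : v = P.u₀ n :=
    tendsto_nhds_unique ((continuous_fst.tendsto _).comp hlim') (hus.mono_left hG)
  have hxy : Tendsto xs G (𝓝 y) := (continuous_snd.tendsto _).comp hlim'
  simp only [hv] at hyf
  have hadm : ∀ {u : P.U n} {z : Dec k}, z ∈ P.feas n k u → z ∈ P.admDec k :=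
    fun hz => ⟨hz.1, hz.2.1⟩
  have hΦx : Tendsto (fun m => P.Φ k π q (xs m)) G (𝓝 (P.Φ k π q y)) :=
    (hL.continuousOn_Φ hπ y (hadm hyf)).tendsto.comp
      (tendsto_nhdsWithin_iff.2 ⟨hxy, (hxs.filter_mono hG).mono fun m hm => hadm hm.1⟩)
  have hΦy : Tendsto (fun m => P.Φ k π q (ys m)) G (𝓝 (P.Φ k π q x)) :=
    (hL.continuousOn_Φ hπ x (hadm h.kkt.1)).tendsto.comp
      (tendsto_nhdsWithin_iff.2 ⟨hy.mono_left hG, (hys.filter_mono hG).mono fun m hm => hadm hm⟩)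
  -- Each `xs m` does at least as well as the feasible `ys m`, which tends to `x`. So the limit `y`,
  -- feasible at `u*`, is optimal and equals `x` by uniqueness.
  have hle : s.sign * P.Φ k π q x ≤ s.sign * P.Φ k π q y := by
    refine le_of_tendsto_of_tendsto (hΦy.const_mul _) (hΦx.const_mul _) ?_
    filter_upwards [hG hxs, hG hys] with m h1 h2
    exact h1.2 _ h2
  have := h.unique_optimizer y ⟨hyf, fun z hz => (h.optimizer.2 z hz).trans hle⟩
  rwa [this] at hxy

lemma RegularAt.eventually_mem_cellDec (h : P.RegularAt s n k π q r ε σ κ B lo hi x l)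
    {us : ℕ → P.U n} (hus : Tendsto us atTop (𝓝 (P.u₀ n))) {xs : ℕ → Dec k}
    (hxs : Tendsto xs atTop (𝓝 x)) (hf : ∀ᶠ m in atTop, xs m ∈ P.feas n k (us m)) :
    ∀ᶠ m in atTop, xs m ∈ P.cellDec lo hi := by
  filter_upwards [(hus.prodMk_nhds hxs).eventually h.cells_local, hf] with m h1 h2
  exact ⟨h2.1, h1 h2⟩

/-- Hadamard directional derivative of the value in the input. -/
lemma RegularAt.hasHadamardDirDeriv_value (h : P.RegularAt s n k π q r ε σ κ B lo hi x l)
    (hL : P.LipschitzObjective r₀ L) (hπ : P.near r₀ π q) (hr : 0 < r) (hσ : 0 < σ) (hκ : 0 < κ) :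
    HasHadamardDirDeriv (fun u : P.U n => u) (fun u => P.V s n k u π q) (P.u₀ n)
      (fun w => ∑ i, l i * P.conInputDeriv x (P.u₀ n) i w) := by
  classical
  intro t us w ht ht0 hq
  have hx := h.mem_cellDec
  have hSc := P.convex_cellDec lo hi
  have husub := tendsto_of_quotient (e := fun u : P.U n => u) ht ht0 hq
  have hus : Tendsto us atTop (𝓝 (P.u₀ n)) := by simpa using husub.add_const (P.u₀ n)
  obtain ⟨Y, K, hY⟩ := h.exists_path hσ
  have hYm := hus.eventually hY
  obtain ⟨Φ', hΦ', hstat⟩ := h.kkt.2.2.2.2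
  -- the optimizers along the perturbation
  have hopt : ∀ m, ∃ y, us m ∈ Metric.closedBall (P.u₀ n) r → P.IsOptimizer s n k (us m) π q y :=
    fun m => by
      by_cases hm : us m ∈ Metric.closedBall (P.u₀ n) r
      · obtain ⟨y, hy⟩ := h.exists_optimizer hL hπ hm
        exact ⟨y, fun _ => hy⟩
      · exact ⟨x, fun h' => absurd h' hm⟩
  choose xs hxs using hopt
  have hxs' : ∀ᶠ m in atTop, P.IsOptimizer s n k (us m) π q (xs m) :=
    (hus.eventually (Metric.closedBall_mem_nhds _ hr)).mono fun m hm => hxs m hm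
  have hYtend : Tendsto (fun m => Y (us m)) atTop (𝓝 x) := by
    rw [tendsto_iff_norm_sub_tendsto_zero]
    have : Tendsto (fun m => K * ‖us m - P.u₀ n‖) atTop (𝓝 0) := by
      simpa using husub.norm.const_mul K
    exact squeeze_zero' (Eventually.of_forall fun m => norm_nonneg _)
      (hYm.mono fun m hm => hm.2.2.2) this
  have hxtend := h.tendsto_optimizer hL hπ hr hus hxs' (hYm.mono fun m hm => hm.1) hYtend
  have hxS := h.eventually_mem_cellDec hus hxtend (hxs'.mono fun m hm => hm.1)
  -- second-order expansion of the Lagrangian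
  have hlagd := h.hasFDeriv_lagrangian hΦ'
  obtain ⟨Q, hQ⟩ := taylor_two_within hSc hx h.contDiff_lagrangian hlagd
  -- Differences of cell points are balanced, so stationarity removes the linear term from the
  -- expansion of the Lagrangian.
  have hstat' : ∀ v ∈ balanced k, (Φ' + ∑ i, l i • dotL (P.grad lo hi x (P.u₀ n) i)) v = 0 :=
    fun v hv => by
      rw [_root_.add_apply, _root_.sum_apply]
      exact hstat v (mem_balanced.1 hv)
  have hl0 : ∀ i, ¬ P.con lo hi x (P.u₀ n) i = 0 → s.sign * l i = 0 := fun i hi' => by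
    rw [h.mult_eq_zero hi', mul_zero]
  have hlag : ∀ y, s.sign * P.Φ k π q y +
      ∑ i : {i // P.con lo hi x (P.u₀ n) i = 0}, (s.sign * l i) * P.con lo hi y (P.u₀ n) i =
      s.sign * P.lagrangian (P.u₀ n) π q lo hi l y := fun y => by
    rw [sum_active (l := fun i => s.sign * l i) (F := fun i => P.con lo hi y (P.u₀ n) i) hl0,
      lagrangian, mul_add, Finset.mul_sum]
    simp only [mul_assoc]
  obtain ⟨b, hb⟩ : ∃ b, ∀ᶠ m in atTop, ‖(t m)⁻¹ • (us m - P.u₀ n)‖ ≤ b :=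
    ⟨‖w‖ + 1, hq.norm.eventually (ge_mem_nhds (by linarith))⟩
  -- Objective, multipliers and quadratic form are all multiplied by the sign, which turns both
  -- goals into maximization with nonnegative inequality multipliers; only active constraints are
  -- kept.
  have key := tendsto_value_quotient (E := Dec k) (U := P.U n) hSc hx (balanced k)
    (fun y hy => sub_mem_balanced hx hy) (u₀ := P.u₀ n) (φ := fun y => s.sign * P.Φ k π q y)
    (φ' := s.sign • Φ') (by simpa using hΦ'.const_mul s.sign)
    (c := fun (i : {i // P.con lo hi x (P.u₀ n) i = 0}) a => P.con lo hi a.1 a.2 i.1)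
    (c' := fun i => P.conDeriv lo hi x (P.u₀ n) i.1) (fun i => i.2)
    (fun i => (h.con_differentiable i.2).1) (fun i => (h.con_differentiable i.2).2)
    (l := fun i => s.sign * l i.1) (eq := fun i => i.1.IsEq) (Q := s.sign • Q)
    (fun ε hε => by
      filter_upwards [hQ ε hε, self_mem_nhdsWithin] with y hy hyS
      rw [hstat' _ (sub_mem_balanced hx hyS), sub_zero] at hy
      rw [hlag, hlag]
      have e : s.sign * P.lagrangian (P.u₀ n) π q lo hi l y -
          s.sign * P.lagrangian (P.u₀ n) π q lo hi l x - (s.sign • Q) (y - x) (y - x) / 2 =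
          s.sign * (P.lagrangian (P.u₀ n) π q lo hi l y -
            P.lagrangian (P.u₀ n) π q lo hi l x - Q (y - x) (y - x) / 2) := by
        simp only [_root_.smul_apply, smul_eq_mul]
        ring
      rw [e, abs_mul, s.abs_sign, one_mul]
      exact hy)
    (fun i hi' => h.kkt.2.2.1 i.1 hi')
    (fun v hv => by
      have h1 := hstat v (mem_balanced.1 hv)
      simp only [conDeriv_apply, map_zero, add_zero]
      rw [sum_active (l := fun i => s.sign * l i)
        (F := fun i => dot (P.grad lo hi x (P.u₀ n) i) v) hl0]
      simp only [_root_.smul_apply, smul_eq_mul, mul_assoc, ← Finset.mul_sum]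
      rw [← mul_add, h1, mul_zero])
    (fun d hd hd0 hcone => by
      simp only [conDeriv_apply, map_zero, add_zero] at hcone
      have hcrit : d ∈ P.criticalCone (P.u₀ n) lo hi x l :=
        ⟨mem_balanced.1 hd, fun i hi' => ⟨(hcone ⟨i, hi'⟩).1, fun hor =>
          (hcone ⟨i, hi'⟩).2 (hor.imp id fun hli => by
            refine mul_ne_zero ?_ hli
            intro h0
            have := s.sign_mul_self
            rw [h0] at this
            norm_num at this)⟩⟩
      -- Critical directions point into the cell, so the second derivative along the ray in SOSC is
      -- the value of `Q`.
      have hray : ∀ᶠ τ : ℝ in 𝓝[≥] 0, x + τ • d ∈ P.cellDec lo hi := by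
        refine eventually_add_mem_cellDec h.cells (P.u₀ n) hx (ψ := fun τ : ℝ => τ • d) ?_
          (Eventually.of_forall fun τ => Submodule.smul_mem _ _ hd) ?_
        · have : Continuous fun τ : ℝ => τ • d := by fun_prop
          have h2 := (this.tendsto 0).mono_left (nhdsWithin_le_nhds (s := Ici (0 : ℝ)))
          rwa [zero_smul] at h2
        · filter_upwards [self_mem_nhdsWithin] with τ hτ i _ hi'
          rw [dot_smul_right]
          exact mul_nonneg hτ (hcone ⟨i, hi'⟩).1
      have h3 := h.sosc d hcrit
      rw [iteratedDerivWithin_two_ray h.contDiff_lagrangian hQ hray] at h3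
      have h4 : 0 < dot d d := lt_of_lt_of_le (by positivity) (norm_sq_le_dot_self d)
      simp only [_root_.smul_apply, smul_eq_mul]
      nlinarith [mul_pos hκ h4])
    ht ht0 hq hxtend hxS
    (by
      filter_upwards [hxS, hxs'] with m hm1 hm2 i
      have hf := (mem_feas_iff (lo := lo) (hi := hi)).1 hm2.1
      obtain ⟨i, hi'⟩ := i
      by_cases hnr : i.NotRow
      · refine ⟨((mem_cellDec_iff h.cells (us m)).1 hm1).2 i hnr, fun he => ?_⟩
        cases i with
        | row j => exact absurd rfl (hnr j)
        | _ => exact he.elim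
      · obtain ⟨j, rfl⟩ := Con.exists_of_not_notRow hnr
        cases j with
        | inl j => exact ⟨(hf.2.1 j).ge, fun _ => hf.2.1 j⟩
        | inr j => exact ⟨hf.2.2 j, fun he => he.elim⟩)
    (ys := fun m => Y (us m)) (K := |K| * b)
    (by
      filter_upwards [hYm, hb] with m hm hbm
      have htm := ht m
      rw [norm_smul, norm_inv, Real.norm_of_nonneg htm.le, inv_mul_le_iff₀ htm] at hbm
      calc ‖Y (us m) - x‖ ≤ K * ‖us m - P.u₀ n‖ := hm.2.2.2
        _ ≤ |K| * ‖us m - P.u₀ n‖ := by gcongr; exact le_abs_self K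
        _ ≤ |K| * (t m * b) := by gcongr
        _ = _ := by ring)
    (hYm.mono fun m hm => hm.2.1) (hYm.mono fun m hm i => hm.2.2.1 i.1 i.2)
    (by
      filter_upwards [hYm, hxs'] with m h1 h2
      exact h2.2 _ h1.1)
  -- back to the value
  have key2 := key.const_mul s.sign
  have hlim : s.sign * ∑ i : {i // P.con lo hi x (P.u₀ n) i = 0},
      s.sign * l i.1 * P.conDeriv lo hi x (P.u₀ n) i.1 (0, w) =
      ∑ i, l i * P.conInputDeriv x (P.u₀ n) i w := by
    rw [sum_active (l := fun i => s.sign * l i)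
      (F := fun i => P.conDeriv lo hi x (P.u₀ n) i (0, w)) hl0, Finset.mul_sum]
    refine Finset.sum_congr rfl fun i _ => ?_
    have e0 : dot (P.grad lo hi x (P.u₀ n) i) 0 = 0 := by simp [dot]
    rw [conDeriv_apply, e0, zero_add, ← mul_assoc, ← mul_assoc, s.sign_mul_self, one_mul]
  rw [hlim] at key2
  refine key2.congr' ?_
  filter_upwards [hxs'] with m hm
  rw [hm.value_eq, h.optimizer.value_eq]
  have := s.sign_mul_self
  linear_combination ((t m)⁻¹ * (P.Φ k π q (xs m) - P.Φ k π q x)) * this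

/-! ### Bounds on the multipliers and on the derivative, uniform in `n` -/

/-- The derivative of the objective is bounded on balanced directions by a Lipschitz constant. -/
lemma RegularAt.abs_fderiv_le (h : P.RegularAt s n k π q r ε σ κ B lo hi x l) (hσ : 0 < σ)
    {K : ℝ} (hK : ∀ y ∈ P.admDec k, ∀ z ∈ P.admDec k,
      |P.Φ k π q y - P.Φ k π q z| ≤ K * ‖y - z‖) {Φ' : Dec k →L[ℝ] ℝ}
    (hΦ' : HasFDerivWithinAt (P.Φ k π q) Φ' (P.cellDec lo hi) x) {v : Dec k}
    (hv : v ∈ balanced k) : |Φ' v| ≤ K * ‖v‖ := by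
  classical
  have hx := h.mem_cellDec
  obtain ⟨b, hb⟩ := h.licq.exists_dual hσ
  -- A balanced `v` need not point into the cell. The direction `d` has product `1` with every
  -- active gradient, so `d` and `d + e • v` both point inward for small `e`, and comparing the
  -- objective along these two rays isolates `Φ' v`.
  set d : Dec k := ∑ a : {a // P.con lo hi x (P.u₀ n) a = 0}, (1 : ℝ) • b a.1 with hd
  have hdbal : d ∈ balanced k :=
    Submodule.sum_mem _ fun a _ => Submodule.smul_mem _ _ (hb _ a.2).1
  have hdgrad : ∀ i, P.con lo hi x (P.u₀ n) i = 0 → dot (P.grad lo hi x (P.u₀ n) i) d = 1 := by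
    intro i hi'
    rw [hd, dot_sum_smul_right, Finset.sum_eq_single ⟨i, hi'⟩]
    · rw [(hb i hi').2 i hi', if_pos rfl, mul_one]
    · intro a _ hne
      rw [(hb _ a.2).2 i hi', if_neg, mul_zero]
      intro heq
      exact hne (Subtype.ext heq.symm)
    · intro hm
      exact absurd (Finset.mem_univ _) hm
  obtain ⟨e, he, hesmall⟩ : ∃ e : ℝ, 0 < e ∧ ∀ i, 0 ≤ 1 + e * dot (P.grad lo hi x (P.u₀ n) i) v := by
    have hev : ∀ᶠ e : ℝ in 𝓝[>] 0, ∀ i, 0 ≤ 1 + e * dot (P.grad lo hi x (P.u₀ n) i) v := by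
      refine eventually_all.2 fun i => ?_
      have hc : Continuous fun e : ℝ => 1 + e * dot (P.grad lo hi x (P.u₀ n) i) v := by fun_prop
      have := (hc.tendsto 0).mono_left (nhdsWithin_le_nhds (s := Ioi (0 : ℝ)))
      rw [zero_mul, add_zero] at this
      exact this.eventually (le_mem_nhds one_pos)
    obtain ⟨e, h1, h2⟩ := ((eventually_mem_nhdsWithin (a := (0 : ℝ)) (s := Ioi 0)).and hev).exists
    exact ⟨e, h1, h2⟩
  have hray : ∀ z ∈ balanced k,
      (∀ i, P.con lo hi x (P.u₀ n) i = 0 → 0 ≤ dot (P.grad lo hi x (P.u₀ n) i) z) →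
      (∀ᶠ τ : ℝ in 𝓝[>] 0, x + τ • z ∈ P.admDec k) ∧
      Tendsto (fun τ : ℝ => τ⁻¹ * (P.Φ k π q (x + τ • z) - P.Φ k π q x)) (𝓝[>] 0) (𝓝 (Φ' z)) := by
    intro z hz hzg
    have h0 : Tendsto (fun τ : ℝ => τ • z) (𝓝[>] 0) (𝓝 0) := by
      have : Continuous fun τ : ℝ => τ • z := by fun_prop
      have h2 := (this.tendsto 0).mono_left (nhdsWithin_le_nhds (s := Ioi (0 : ℝ)))
      rwa [zero_smul] at h2
    have hS : ∀ᶠ τ : ℝ in 𝓝[>] 0, x + τ • z ∈ P.cellDec lo hi := by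
      refine eventually_add_mem_cellDec h.cells (P.u₀ n) hx (ψ := fun τ : ℝ => τ • z) h0
        (Eventually.of_forall fun τ => Submodule.smul_mem _ _ hz) ?_
      filter_upwards [self_mem_nhdsWithin] with τ hτ i _ hi'
      rw [dot_smul_right]
      exact mul_nonneg (le_of_lt hτ) (hzg i hi')
    refine ⟨?_, ?_⟩
    · refine Tendsto.eventually (tendsto_nhdsWithin_iff.2 ⟨?_, hS⟩) h.adm_near
      simpa using h0.const_add x
    · have := hΦ'.lim (l := 𝓝[>] (0 : ℝ)) (c := fun τ => τ⁻¹) (d := fun τ : ℝ => τ • z) (v := z)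
        h0 hS (tendsto_const_nhds.congr' (by
          filter_upwards [self_mem_nhdsWithin] with τ hτ
          rw [smul_smul, inv_mul_cancel₀ (ne_of_gt hτ), one_smul]))
      simpa using this
  obtain ⟨ha1, hl1⟩ := hray d hdbal fun i hi' => by rw [hdgrad i hi']; exact zero_le_one
  obtain ⟨ha2, hl2⟩ := hray (d + e • v) (add_mem hdbal (Submodule.smul_mem _ _ hv)) fun i hi' => by
    rw [dot_add_right, dot_smul_right, hdgrad i hi']
    exact hesmall i
  have hlim := (hl2.sub hl1).abs
  have hbd : |Φ' (d + e • v) - Φ' d| ≤ K * (e * ‖v‖) := by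
    refine le_of_tendsto hlim ?_
    filter_upwards [ha1, ha2, self_mem_nhdsWithin] with τ h1 h2 hτ
    have hτ0 : (0 : ℝ) < τ := hτ
    have h3 := hK _ h2 _ h1
    have h4 : x + τ • (d + e • v) - (x + τ • d) = (τ * e) • v := by
      rw [smul_add, smul_smul]; abel
    rw [h4, norm_smul, Real.norm_of_nonneg (by positivity)] at h3
    rw [← mul_sub, sub_sub_sub_cancel_right, abs_mul, abs_of_pos (inv_pos.2 hτ0),
      inv_mul_le_iff₀ hτ0]
    linarith
  rw [map_add, add_sub_cancel_left, map_smul, smul_eq_mul, abs_mul, abs_of_pos he] at hbd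
  have : e * |Φ' v| ≤ e * (K * ‖v‖) := by linarith
  exact le_of_mul_le_mul_left this he

/-- A bound on the multipliers. -/
lemma RegularAt.abs_mult_le (h : P.RegularAt s n k π q r ε σ κ B lo hi x l) (hσ : 0 < σ)
    {K : ℝ} (hK0 : 0 ≤ K) (hK : ∀ y ∈ P.admDec k, ∀ z ∈ P.admDec k,
      |P.Φ k π q y - P.Φ k π q z| ≤ K * ‖y - z‖) (i : P.Con n k) : |l i| ≤ K / σ := by
  obtain ⟨Φ', hΦ', hstat⟩ := h.kkt.2.2.2.2
  have hk : (k : ℝ) ≠ 0 := by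
    rintro hk
    have hk0 : k = 0 := by exact_mod_cast hk
    subst hk0
    have := h.mem_cellDec.1.2.1
    simp at this
  set G : Dec k := ∑ i, l i • P.grad lo hi x (P.u₀ n) i with hG
  -- This multiplier of the constraint on the total weight makes `T` balanced, so that stationarity
  -- can be tested at `T` itself.
  set w₀ : ℝ := -(∑ j, G.1 j) / k with hw₀
  set T : Dec k := w₀ • ((fun _ => 1, 0) : Dec k) + G with hT
  have hTbal : ∑ j, T.1 j = 0 := by
    simp only [hT, Prod.fst_add, Prod.smul_fst, Pi.add_apply, Pi.smul_apply, smul_eq_mul, mul_one,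
      Finset.sum_add_distrib, Finset.sum_const, Finset.card_univ, Fintype.card_fin, nsmul_eq_mul]
    rw [hw₀]
    field_simp
    ring
  have hle := h.licq w₀ l fun i hi' => by
    by_contra hne
    exact hi' (h.mult_eq_zero hne)
  rw [← hG, ← hT] at hle
  -- Together with the bound on `Φ'` this gives `dot T T ≤ K ‖T‖`, hence `dot T T ≤ K ^ 2`; LICQ
  -- turns it into a bound on the multipliers.
  have hTT : dot T T = -Φ' T := by
    have h1 := hstat T hTbal
    have h2 : dot T T = dot G T := by
      conv_lhs => rw [hT, dot_add_left, dot_smul_left, dot_one, ← hT, hTbal]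
      ring
    have h3 : dot G T = ∑ i, l i * dot (P.grad lo hi x (P.u₀ n) i) T := by
      rw [hG, dot_sum_smul_left]
    linarith
  have hbd : dot T T ≤ K * ‖T‖ := by
    rw [hTT]
    exact (neg_le_abs _).trans (h.abs_fderiv_le hσ hK hΦ' (mem_balanced.2 hTbal))
  have hsq := norm_sq_le_dot_self T
  have hTK : dot T T ≤ K ^ 2 := by
    have hn := norm_nonneg T
    have : ‖T‖ ≤ K := by
      by_contra hcon
      nlinarith
    nlinarith
  have hli : l i ^ 2 ≤ ∑ i, l i ^ 2 :=
    Finset.single_le_sum (f := fun i => l i ^ 2) (fun i _ => sq_nonneg _) (Finset.mem_univ i)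
  have h5 : (σ * |l i|) ^ 2 ≤ K ^ 2 := by
    rw [mul_pow, sq_abs]
    nlinarith [sq_nonneg w₀, sq_nonneg σ, mul_le_mul_of_nonneg_left hli (sq_nonneg σ),
      mul_nonneg (sq_nonneg σ) (sq_nonneg w₀)]
  rw [le_div_iff₀ hσ, mul_comm]
  exact (le_abs_self _).trans (sq_le_sq.1 h5 |>.trans (abs_of_nonneg hK0).le)

/-- The differentiability condition on rows bounds their derivative in the input. -/
lemma RegularAt.norm_inputDeriv_le (h : P.RegularAt s n k π q r ε σ κ B lo hi x l) {i : P.Row n}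
    (hi' : l (.row i) ≠ 0) : ‖P.inputDeriv x (P.u₀ n) i‖ ≤ B := by
  obtain ⟨A, hA, hAd⟩ := h.rows_differentiable i hi'
  have hact : P.con lo hi x (P.u₀ n) (.row i) = 0 := by
    by_contra hne
    exact hi' (h.mult_eq_zero hne)
  -- Both linear maps are the limit of the same difference quotients along the straight path `u* + w
  -- / (m + 1)`.
  suffices heq : P.inputDeriv x (P.u₀ n) i = A by rwa [heq]
  refine ContinuousLinearMap.ext fun w => ?_
  have ht : ∀ m : ℕ, (0 : ℝ) < 1 / (m + 1) := fun m => Nat.one_div_pos_of_nat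
  have ht0 : Tendsto (fun m : ℕ => (1 : ℝ) / (m + 1)) atTop (𝓝 0) :=
    tendsto_one_div_add_atTop_nhds_zero_nat
  have hq : Tendsto (fun m : ℕ => ((1 : ℝ) / (m + 1))⁻¹ •
      ((P.u₀ n + ((1 : ℝ) / (m + 1)) • w) - P.u₀ n)) atTop (𝓝 w) := by
    refine tendsto_const_nhds.congr fun m => ?_
    rw [add_sub_cancel_left, smul_smul, inv_mul_cancel₀ (ht m).ne', one_smul]
  have h1 := hAd _ _ w ht ht0 hq
  have h2 := tendsto_partial_quotient (P.convex_cellDec lo hi) h.mem_cellDec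
    (h.con_differentiable hact).1 (h.con_differentiable hact).2 ht ht0 hq
    (tendsto_const_nhds (x := x)) (Eventually.of_forall fun _ => h.mem_cellDec)
  have h3 := tendsto_nhds_unique h2 h1
  rw [conDeriv_apply] at h3
  have e0 : dot (P.grad lo hi x (P.u₀ n) (.row i)) 0 = 0 := by simp [dot]
  rw [e0, zero_add] at h3
  exact h3

open Classical in
/-- The envelope formula as a continuous linear map. -/
def envelopeL (P : Setup) {n k : ℕ} (x : Dec k) (l : P.Con n k → ℝ) : P.U n →L[ℝ] ℝ :=
  ∑ i : P.Row n with l (.row i) ≠ 0, l (.row i) • P.inputDeriv x (P.u₀ n) i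

lemma envelopeL_apply (x : Dec k) (l : P.Con n k → ℝ) (w : P.U n) :
    P.envelopeL x l w = P.envelope x l w := by
  simp only [envelopeL, envelope, _root_.sum_apply, _root_.smul_apply, smul_eq_mul,
    inputDeriv_apply]
  rfl

/-- Only rows depend on the input, and rows with zero multiplier contribute nothing. -/
lemma envelopeL_eq_sum (x : Dec k) (l : P.Con n k → ℝ) (w : P.U n) :
    P.envelopeL x l w = ∑ i, l i * P.conInputDeriv x (P.u₀ n) i w := by
  classical
  simp only [envelopeL, _root_.sum_apply, _root_.smul_apply, smul_eq_mul]
  rw [Finset.sum_filter]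
  refine Fintype.sum_of_injective (Con.row (P := P) (n := n) (k := k)) (fun a b => Con.row.inj) _ _
    (fun i hi' => ?_) fun i => ?_
  · cases i with
    | row m => exact absurd ⟨m, rfl⟩ hi'
    | _ => exact mul_zero _
  · split_ifs with h0
    · rfl
    · rw [not_not.1 h0, zero_mul]

/-- A row with nonzero multiplier is active, so the sum has at most `2k` terms, each at most `K / σ
* |B|`. -/
lemma RegularAt.norm_envelopeL_le (h : P.RegularAt s n k π q r ε σ κ B lo hi x l) (hσ : 0 < σ)
    {K : ℝ} (hK0 : 0 ≤ K) (hK : ∀ y ∈ P.admDec k, ∀ z ∈ P.admDec k,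
      |P.Φ k π q y - P.Φ k π q z| ≤ K * ‖y - z‖) :
    ‖P.envelopeL x l‖ ≤ (2 * k : ℕ) * (K / σ * |B|) := by
  classical
  have hcard : (Finset.univ.filter fun i : P.Row n => l (.row i) ≠ 0).card ≤ 2 * k := by
    refine le_trans ?_ (h.licq.card_le hσ)
    rw [Fintype.card_subtype]
    refine Finset.card_le_card_of_injOn (fun i => Con.row i) (fun i hi' => ?_)
      (fun a _ b _ hab => Con.row.inj hab)
    have hi'' : l (.row i) ≠ 0 := by simpa using hi'
    have : P.con lo hi x (P.u₀ n) (.row i) = 0 := by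
      by_contra hne
      exact hi'' (h.mult_eq_zero hne)
    simpa using this
  have hKσ : 0 ≤ K / σ * |B| := by positivity
  calc ‖P.envelopeL x l‖
      ≤ (Finset.univ.filter fun i : P.Row n => l (.row i) ≠ 0).card • (K / σ * |B|) := by
        refine norm_sum_le_of_le _ (fun i hi' => ?_) |>.trans (Finset.sum_const _).le
        have hi'' : l (.row i) ≠ 0 := by simpa using hi'
        rw [norm_smul, Real.norm_eq_abs]
        exact mul_le_mul (h.abs_mult_le hσ hK0 hK _)
          ((h.norm_inputDeriv_le hi'').trans (le_abs_self B)) (norm_nonneg _) (by positivity)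
    _ ≤ (2 * k : ℕ) * (K / σ * |B|) := by
        rw [nsmul_eq_mul]
        gcongr

end Regular
end Setup
end SharpBounds
end

theorem mainTheorem9 (P : Setup) (r₀ L : ℝ) (hr₀ : 0 < r₀) (hL : P.LipschitzObjective r₀ L) :
    -- (i) local Lipschitz continuity near optimizers, uniform in `n`, `k` and `(π, q)`
    (∃ K : ℝ, ∃ r > (0 : ℝ), ∀ (s : Goal) (n k : ℕ) (u : P.U n) (π' : unitInterval) (q' : P.PM)
        (xs : Dec k), P.near r₀ π' q' → P.IsOptimizer s n k u π' q' xs →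
      ∀ π q, P.near r₀ π q →
        ∀ x ∈ P.admDec k ∩ Metric.ball xs r, ∀ y ∈ P.admDec k ∩ Metric.ball xs r,
          |P.Φ k π q x - P.Φ k π q y| ≤ K * (∑ j, |x.1 j - y.1 j| + ‖x.2 - y.2‖)) ∧
    -- (ii) Hadamard directional differentiability in `(c, θ)` and the envelope formula
    (P.RegularIntegrands →
      ∀ (s : Goal) (k : ℕ) (π : unitInterval) (q : P.PM), P.near r₀ π q →
      ∀ r > (0 : ℝ), ∀ ε > (0 : ℝ), ∀ σ > (0 : ℝ), ∀ κ > (0 : ℝ), ∀ (B : ℝ)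
        (lo hi : ℕ → Fin k → ℝ) (x : ℕ → Dec k) (l : (n : ℕ) → P.Con n k → ℝ),
        (∀ n, P.RegularAt s n k π q r ε σ κ B (lo n) (hi n) (x n) (l n)) →
      ∃ C : ℝ, ∀ n, ∃ D : P.U n →L[ℝ] ℝ,
        HasHadamardDirDeriv (fun u : P.U n => u) (fun u => P.V s n k u π q) (P.u₀ n) D ∧
        (∀ h, D h = P.envelope (x n) (l n) h) ∧ ‖D‖ ≤ C) ∧
    -- (iii) Hadamard directional differentiability in `π`, in `q`, and in `(π, q)`
    (∀ (s : Goal) (n k : ℕ) (ρ : ℝ), ∀ u ∈ Metric.ball (P.u₀ n) ρ,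
      (UniformHadamardDirDifferentiableAt (fun π : unitInterval => (π : ℝ))
          (fun μ π => P.F μ π P.q₀) (P.nearFeasible n ρ) P.π₀ →
        HadamardDirDifferentiableAt (fun π : unitInterval => (π : ℝ))
          (fun π => P.V s n k u π P.q₀) P.π₀) ∧
      (UniformHadamardDirDifferentiableAt (blEmb : P.PM → BLStar P.Y)
          (fun μ q => P.F μ P.π₀ q) (P.nearFeasible n ρ) P.q₀ →
        HadamardDirDifferentiableAt (blEmb : P.PM → BLStar P.Y)
          (fun q => P.V s n k u P.π₀ q) P.q₀) ∧
      (UniformHadamardDirDifferentiableAt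
          (fun w : unitInterval × P.PM => ((w.1 : ℝ), (blEmb w.2 : BLStar P.Y)))
          (fun μ w => P.F μ w.1 w.2) (P.nearFeasible n ρ) (P.π₀, P.q₀) →
        HadamardDirDifferentiableAt
          (fun w : unitInterval × P.PM => ((w.1 : ℝ), (blEmb w.2 : BLStar P.Y)))
          (fun w => P.V s n k u w.1 w.2) (P.π₀, P.q₀))) := by
  -- The Lipschitz bound holds on all admissible vectors, so the radius `1` is arbitrary.
  refine ⟨⟨|L| * (P.yHi - P.yLo + 1), 1, one_pos, fun s n k u π' q' xs _ _ π q hπ x hx y hy =>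
    hL.abs_Φ_sub_le hπ hx.1 hy.1⟩, ?_, hL.hadamard_parameters hr₀⟩
  intro _ s k π q hπ r hr ε _ σ hσ κ hκ B lo hi x l h
  have hK0 : 0 ≤ |L| * (P.yHi - P.yLo + 1) * (k + 1) := by
    have := sub_pos.2 P.yLo_lt_yHi
    positivity
  -- The constant is the bound of `norm_envelopeL_le`, built from `k`, `σ`, `B`, `L` and the outcome
  -- range, none of which depends on `n`.
  refine ⟨_, fun n => ⟨P.envelopeL (x n) (l n), ?_, Setup.envelopeL_apply (x n) (l n),
    (h n).norm_envelopeL_le hσ hK0 fun y hy z hz => hL.abs_Φ_sub_le_norm hπ hy hz⟩⟩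
  intro t us w ht ht0 hq
  rw [Setup.envelopeL_eq_sum]
  exact (h n).hasHadamardDirDeriv_value hL hπ hr hσ hκ t us w ht ht0 hq
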